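/- **Setting.** Let $N\ge 3$, let indices $n$ run over $\mathbb Z/N\mathbb Z$, and let $k_n,\ell_n$ be positive integers with $k_{n-1}k_{n+1}=\ell_{n-1}\ell_{n+1}$ for all $n$. Let $H^2=\bigoplus_n\big(\mathbb Z H_n\oplus\bigoplus_{-\ell_n\le i\le k_n,\ i\ne0}\mathbb Z E_n^i\big)$, let $H_2$ be the lattice with the corresponding basis $h_n,e_n^i$, and pair them by $\langle H_m,h_n\rangle=\delta_{mn}$, $\langle E_m^i,e_n^j\rangle=-\delta_{mn}\delta_{ij}$, all other pairings of basis elements being $0$. For $-\ell_n<i<k_n$ put $\alpha_n^0=H_n-E_n^1-E_n^{-1}$, $\check\alpha_n^0=h_{n-1}+h_{n+1}-e_n^1-e_n^{-1}$, $\alpha_n^{\pm i}=E_n^{\pm i}-E_n^{\pm(i+1)}$, $\check\alpha_n^{\pm i}=e_n^{\pm i}-e_n^{\pm(i+1)}$ ($i>0$). The Weyl group $W$ is generated by the reflections $s_n^i(\Lambda)=\Lambda+\langle\Lambda,\check\alpha_n^i\rangle\alpha_n^i$ of $H^2$, and $M=W\cdot\{E_n^i\}$. Let $\mathbb K$ be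 the field generated over $\mathbb C$ by independent variables $a_n^i$ ($-\ell_n<i<k_n$) and their fractional powers, and let $L=\mathbb K(\tau)$ be the field of rational functions over $\mathbb K$ in indeterminates $\tau_n^i$ ($-\ell_n\le i\le k_n$, $i\neq0$). Put $$u_n=\frac{\big(a_n^0\prod_{j=1}^{\ell_n-1}(a_n^{-j})^{1-j/\ell_n}\big)^{\ell_n/(k_n+\ell_n)}}{\big(\prod_{i=1}^{k_n-1}(a_n^i)^{1-i/k_n}\big)^{k_n/(k_n+\ell_n)}},\qquad v_n=\frac{\big(a_n^0\prod_{i=1}^{k_n-1}(a_n^i)^{1-i/k_n}\big)^{k_n/(k_n+\ell_n)}}{\big(\prod_{j=1}^{\ell_n-1}(a_n^{-j})^{1-j/\ell_n}\big)^{\ell_n/(k_n+\ell_n)}},$$ and $u_n^1=u_n$, $u_n^i=a_n^{i-1}u_n^{i-1}$, $v_n^{-1}=v_n$, $v_n^{-j}=a_n^{-j+1}v_n^{-j+1}$ ($i,j\ge2$). In $(\mathbb P^1)^N$ over $\mathbb K$ with coordinates $f_n=\zeta_n^0/\zeta_n^\infty$ let $$C_n^i=\{f_{n-1}=0,\ f_n=-u_n^i,\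 f_{n+1}=\infty\}\ (1\le i\le k_n),\quad C_n^{-j}=\{f_{n-1}=\infty,\ f_n=-1/v_n^{-j},\ f_{n+1}=0\}\ (1\le j\le\ell_n).$$ Put $\theta_n^0=k_{n+1}+\ell_{n-1}$, $\theta_n^\infty=k_{n-1}+\ell_{n+1}$, $\omega_n=\theta_n^0/(\theta_n^0+\theta_n^\infty)$, $\xi_n=\prod_{i=1}^{k_n}\tau_n^i$, $\eta_n=\prod_{j=1}^{\ell_n}\tau_n^{-j}$. Let $s_n^i$ act on $L$ over $\mathbb C$ by $s_n^i(a_m^j)=a_m^j(a_n^i)^{\langle\alpha_m^j,\check\alpha_n^i\rangle}$ (also on fractional powers) and $$s_n^0(\tau_n^1)=\frac{v_n^{\omega_n}\xi_{n+1}\eta_{n-1}+v_n^{-1+\omega_n}\xi_{n-1}\eta_{n+1}}{\tau_n^{-1}},\qquad s_n^0(\tau_n^{-1})=\frac{u_n^{-\omega_n}\xi_{n+1}\eta_{n-1}+u_n^{1-\omega_n}\xi_{n-1}\eta_{n+1}}{\tau_n^{1}},$$ while $s_n^{\pm i}$ ($i>0$) exchanges $\tau_n^{\pm i}$ and $\tau_n^{\pm(i+1)}$,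 and all other $\tau_m^j$ are fixed. (Superscripts on $\tau_n,a_n,u_n^{i},v_n^{-j},E_n$ are indices, but the exponents on the parameters $u_n$ and $v_n$ in these two formulas are powers.) The $\tau$-function $\tau:M\to L$ is defined by $\tau(E_n^i)=\tau_n^i$ and $\tau(w.\Lambda)=w.\tau(\Lambda)$ for $w\in W$. For $\Lambda=\sum d_nH_n-\sum\mu_n^iE_n^i\in M$, a *normalized defining polynomial* $\Phi_\Lambda=\sum_mA_m\zeta^m\in\mathbb K[\zeta]$ is a nonzero multihomogeneous polynomial of multidegree $d=(d_n)$ with multiplicity exactly $\max(\mu_n^i,0)$ along each $C_n^i$, such that every $A_m=\sum_xc_{m,x}a^x$ is a finite sum of monic monomials $a^x$ (rational exponents) with integral multiplicities $c_{m,x}$, is a single monic monomial for each of the corner monomials $\zeta^m=\prod_n(\zeta_n^{\varepsilon_n})^{d_n}$, $\varepsilon_n\in\{0,\infty\}$, and $$\prod_{m,x}(a^x)^{c_{m,x}(1/\theta)^m}=1,\qquad(1/\theta)^m=\prod_n(1/\theta_n^0)^{m_n^0}(1/\theta_n^\infty)^{m_n^\infty}.$$ **Theorem.** The action of the generators $s_n^i$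 on $L$ extends to an action of $W$ by field automorphisms and the $\tau$-function exists. For every $\Lambda=\sum d_nH_n-\sum\mu_n^iE_n^i\in M$ the forms of multidegree $d$ with multiplicity at least $\mu_n^i$ along every $C_n^i$ are a one-dimensional $\mathbb K$-vector space (so the hypersurface is unique), there is exactly one normalized defining polynomial $\Phi_\Lambda$, and $$\tau(\Lambda)\prod_{n,i}(\tau_n^i)^{\mu_n^i}=\Phi_\Lambda(\zeta)\qquad\text{with }\ \zeta_n^0=\xi_{n+1}\eta_{n-1},\quad\zeta_n^\infty=\xi_{n-1}\eta_{n+1}.$$ In particular every $\tau(\Lambda)$ is a Laurent polynomial in the $\tau_n^i$ with coefficients in $\mathbb K$. -/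

import Mathlib

open scoped BigOperators

noncomputable section

/-- The discrete data: `N ≥ 3` and two `N`-periodic sequences `k`, `ℓ` of positive integers. The
suffix `n` lives in `ℤ/Nℤ`. -/
structure TropicalDatum where
  N : ℕ
  three_le : 3 ≤ N
  k : ZMod N → ℕ
  ℓ : ZMod N → ℕ
  k_pos : ∀ n, 0 < k n
  ℓ_pos : ∀ n, 0 < ℓ n

namespace TropicalDatum

instance instNeZeroN (T : TropicalDatum) : NeZero T.N :=
  ⟨by have := T.three_le; omega⟩

/-- Indices `(n, i)` of the centers `C_n^i`: `-ℓ_n ≤ i ≤ k_n`, `i ≠ 0`. -/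
abbrev Center (T : TropicalDatum) : Type :=
  Σ n : ZMod T.N, ↥((Finset.Icc (-(T.ℓ n : ℤ)) (T.k n : ℤ)).erase 0)

/-- Indices `(n, i)` of the simple roots `α_n^i`: `-ℓ_n + 1 ≤ i ≤ k_n - 1`. -/
abbrev Root (T : TropicalDatum) : Type :=
  Σ n : ZMod T.N, ↥(Finset.Icc (-(T.ℓ n : ℤ) + 1) ((T.k n : ℤ) - 1))

variable (T : TropicalDatum)

/-! ### The Néron-Severi bilattice and the Weyl group -/

/-- `H²(X, ℤ)`, with basis `H_n`, `E_n^i`: the pair `(d, ε)` is `∑ d_n H_n + ∑ ε_n^i E_n^i`. -/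
abbrev NS : Type := (ZMod T.N → ℤ) × (T.Center → ℤ)

/-- `H_2(X, ℤ)`, with basis `h_n`, `e_n^i`: the pair `(d, ε)` is `∑ d_n h_n + ∑ ε_n^i e_n^i`. -/
abbrev Curves : Type := (ZMod T.N → ℤ) × (T.Center → ℤ)

/-- The class `H_n`; also the class `h_n`. -/
def H (n : ZMod T.N) : T.NS := (Pi.single n 1, 0)

/-- The class `E_n^i`; also the class `e_n^i` (used only for `-ℓ_n ≤ i ≤ k_n`, `i ≠ 0`). -/
def E (n : ZMod T.N) (i : ℤ) : T.NS :=
  (0, fun c => if c.1 = n ∧ (c.2 : ℤ) = i then 1 else 0)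

/-- The intersection pairing with a fixed element of `H_2`:
`⟨H_m, h_n⟩ = δ_{mn}`, `⟨E_m^i, e_n^j⟩ = -δ_{mn} δ_{ij}`, other pairings zero. -/
def pairing (γ : T.Curves) : T.NS →ₗ[ℤ] ℤ where
  toFun Λ := ∑ n, Λ.1 n * γ.1 n - ∑ c, Λ.2 c * γ.2 c
  map_add' x y := by
    simp only [Prod.fst_add, Prod.snd_add, Pi.add_apply, add_mul, Finset.sum_add_distrib]
    ring
  map_smul' a x := by
    simp only [Prod.smul_fst, Prod.smul_snd, Pi.smul_apply, smul_eq_mul, mul_assoc,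
      ← Finset.mul_sum, RingHom.id_apply, mul_sub]

/-- The simple roots: `α_n^0 = H_n - E_n^1 - E_n^{-1}`, `α_n^i = E_n^i - E_n^{i+1}` for `i > 0`,
`α_n^{-j} = E_n^{-j} - E_n^{-j-1}` for `j > 0`. -/
def α (r : T.Root) : T.NS :=
  if (r.2 : ℤ) = 0 then T.H r.1 - T.E r.1 1 - T.E r.1 (-1)
  else if 0 < (r.2 : ℤ) then T.E r.1 r.2 - T.E r.1 (r.2 + 1)
  else T.E r.1 r.2 - T.E r.1 (r.2 - 1)

/-- The simple coroots: `α̌_n^0 = h_{n-1} + h_{n+1} - e_n^1 - e_n^{-1}`,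
`α̌_n^i = e_n^i - e_n^{i+1}` for `i > 0`, `α̌_n^{-j} = e_n^{-j} - e_n^{-j-1}` for `j > 0`. -/
def coα (r : T.Root) : T.Curves :=
  if (r.2 : ℤ) = 0 then T.H (r.1 - 1) + T.H (r.1 + 1) - T.E r.1 1 - T.E r.1 (-1)
  else if 0 < (r.2 : ℤ) then T.E r.1 r.2 - T.E r.1 (r.2 + 1)
  else T.E r.1 r.2 - T.E r.1 (r.2 - 1)

theorem one_ne : (1 : ZMod T.N) ≠ 0 := by
  have h3 := T.three_le
  intro h
  have h' : ((1 : ℕ) : ZMod T.N) = 0 := by exact_mod_cast h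
  rw [ZMod.natCast_eq_zero_iff] at h'
  have := Nat.le_of_dvd one_pos h'
  omega

theorem sub_one_ne (n : ZMod T.N) : n - 1 ≠ n := by
  intro h; exact T.one_ne (by simpa using h)

theorem add_one_ne (n : ZMod T.N) : n + 1 ≠ n := by
  intro h; exact T.one_ne (by simpa using h)

/-- `(n, i)` as the index of a center. -/
def ctr (n : ZMod T.N) (i : ℤ) (h : i ≠ 0 ∧ -(T.ℓ n : ℤ) ≤ i ∧ i ≤ T.k n) : T.Center :=
  ⟨n, ⟨i, by simpa [Finset.mem_erase, Finset.mem_Icc] using h⟩⟩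

theorem E_ctr (n : ZMod T.N) (i : ℤ) (h) :
    T.E n i = (0, Pi.single (T.ctr n i h) 1) := by
  unfold E
  congr 1
  funext c
  rw [Pi.single_apply]
  congr 1
  apply propext
  constructor
  · rintro ⟨rfl, rfl⟩
    rfl
  · rintro rfl
    exact ⟨rfl, rfl⟩

theorem ctr_ne (n : ZMod T.N) (i j : ℤ) (h h') (hij : i ≠ j) :
    T.ctr n i h ≠ T.ctr n j h' := by
  intro e
  simp only [ctr, Sigma.mk.injEq, heq_eq_eq, Subtype.mk.injEq, true_and] at e
  exact hij e

theorem pairing_self (r : T.Root) : T.pairing (T.coα r) (T.α r) = -2 := by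
  have hr := Finset.mem_Icc.1 r.2.2
  have hk := T.k_pos r.1
  have hl := T.ℓ_pos r.1
  have key : ∀ (c c' : T.Center), c ≠ c' → ∀ x y : ZMod T.N → ℤ,
      (∑ n, x n * y n = 0) →
      T.pairing (y, Pi.single c 1 - Pi.single c' 1) (x, Pi.single c 1 - Pi.single c' 1) = -2 := by
    intro c c' hc x y hxy
    simp only [pairing, LinearMap.coe_mk, AddHom.coe_mk, hxy, Pi.sub_apply, sub_mul, mul_sub,
      Finset.sum_sub_distrib]
    simp [Pi.single_apply, hc, hc.symm]
  unfold α coα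
  split_ifs with h0 h1
  · rw [T.E_ctr r.1 1 ⟨by omega, by omega, by omega⟩,
      T.E_ctr r.1 (-1) ⟨by omega, by omega, by omega⟩]
    have hne := T.ctr_ne r.1 1 (-1) ⟨by omega, by omega, by omega⟩
      ⟨by omega, by omega, by omega⟩ (by omega)
    simp only [pairing, LinearMap.coe_mk, AddHom.coe_mk, H, Prod.mk_sub_mk, Prod.mk_add_mk,
      Pi.sub_apply, Pi.add_apply, Pi.zero_apply, sub_mul, mul_sub, mul_add,
      Finset.sum_sub_distrib, Finset.sum_add_distrib]
    simp [Pi.single_apply, hne, hne.symm, T.one_ne]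
  · rw [T.E_ctr r.1 r.2 ⟨by omega, by omega, by omega⟩,
      T.E_ctr r.1 (r.2 + 1) ⟨by omega, by omega, by omega⟩]
    rw [Prod.mk_sub_mk]
    exact key _ _ (T.ctr_ne _ _ _ _ _ (by omega)) _ _ (by simp)
  · rw [T.E_ctr r.1 r.2 ⟨by omega, by omega, by omega⟩,
      T.E_ctr r.1 (r.2 - 1) ⟨by omega, by omega, by omega⟩]
    rw [Prod.mk_sub_mk]
    exact key _ _ (T.ctr_ne _ _ _ _ _ (by omega)) _ _ (by simp)

/-- The simple reflection `s_n^i(Λ) = Λ + ⟨Λ, α̌_n^i⟩ α_n^i` on `H²(X, ℤ)`. -/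
def s (r : T.Root) : T.NS ≃ₗ[ℤ] T.NS :=
  LinearEquiv.ofInvolutive
    (LinearMap.id + (T.pairing (T.coα r)).smulRight (T.α r))
    (by
      intro Λ
      simp only [LinearMap.add_apply, LinearMap.id_apply, LinearMap.smulRight_apply, map_add,
        map_smul, T.pairing_self]
      module)

/-- The Weyl group `W`, generated by the simple reflections. -/
def W : Subgroup (T.NS ≃ₗ[ℤ] T.NS) := Subgroup.closure (Set.range T.s)

/-- The simple reflections as elements of `W`. -/
def sW (r : T.Root) : T.W := ⟨T.s r, Subgroup.subset_closure ⟨r, rfl⟩⟩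

/-- The Weyl orbit `M = W.{E_n^i}` of the classes of exceptional divisors. -/
def M : Set T.NS := {Λ | ∃ w ∈ T.W, ∃ c : T.Center, Λ = w (T.E c.1 c.2)}

/-! ### The coefficient field and the multiplicative root variables -/

/-- Finite sums of monomials `a^x` in fractional powers of the multiplicative root variables
`a_n^i`, with coefficients in `R`; the exponents `x` are vectors of rational numbers. -/
abbrev Puiseux (R : Type) [CommRing R] : Type := AddMonoidAlgebra R (T.Root → ℚ)

/-- The field `𝕂 = ⋃_p ℂ(a^{1/p})` generated over `ℂ` by the independent variables `a_n^i` and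
their fractional powers. -/
abbrev K : Type := FractionRing (T.Puiseux ℂ)

/-- The monic monomial `a^x`. -/
def mono (x : T.Root → ℚ) : T.K :=
  algebraMap (T.Puiseux ℂ) T.K (AddMonoidAlgebra.single x 1)

/-- The action on exponents of `a_m^j ↦ a_m^j (a_n^i)^{⟨α_m^j, α̌_n^i⟩}`. -/
def expAct (r : T.Root) : (T.Root → ℚ) ≃+ (T.Root → ℚ) where
  toFun x := x + Pi.single r (∑ t, x t * (T.pairing (T.coα r) (T.α t) : ℚ))
  invFun x := x + Pi.single r (∑ t, x t * (T.pairing (T.coα r) (T.α t) : ℚ))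
  left_inv x := by
    have h : ((T.pairing (T.coα r) (T.α r) : ℤ) : ℚ) = -2 := by rw [T.pairing_self]; norm_num
    simp only [Pi.add_apply, add_mul, Finset.sum_add_distrib, Pi.single_apply, ite_mul, zero_mul,
      Finset.sum_ite_eq', Finset.mem_univ, if_true, h]
    rw [add_assoc, ← Pi.single_add]
    convert add_zero x using 2
    rw [← Pi.single_zero r]
    congr 1
    ring
  right_inv x := by
    have h : ((T.pairing (T.coα r) (T.α r) : ℤ) : ℚ) = -2 := by rw [T.pairing_self]; norm_num
    simp only [Pi.add_apply, add_mul, Finset.sum_add_distrib, Pi.single_apply, ite_mul, zero_mul,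
      Finset.sum_ite_eq', Finset.mem_univ, if_true, h]
    rw [add_assoc, ← Pi.single_add]
    convert add_zero x using 2
    rw [← Pi.single_zero r]
    congr 1
    ring
  map_add' x y := by
    simp only [Pi.add_apply, add_mul, Finset.sum_add_distrib, Pi.single_add]
    abel

/-- The action of `s_n^i` on `𝕂`, determined by `s_n^i(a_n^i) = 1/a_n^i`,
`s_n^i(a_n^{i±1}) = a_n^i a_n^{i±1}`, `s_n^0(a_{n±1}^0) = a_n^0 a_{n±1}^0`, the other root variables
being fixed; that is, by `s_n^i(a_m^j) = a_m^j (a_n^i)^{⟨α_m^j, α̌_n^i⟩}`. -/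
def sK (r : T.Root) : T.K ≃+* T.K :=
  IsFractionRing.ringEquivOfRingEquiv
    (AddMonoidAlgebra.domCongr ℂ ℂ (T.expAct r)).toRingEquiv

/-- The exponent vector of `u_n^1 = u_n`, where, with `A = ∏_{0<i<k_n} (a_n^i)^{1-i/k_n}` and
`B = ∏_{0<j<ℓ_n} (a_n^{-j})^{1-j/ℓ_n}`,
`u_n = (a_n^0 B)^{ℓ_n/(k_n+ℓ_n)} / A^{k_n/(k_n+ℓ_n)}`. -/
def uExp (n : ZMod T.N) : T.Root → ℚ := fun r =>
  if r.1 ≠ n then 0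
  else if (r.2 : ℤ) = 0 then (T.ℓ n : ℚ) / (T.k n + T.ℓ n)
  else if 0 < (r.2 : ℤ) then -((1 - (r.2 : ℤ) / T.k n) * (T.k n / (T.k n + T.ℓ n)))
  else (1 + (r.2 : ℤ) / T.ℓ n) * (T.ℓ n / (T.k n + T.ℓ n))

/-- The exponent vector of `v_n^{-1} = v_n`, where, with `A`, `B` as for `u_n`,
`v_n = (a_n^0 A)^{k_n/(k_n+ℓ_n)} / B^{ℓ_n/(k_n+ℓ_n)}`. -/
def vExp (n : ZMod T.N) : T.Root → ℚ := fun r =>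
  if r.1 ≠ n then 0
  else if (r.2 : ℤ) = 0 then (T.k n : ℚ) / (T.k n + T.ℓ n)
  else if 0 < (r.2 : ℤ) then (1 - (r.2 : ℤ) / T.k n) * (T.k n / (T.k n + T.ℓ n))
  else -((1 + (r.2 : ℤ) / T.ℓ n) * (T.ℓ n / (T.k n + T.ℓ n)))

/-- The parameter `u_n^i = a_n^{i-1} ⋯ a_n^1 u_n` of the center `C_n^i`, `i > 0`. -/
def u (n : ZMod T.N) (i : ℤ) : T.K :=
  T.mono (T.uExp n + fun r => if r.1 = n ∧ 0 < (r.2 : ℤ) ∧ (r.2 : ℤ) < i then 1 else 0)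

/-- The inverse `1 / v_n^{i}` of the parameter `v_n^{-j} = a_n^{-j+1} ⋯ a_n^{-1} v_n` of the
center `C_n^{i}`, `i = -j < 0`. -/
def vInv (n : ZMod T.N) (i : ℤ) : T.K :=
  (T.mono (T.vExp n + fun r => if r.1 = n ∧ (r.2 : ℤ) < 0 ∧ i < (r.2 : ℤ) then 1 else 0))⁻¹

/-! ### The field of `τ`-variables -/

/-- The field `L = 𝕂(τ)` of rational functions in the indeterminates `τ_n^i`. -/
abbrev L : Type := FractionRing (MvPolynomial T.Center T.K)

/-- The inclusion of the coefficient field `𝕂` in `L`. -/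
def const : T.K →+* T.L :=
  (algebraMap (MvPolynomial T.Center T.K) T.L).comp MvPolynomial.C

/-- The indeterminate attached to a center. -/
def tauVar (c : T.Center) : T.L :=
  algebraMap (MvPolynomial T.Center T.K) T.L (MvPolynomial.X c)

/-- The indeterminate `τ_n^i` (by convention `1` where there is no center `C_n^i`; this value is
never used). -/
def tau (n : ZMod T.N) (i : ℤ) : T.L :=
  if h : i ≠ 0 ∧ -(T.ℓ n : ℤ) ≤ i ∧ i ≤ T.k n then T.tauVar (T.ctr n i h) else 1

/-- `ξ_n = ∏_{i=1}^{k_n} τ_n^i`. -/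
def ξ (n : ZMod T.N) : T.L := ∏ i ∈ Finset.Icc 1 (T.k n), T.tau n i

/-- `η_n = ∏_{j=1}^{ℓ_n} τ_n^{-j}`. -/
def η (n : ZMod T.N) : T.L := ∏ j ∈ Finset.Icc 1 (T.ℓ n), T.tau n (-j)

/-- `θ_n^0 = k_{n+1} + ℓ_{n-1}`. -/
def θ0 (n : ZMod T.N) : ℚ := T.k (n + 1) + T.ℓ (n - 1)

/-- `θ_n^∞ = k_{n-1} + ℓ_{n+1}`. -/
def θinf (n : ZMod T.N) : ℚ := T.k (n - 1) + T.ℓ (n + 1)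

/-- `ω_n = θ_n^0 / (θ_n^0 + θ_n^∞)`. -/
def ω (n : ZMod T.N) : ℚ := T.θ0 n / (T.θ0 n + T.θinf n)

/-- `v_n^{ω_n} ξ_{n+1} η_{n-1} + v_n^{-1+ω_n} ξ_{n-1} η_{n+1}`. -/
def Fv (n : ZMod T.N) : T.L :=
  T.const (T.mono (T.ω n • T.vExp n)) * (T.ξ (n + 1) * T.η (n - 1)) +
    T.const (T.mono ((-1 + T.ω n) • T.vExp n)) * (T.ξ (n - 1) * T.η (n + 1))

/-- `u_n^{-ω_n} ξ_{n+1} η_{n-1} + u_n^{1-ω_n} ξ_{n-1} η_{n+1}`. -/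
def Fu (n : ZMod T.N) : T.L :=
  T.const (T.mono ((-T.ω n) • T.uExp n)) * (T.ξ (n + 1) * T.η (n - 1)) +
    T.const (T.mono ((1 - T.ω n) • T.uExp n)) * (T.ξ (n - 1) * T.η (n + 1))

/-- The values `s_n^i(τ_m^j)`. -/
def sTau (r : T.Root) (c : T.Center) : T.L :=
  if c.1 ≠ r.1 then T.tau c.1 c.2
  else if (r.2 : ℤ) = 0 then
    if (c.2 : ℤ) = 1 then T.Fv r.1 / T.tau r.1 (-1)
    else if (c.2 : ℤ) = -1 then T.Fu r.1 / T.tau r.1 1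
    else T.tau c.1 c.2
  else if 0 < (r.2 : ℤ) then
    if (c.2 : ℤ) = r.2 then T.tau r.1 (r.2 + 1)
    else if (c.2 : ℤ) = r.2 + 1 then T.tau r.1 r.2
    else T.tau c.1 c.2
  else
    if (c.2 : ℤ) = r.2 then T.tau r.1 (r.2 - 1)
    else if (c.2 : ℤ) = r.2 - 1 then T.tau r.1 r.2
    else T.tau c.1 c.2

theorem tau_center (c : T.Center) : T.tau c.1 c.2 = T.tauVar c := by
  have h := c.2.2
  rw [Finset.mem_erase, Finset.mem_Icc] at h
  rw [tau, dif_pos ⟨h.1, h.2.1, h.2.2⟩]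
  rfl

theorem tau_ctr (n : ZMod T.N) (i : ℤ) (h) : T.tau n i = T.tauVar (T.ctr n i h) := by
  rw [tau, dif_pos h]

theorem tauVar_ne_zero (c : T.Center) : T.tauVar c ≠ 0 := by
  unfold tauVar
  simp

theorem tau_ne_zero (n : ZMod T.N) (i : ℤ) : T.tau n i ≠ 0 := by
  unfold tau
  split_ifs
  · exact T.tauVar_ne_zero _
  · exact one_ne_zero

theorem const_eq (x : T.K) : T.const x = algebraMap T.K T.L x := by
  rw [const, RingHom.comp_apply, ← MvPolynomial.algebraMap_eq,
    ← IsScalarTower.algebraMap_apply]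

theorem mono_add_mono_ne_zero (x y : T.Root → ℚ) : T.mono x + T.mono y ≠ 0 := by
  unfold mono
  rw [← map_add, Ne, IsFractionRing.to_map_eq_zero_iff]
  intro h
  have := congrArg (fun p : T.Puiseux ℂ => p.coeff x) h
  by_cases hxy : y = x
  · subst hxy
    norm_num at this
  · simp [hxy] at this

/-- Polynomials in the `τ`-variables with value `1` where all `τ`-variables are `1`. -/
def oneSub : Submonoid T.L where
  carrier := {x | ∃ P : MvPolynomial T.Center T.K,
    algebraMap _ T.L P = x ∧ MvPolynomial.eval 1 P = 1}
  mul_mem' := by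
    rintro _ _ ⟨P, rfl, hP⟩ ⟨Q, rfl, hQ⟩
    exact ⟨P * Q, map_mul _ _ _, by rw [map_mul, hP, hQ, one_mul]⟩
  one_mem' := ⟨1, map_one _, map_one _⟩

theorem tau_mem_oneSub (n : ZMod T.N) (i : ℤ) : T.tau n i ∈ T.oneSub := by
  unfold tau
  split_ifs
  · exact ⟨_, rfl, by simp⟩
  · exact T.oneSub.one_mem

theorem binomial_ne_zero (x y : T.Root → ℚ) (p q : T.L) (hp : p ∈ T.oneSub) (hq : q ∈ T.oneSub) :
    T.const (T.mono x) * p + T.const (T.mono y) * q ≠ 0 := by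
  obtain ⟨P, rfl, hP⟩ := hp
  obtain ⟨Q, rfl, hQ⟩ := hq
  simp only [const, RingHom.comp_apply]
  rw [← map_mul, ← map_mul, ← map_add, Ne, IsFractionRing.to_map_eq_zero_iff]
  intro h
  have := congrArg (MvPolynomial.eval 1) h
  rw [map_add, map_mul, map_mul, MvPolynomial.eval_C, MvPolynomial.eval_C, hP, hQ, mul_one,
    mul_one, map_zero] at this
  exact T.mono_add_mono_ne_zero x y this

theorem ξ_mem_oneSub (n : ZMod T.N) : T.ξ n ∈ T.oneSub :=
  T.oneSub.prod_mem fun _ _ => T.tau_mem_oneSub _ _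

theorem η_mem_oneSub (n : ZMod T.N) : T.η n ∈ T.oneSub :=
  T.oneSub.prod_mem fun _ _ => T.tau_mem_oneSub _ _

theorem Fu_ne_zero (n : ZMod T.N) : T.Fu n ≠ 0 :=
  T.binomial_ne_zero _ _ _ _ (T.oneSub.mul_mem (T.ξ_mem_oneSub _) (T.η_mem_oneSub _))
    (T.oneSub.mul_mem (T.ξ_mem_oneSub _) (T.η_mem_oneSub _))

theorem Fv_ne_zero (n : ZMod T.N) : T.Fv n ≠ 0 :=
  T.binomial_ne_zero _ _ _ _ (T.oneSub.mul_mem (T.ξ_mem_oneSub _) (T.η_mem_oneSub _))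
    (T.oneSub.mul_mem (T.ξ_mem_oneSub _) (T.η_mem_oneSub _))

/-- The values `s_n^i(τ_m^j)` generate `L` over `𝕂`. -/
theorem tauVar_mem_adjoin (r : T.Root) (c : T.Center) :
    T.tauVar c ∈ IntermediateField.adjoin T.K (Set.range (T.sTau r)) := by
  set F := IntermediateField.adjoin T.K (Set.range (T.sTau r)) with hF
  have hr := Finset.mem_Icc.1 r.2.2
  have hk := T.k_pos r.1
  have hl := T.ℓ_pos r.1
  have hs : ∀ c, T.sTau r c ∈ F := fun c => IntermediateField.subset_adjoin _ _ ⟨c, rfl⟩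
  have hc : ∀ x, T.const x ∈ F := fun x => by rw [T.const_eq]; exact F.algebraMap_mem x
  have h0 : ∀ m i, m ≠ r.1 → T.tau m i ∈ F := by
    intro m i hm
    by_cases h : i ≠ 0 ∧ -(T.ℓ m : ℤ) ≤ i ∧ i ≤ T.k m
    · have := hs (T.ctr m i h)
      rw [sTau, if_pos (by exact hm)] at this
      exact this
    · rw [tau, dif_neg h]
      exact F.one_mem
  have hξ : ∀ m, m ≠ r.1 → T.ξ m ∈ F := fun m hm => F.prod_mem fun i _ => h0 m i hm
  have hη : ∀ m, m ≠ r.1 → T.η m ∈ F := fun m hm => F.prod_mem fun i _ => h0 m _ hm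
  have hFu : T.Fu r.1 ∈ F :=
    F.add_mem (F.mul_mem (hc _) (F.mul_mem (hξ _ (T.add_one_ne _)) (hη _ (T.sub_one_ne _))))
      (F.mul_mem (hc _) (F.mul_mem (hξ _ (T.sub_one_ne _)) (hη _ (T.add_one_ne _))))
  have hFv : T.Fv r.1 ∈ F :=
    F.add_mem (F.mul_mem (hc _) (F.mul_mem (hξ _ (T.add_one_ne _)) (hη _ (T.sub_one_ne _))))
      (F.mul_mem (hc _) (F.mul_mem (hξ _ (T.sub_one_ne _)) (hη _ (T.add_one_ne _))))
  have hsc : ∀ i, ∀ h : i ≠ 0 ∧ -(T.ℓ r.1 : ℤ) ≤ i ∧ i ≤ T.k r.1,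
      T.sTau r (T.ctr r.1 i h) ∈ F := fun i h => hs _
  obtain ⟨n, i, hi⟩ := c
  by_cases hn : n = r.1
  swap
  · have := h0 n i hn
    rwa [T.tau_center ⟨n, i, hi⟩] at this
  subst hn
  have hi' := hi
  rw [Finset.mem_erase, Finset.mem_Icc] at hi'
  rw [← T.tau_center]
  change T.tau r.1 i ∈ F
  simp only [sTau, ctr, ne_eq, not_true, if_false] at hsc
  by_cases hr0 : (r.2 : ℤ) = 0
  · simp only [hr0, if_true] at hsc
    by_cases h1 : i = 1
    · subst h1
      have h := hsc (-1) ⟨by omega, by omega, by omega⟩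
      simp at h
      have h2 := F.div_mem hFu h
      rwa [div_div_cancel₀ (T.Fu_ne_zero _)] at h2
    by_cases h2 : i = -1
    · subst h2
      have h := hsc 1 ⟨by omega, by omega, by omega⟩
      simp at h
      have h2 := F.div_mem hFv h
      rwa [div_div_cancel₀ (T.Fv_ne_zero _)] at h2
    · have h := hsc i ⟨by omega, by omega, by omega⟩
      simpa [h1, h2] using h
  by_cases hrp : 0 < (r.2 : ℤ)
  · simp only [hr0, hrp, if_true, if_false] at hsc
    by_cases h1 : i = r.2
    · have h := hsc (r.2 + 1) ⟨by omega, by omega, by omega⟩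
      simp at h
      rwa [h1]
    by_cases h2 : i = r.2 + 1
    · have h := hsc r.2 ⟨by omega, by omega, by omega⟩
      simp at h
      rwa [h2]
    · have h := hsc i ⟨by omega, by omega, by omega⟩
      simpa [h1, h2] using h
  · simp only [hr0, hrp, if_false] at hsc
    by_cases h1 : i = r.2
    · have h := hsc (r.2 - 1) ⟨by omega, by omega, by omega⟩
      simp at h
      rwa [h1]
    by_cases h2 : i = r.2 - 1
    · have h := hsc r.2 ⟨by omega, by omega, by omega⟩
      simp at h
      rwa [h2]
    · have h := hsc i ⟨by omega, by omega, by omega⟩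
      simpa [h1, h2] using h

theorem adjoin_tauVar : IntermediateField.adjoin T.K (Set.range T.tauVar) = ⊤ := by
  rw [eq_top_iff]
  intro x _
  have hP : ∀ P : MvPolynomial T.Center T.K, algebraMap _ T.L P ∈
      IntermediateField.adjoin T.K (Set.range T.tauVar) := by
    intro P
    induction P using MvPolynomial.induction_on with
    | C a =>
      have := T.const_eq a
      rw [const, RingHom.comp_apply] at this
      rw [this]
      exact IntermediateField.algebraMap_mem _ _
    | add p q hp hq => rw [map_add]; exact add_mem hp hq
    | mul_X p i hp =>
      rw [map_mul]
      exact mul_mem hp (IntermediateField.subset_adjoin _ _ ⟨i, rfl⟩)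
  obtain ⟨p, q, _, rfl⟩ := IsFractionRing.div_surjective (A := MvPolynomial T.Center T.K) x
  exact div_mem (hP p) (hP q)

theorem algebraicIndependent_tauVar : AlgebraicIndependent T.K T.tauVar := by
  have h := MvPolynomial.algebraicIndependent_X T.Center T.K
  exact h.map' (f := IsScalarTower.toAlgHom T.K (MvPolynomial T.Center T.K) T.L)
    (IsFractionRing.injective (MvPolynomial T.Center T.K) T.L)

theorem algebraicIndependent_sTau (r : T.Root) : AlgebraicIndependent T.K (T.sTau r) := by
  have htop : IntermediateField.adjoin T.K (Set.range (T.sTau r)) = ⊤ := by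
    rw [eq_top_iff, ← T.adjoin_tauVar, IntermediateField.adjoin_le_iff]
    rintro _ ⟨c, rfl⟩
    exact T.tauVar_mem_adjoin r c
  have : Algebra.IsAlgebraic (Algebra.adjoin T.K (Set.range (T.sTau r))) T.L := by
    rw [← IntermediateField.isAlgebraic_adjoin_iff_top, htop,
      Algebra.isAlgebraic_iff_isIntegral]
    exact Algebra.isIntegral_of_surjective IntermediateField.topEquiv.surjective
  refine (Algebra.IsAlgebraic.isTranscendenceBasis_of_le_trdeg_of_finite T.K (T.sTau r) ?_).1
  exact T.algebraicIndependent_tauVar.cardinalMk_le_trdeg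

/-- The substitution of `s_n^i(a)`, `s_n^i(τ)` in polynomials. -/
def sPoly (r : T.Root) : MvPolynomial T.Center T.K →+* T.L :=
  MvPolynomial.eval₂Hom (T.const.comp (T.sK r : T.K →+* T.K)) (T.sTau r)

theorem sPoly_injective (r : T.Root) : Function.Injective (T.sPoly r) := by
  have h : T.sPoly r = (MvPolynomial.aeval (T.sTau r) : MvPolynomial T.Center T.K →ₐ[T.K] T.L).toRingHom.comp
      (MvPolynomial.map (T.sK r : T.K →+* T.K)) := by
    ext x
    · simp [sPoly, T.const_eq]
    · simp [sPoly]
  rw [h]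
  exact Function.Injective.comp (g := MvPolynomial.aeval (T.sTau r))
    (T.algebraicIndependent_sTau r)
    (MvPolynomial.map_injective _ (T.sK r).injective)

/-- The birational transformation `s_n^i` of `L`, i.e. `R(a, τ) ↦ R(s_n^i(a), s_n^i(τ))`. -/
def sL (r : T.Root) : T.L →+* T.L := IsFractionRing.lift (T.sPoly_injective r)

/-- `ρ` is the action of the Weyl group on `L` by field automorphisms in which the generators `s_n^i`
act as the birational transformations defined above. It is unique if it exists, since the `s_n^i`
generate `W`. -/
def IsWeylAction (ρ : T.W →* RingAut T.L) : Prop :=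
  ∀ (r : T.Root) (x : T.L), ρ (T.sW r) x = T.sL r x

/-- `τ : M → L` is the `τ`-function: `τ(E_n^i) = τ_n^i` and `τ(w.Λ) = w.τ(Λ)` for `w ∈ W`. -/
structure IsTauFunction (ρ : T.W →* RingAut T.L) (τ : T.M → T.L) : Prop where
  exceptional : ∀ (c : T.Center) (Λ : T.M), (Λ : T.NS) = T.E c.1 c.2 → τ Λ = T.tauVar c
  equivariant : ∀ (w : T.W) (Λ Λ' : T.M), (Λ' : T.NS) = w.1 (Λ : T.NS) → τ Λ' = ρ w (τ Λ)

/-! ### Defining polynomials -/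

/-- The index set of the homogeneous coordinates of `(ℙ¹)^N`: `(n, 0)` stands for `ζ_n^0` and
`(n, 1)` for `ζ_n^∞`, so that `f_n = ζ_n^0 / ζ_n^∞`. -/
abbrev Coord : Type := ZMod T.N × Fin 2

/-- The ideal of the center `C_n^i` in the homogeneous coordinate ring, where
`C_n^i = {f_{n-1} = 0, f_n = -u_n^i, f_{n+1} = ∞}` for `i > 0` and
`C_n^{-j} = {f_{n-1} = ∞, f_n = -1/v_n^{-j}, f_{n+1} = 0}` for `j > 0`. -/
def centerIdeal (c : T.Center) : Ideal (MvPolynomial T.Coord T.K) :=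
  if 0 < (c.2 : ℤ) then
    Ideal.span {MvPolynomial.X (c.1 - 1, 0),
      MvPolynomial.X (c.1, 0) + MvPolynomial.C (T.u c.1 c.2) * MvPolynomial.X (c.1, 1),
      MvPolynomial.X (c.1 + 1, 1)}
  else
    Ideal.span {MvPolynomial.X (c.1 - 1, 1),
      MvPolynomial.X (c.1, 0) + MvPolynomial.C (T.vInv c.1 c.2) * MvPolynomial.X (c.1, 1),
      MvPolynomial.X (c.1 + 1, 0)}

/-- The degrees `d_n` of `Λ = ∑ d_n H_n - ∑ μ_n^i E_n^i`. -/
def deg (Λ : T.NS) (n : ZMod T.N) : ℤ := Λ.1 n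

/-- The multiplicities `μ_n^i` of `Λ = ∑ d_n H_n - ∑ μ_n^i E_n^i`. -/
def mult (Λ : T.NS) (c : T.Center) : ℤ := -Λ.2 c

/-- The forms of multidegree `d` with multiplicity at least `μ_n^i` along `C_n^i`, i.e. the global
sections belonging to `Λ = ∑ d_n H_n - ∑ μ_n^i E_n^i`; a condition with `μ_n^i ≤ 0` is void. As
`C_n^i` is a complete intersection of hyperplanes, the polynomials of multiplicity at least `μ` are
those in the `μ`-th power of its ideal. -/
def linearSystem (Λ : T.NS) : Submodule T.K (MvPolynomial T.Coord T.K) :=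
  (⨅ n : ZMod T.N, MvPolynomial.weightedHomogeneousSubmodule T.K
      (fun z : T.Coord => if z.1 = n then (1 : ℤ) else 0) (T.deg Λ n)) ⊓
    ⨅ c : T.Center, (T.centerIdeal c ^ (T.mult Λ c).toNat).restrictScalars T.K

/-- `Φ` defines a hypersurface of multidegree `d` having multiplicity exactly `μ_n^i` along `C_n^i`
(multiplicity `0` in the case `μ_n^i = -1`, which occurs for `Λ = E_n^i`). -/
structure IsDefiningPolynomial (Λ : T.NS) (Φ : MvPolynomial T.Coord T.K) : Prop where
  ne_zero : Φ ≠ 0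
  mem_linearSystem : Φ ∈ T.linearSystem Λ
  multiplicity : ∀ c : T.Center, Φ ∉ T.centerIdeal c ^ ((T.mult Λ c).toNat + 1)

/-- Finite sums of monomials `a^x` with integral multiplicities, as elements of `𝕂`. -/
def puiseuxToK : T.Puiseux ℤ →+* T.K :=
  (algebraMap (T.Puiseux ℂ) T.K).comp
    (AddMonoidAlgebra.mapRingHom (T.Root → ℚ) (Int.castRingHom ℂ))

/-- The exponent of the corner monomial `∏_n (ζ_n^{S n})^{d_n}`, `S n ∈ {0, ∞}`. -/
def corner (d : ZMod T.N → ℤ) (S : ZMod T.N → Fin 2) : T.Coord →₀ ℕ :=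
  Finsupp.equivFunOnFinite.symm fun z => if z.2 = S z.1 then (d z.1).toNat else 0

/-- `(1/θ)^m = ∏_n (1/θ_n^0)^{m_n^0} (1/θ_n^∞)^{m_n^∞}`. -/
def thetaWeight (m : T.Coord →₀ ℕ) : ℚ :=
  ∏ n, (1 / T.θ0 n) ^ m (n, 0) * (1 / T.θinf n) ^ m (n, 1)

/-- `Φ = ∑_m A_m ζ^m` is normalized: each `A_m = ∑_x c_{m,x} a^x` is a sum of monic monomials `a^x`
with integral multiplicities `c_{m,x}`, it is a single monic monomial when `ζ^m` is a corner
monomial, and `∏_m A_m^{(1/θ)^m} = 1`, where a sum of monomials contributes through each of its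
terms, i.e. `∏_{m,x} (a^x)^{c_{m,x} (1/θ)^m} = 1`. -/
def IsNormalized (d : ZMod T.N → ℤ) (Φ : MvPolynomial T.Coord T.K) : Prop :=
  ∃ P : MvPolynomial T.Coord (T.Puiseux ℤ),
    MvPolynomial.map T.puiseuxToK P = Φ ∧
    (∀ S : ZMod T.N → Fin 2, ∃ x : T.Root → ℚ,
      P.coeff (T.corner d S) = AddMonoidAlgebra.single x 1) ∧
    ∏ m ∈ P.support, (P.coeff m).coeff.prod
      (fun x c => T.mono (((c : ℚ) * T.thetaWeight m) • x)) = 1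

/-- `Φ` is the normalized defining polynomial `Φ_Λ`. -/
def IsNormalizedDefiningPolynomial (Λ : T.NS) (Φ : MvPolynomial T.Coord T.K) : Prop :=
  T.IsDefiningPolynomial Λ Φ ∧ T.IsNormalized (T.deg Λ) Φ

/-- The values `ζ_n^0 = ξ_{n+1} η_{n-1}`, `ζ_n^∞ = ξ_{n-1} η_{n+1}` in `L`. -/
def zeta (z : T.Coord) : T.L :=
  if z.2 = 0 then T.ξ (z.1 + 1) * T.η (z.1 - 1) else T.ξ (z.1 - 1) * T.η (z.1 + 1)

/-- The ring `𝕂[τ^{±1}]` of Laurent polynomials in the `τ_n^i`, inside `L`. -/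
def laurent : Subalgebra T.K T.L :=
  Algebra.adjoin T.K (Set.range T.tauVar ∪ Set.range fun c => (T.tauVar c)⁻¹)

end TropicalDatum

end

/-!
A simple reflection `s_n^i` lifts to a semilinear substitution of the homogeneous coordinates of
`(ℙ¹)^N`: it exchanges two centers for `i ≠ 0`, and for `i = 0` it multiplies the coordinates with
index `n ± 1` by linear forms vanishing on `C_n^1` or `C_n^{-1}`. Up to powers of these forms it
maps sections belonging to `Λ` to sections belonging to `s_n^i(Λ)`, so one-dimensionality of the
space of sections propagates from the exceptional classes along words in the Weyl group.

The normalization `∏ (a^x)^{c_{m,x} (1/θ)^m} = 1` of a polynomial with value `≠ 0` at `a = 1`,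
`ζ = 1/θ` says that its derivative at this point in the direction of the parameters `a` vanishes.
The exponent `ω_n` makes the forms above stationary in this sense, hence normalized polynomials are
mapped to normalized ones. Under the evaluation `ζ ↦ ξη` the same substitution is the action of
`s_n^i` on `L`. So the normalized polynomials, being unique, determine the value of a word in
the generators on each `τ`-variable by its image in `W` alone, and this gives the relations of `W`.
-/

noncomputable section

theorem sign_cases_of_ne_zero {j : ℤ} (hj : j ≠ 0) :
    (0 < j ∧ j.sign = 1) ∨ (j < 0 ∧ j.sign = -1) :=
  hj.lt_or_gt.symm.imp (fun h => ⟨h, Int.sign_eq_one_of_pos h⟩)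
    fun h => ⟨h, Int.sign_eq_neg_one_of_neg h⟩

/-- The left-hand side is a multiple of `y₀ + γ y₁` modulo `x₁`, resp. modulo `x₀`. -/
theorem mul_add_mul_mem_of_add_mul_mem {S : Type*} [CommRing S] {I : Ideal S}
    {x₀ x₁ y₀ y₁ a b p p' g γ : S} (hI : y₀ + γ * y₁ ∈ I)
    (h : x₁ ∈ I ∧ g * b = γ * a ∨ x₀ ∈ I ∧ g * (b * p') = γ * (a * p)) :
    a * (x₀ + p * x₁) * y₀ + g * (b * (x₀ + p' * x₁) * y₁) ∈ I := by
  rcases h with ⟨hx, h⟩ | ⟨hx, h⟩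
  · convert add_mem (I.mul_mem_left (a * x₀) hI)
      (I.mul_mem_left (a * p * y₀ + g * b * p' * y₁) hx) using 1
    linear_combination (x₀ * y₁) * h
  · convert add_mem (I.mul_mem_left (a * p * x₁) hI)
      (I.mul_mem_left (a * y₀ + g * b * y₁) hx) using 1
    linear_combination (x₁ * y₁) * h

theorem prod_inl_pow {ι R M : Type*} [CommSemiring R] [AddCommMonoid M] [Module R M]
    [Module Rᵐᵒᵖ M] [IsCentralScalar R M] (s : Finset ι) (w : ι → R) (a : ι → ℕ) :
    (∏ i ∈ s, (TrivSqZeroExt.inl (w i) : TrivSqZeroExt R M) ^ a i) =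
      TrivSqZeroExt.inl (∏ i ∈ s, w i ^ a i) := by
  have h := map_prod (TrivSqZeroExt.inlHom R M) (fun i => w i ^ a i) s
  simp only [map_pow] at h
  exact h.symm

theorem eq_zero_of_forall_addMonoidHom {ι M : Type*} [AddMonoid M] {x : ι → M}
    (h : ∀ φ : (ι → M) →+ M, φ x = 0) : x = 0 :=
  funext fun i => h (Pi.evalAddMonoidHom (fun _ => M) i)

section ReesAlgebra

open Polynomial

variable {R : Type*} [CommRing R] {I : Ideal R}

theorem X_mul_C_mem_reesAlgebra {a : R} (h : a ∈ I) : X * C a ∈ reesAlgebra I := by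
  rw [mul_comm, C_mul_X_eq_monomial]
  exact reesAlgebra.monomial_mem.2 (by simpa using h)

theorem mem_ideal_pow_iff_X_pow_dvd {b : R →+* R[X]} (hb : ∀ f, b f ∈ reesAlgebra I)
    (hb_one : ∀ f, (b f).eval 1 = f) (hbI : ∀ f ∈ I, X ∣ b f) (f : R) (n : ℕ) :
    f ∈ I ^ n ↔ X ^ n ∣ b f := by
  constructor
  · intro hf
    have map_le : I.map b ≤ Ideal.span {X} :=
      Ideal.map_le_iff_le_comap.2 fun g hg => Ideal.mem_span_singleton.2 (hbI g hg)
    have hbf : b f ∈ I.map b ^ n := by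
      rw [← Ideal.map_pow]
      exact Ideal.mem_map_of_mem b hf
    rw [← Ideal.mem_span_singleton, ← Ideal.span_singleton_pow]
    exact Ideal.pow_right_mono map_le n hbf
  · intro h
    rw [X_pow_dvd_iff] at h
    rw [← hb_one f, eval_eq_sum_range]
    refine Ideal.sum_mem _ fun i _ => ?_
    rw [one_pow, mul_one]
    by_cases hi : i < n
    · rw [h i hi]
      exact Ideal.zero_mem _
    · exact Ideal.pow_le_pow_right (not_lt.1 hi) ((mem_reesAlgebra_iff I (b f)).1 (hb f) i)

end ReesAlgebra

section LinearForm

open MvPolynomial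

variable {σ R : Type*} [CommRing R] {i j : σ}

theorem coeff_add_single_X_add_C_mul_X_mul (hij : i ≠ j) (γ : R) (g : MvPolynomial σ R)
    (m : σ →₀ ℕ) (hm : m j = 0) :
    coeff (m + Finsupp.single i 1) ((X i + C γ * X j) * g) = coeff m g := by
  classical
  rw [add_mul, coeff_add, add_comm m, coeff_X_mul, mul_assoc, coeff_C_mul, coeff_X_mul', if_neg,
    mul_zero, add_zero]
  simp [hm, hij]

theorem coeff_add_single_add_single_X_add_C_mul_X_mul (γ : R) (g : MvPolynomial σ R)
    (m : σ →₀ ℕ) :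
    coeff (m + Finsupp.single j 1 + Finsupp.single i 1) ((X i + C γ * X j) * g) =
      coeff (m + Finsupp.single j 1) g + γ * coeff (m + Finsupp.single i 1) g := by
  rw [add_mul, coeff_add, add_comm _ (Finsupp.single i 1), coeff_X_mul, mul_assoc, coeff_C_mul,
    show Finsupp.single i 1 + (m + Finsupp.single j 1) =
      Finsupp.single j 1 + (m + Finsupp.single i 1) by abel, coeff_X_mul]

/-- `S m` is meant as an integrality or homogeneity condition on the coefficient at `m`, which thus
descends to a quotient by a linear form. -/
theorem coeff_of_X_add_C_mul_X_mul (hij : i ≠ j) (γ : R) (S : (σ →₀ ℕ) → R → Prop)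
    (hsub : ∀ m x y, S m x → S m y → S m (x - y))
    (hγ : ∀ m x, S (m + Finsupp.single i 1) x → S (m + Finsupp.single j 1) (γ * x))
    {g : MvPolynomial σ R} (h : ∀ m, S m (coeff (m + Finsupp.single i 1) ((X i + C γ * X j) * g)))
    (m : σ →₀ ℕ) : S m (coeff m g) := by
  induction hm : m j generalizing m with
  | zero => exact coeff_add_single_X_add_C_mul_X_mul hij γ g m hm ▸ h m
  | succ k ih =>
    obtain ⟨m, rfl⟩ : ∃ m', m = m' + Finsupp.single j 1 := by
      refine ⟨m - Finsupp.single j 1, (tsub_add_cancel_of_le ?_).symm⟩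
      rw [Finsupp.single_le_iff]
      omega
    have hdiv := h (m + Finsupp.single j 1)
    have hprev := hγ m _ (ih (m + Finsupp.single i 1) (by simpa [hij] using hm))
    rw [coeff_add_single_add_single_X_add_C_mul_X_mul] at hdiv
    simpa only [add_sub_cancel_right] using hsub _ _ _ hdiv hprev

theorem mem_range_map_of_X_add_C_mul_X_mul {A : Type*} [CommRing A] {φ : A →+* R} (hij : i ≠ j)
    (γ : A) {g : MvPolynomial σ R}
    (h : (X i + C (φ γ) * X j) * g ∈ (map (σ := σ) φ).range) : g ∈ (map (σ := σ) φ).range := by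
  obtain ⟨P, hP⟩ := h
  refine mem_range_map_iff_coeffs_subset.2 fun x hx => ?_
  obtain ⟨m, _, rfl⟩ := mem_coeffs_iff.1 hx
  exact coeff_of_X_add_C_mul_X_mul hij (φ γ) (fun _ x => x ∈ φ.range)
    (fun _ _ _ hx hy => sub_mem hx hy) (fun _ x hx => mul_mem ⟨γ, rfl⟩ hx)
    (fun m => by rw [← hP, coeff_map]; exact ⟨_, rfl⟩) m

open scoped Classical in
/-- The reduction modulo the linear form `X_i + γ X_j`, eliminating `X_i`. -/
def elimX (i j : σ) (γ : R) : MvPolynomial σ R →ₐ[R] MvPolynomial σ R :=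
  aeval (Function.update X i (-(C γ * X j)))

theorem X_add_C_mul_X_dvd_sub_elimX (γ : R) (f : MvPolynomial σ R) :
    X i + C γ * X j ∣ f - elimX i j γ f := by
  induction f using MvPolynomial.induction_on with
  | C a => simp [elimX, algebraMap_eq]
  | add p q hp hq =>
    rw [map_add, add_sub_add_comm]
    exact dvd_add hp hq
  | mul_X p z hp =>
    have hz : X i + C γ * X j ∣ X z - elimX i j γ (X z) := by
      by_cases hz : z = i
      · simp [elimX, hz]
      · simp [elimX, hz]
    rw [map_mul, show p * X z - elimX i j γ p * elimX i j γ (X z) =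
      (p - elimX i j γ p) * X z + elimX i j γ p * (X z - elimX i j γ (X z)) by ring]
    exact dvd_add (hp.mul_right _) (hz.mul_left _)

theorem X_add_C_mul_X_dvd_iff (hij : i ≠ j) (γ : R) (f : MvPolynomial σ R) :
    X i + C γ * X j ∣ f ↔ elimX i j γ f = 0 := by
  constructor
  · rintro ⟨g, rfl⟩
    simp [elimX, hij.symm, algebraMap_eq]
  · intro h
    simpa only [h, sub_zero] using X_add_C_mul_X_dvd_sub_elimX (i := i) (j := j) γ f

theorem prime_X_add_C_mul_X [IsDomain R] (hij : i ≠ j) (γ : R) :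
    Prime (X i + C γ * X j : MvPolynomial σ R) := by
  refine ⟨fun h => ?_, fun h => ?_, fun p q h => ?_⟩
  · classical
    have := congrArg (coeff (Finsupp.single i 1)) h
    simp [coeff_X, coeff_C_mul, Finsupp.single_left_inj, hij.symm] at this
  · have := (X_add_C_mul_X_dvd_iff hij γ 1).1 h.dvd
    simp at this
  · rw [X_add_C_mul_X_dvd_iff hij, map_mul, mul_eq_zero] at h
    rwa [X_add_C_mul_X_dvd_iff hij, X_add_C_mul_X_dvd_iff hij]

end LinearForm

section WeightedHomogeneous

open MvPolynomial

variable {σ σ' R S M M' : Type*} [CommSemiring R] [CommSemiring S]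
  [AddCommMonoid M] [AddCommMonoid M'] {w : σ → M} {n : M} {f : MvPolynomial σ R}

theorem isWeightedHomogeneous_of_map {φ : R →+* S} (hφ : Function.Injective φ)
    (hf : IsWeightedHomogeneous w (map φ f) n) : IsWeightedHomogeneous w f n := by
  refine fun m hm => hf fun h => hm (hφ ?_)
  rw [← coeff_map, h, map_zero]

theorem isWeightedHomogeneous_eval₂ (hf : IsWeightedHomogeneous w f n) (φ : R →+* S)
    {w' : σ' → M'} (L : M →+ M') {x : σ → MvPolynomial σ' S}
    (hx : ∀ z, IsWeightedHomogeneous w' (x z) (L (w z))) :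
    IsWeightedHomogeneous w' (eval₂ (C.comp φ) x f) (L n) := by
  refine IsWeightedHomogeneous.sum _ _ _ fun m hm => ?_
  rw [← hf (mem_support_iff.1 hm), Finsupp.weight_apply, map_finsuppSum]
  refine IsWeightedHomogeneous.C_mul (IsWeightedHomogeneous.prod _ _ _ fun z _ => ?_) _
  simpa only [map_nsmul] using (hx z).pow (m z)

theorem isWeightedHomogeneous_of_X_add_C_mul_X_mul {R M : Type*} [CommRing R]
    [AddCancelCommMonoid M] {w : σ → M} {n : M} {f : MvPolynomial σ R} {i j : σ} (hij : i ≠ j)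
    (hw : w i = w j) (γ : R)
    (h : IsWeightedHomogeneous w ((X i + C γ * X j) * f) (n + w i)) :
    IsWeightedHomogeneous w f n := by
  refine coeff_of_X_add_C_mul_X_mul hij γ (fun m x => x ≠ 0 → Finsupp.weight w m = n) ?_ ?_ ?_
  · intro m x y hx hy hxy
    by_cases hx0 : x = 0
    · exact hy fun hy0 => hxy (by rw [hx0, hy0, sub_zero])
    · exact hx hx0
  · intro m x hx h0
    rw [← hx (right_ne_zero_of_mul h0)]
    simp [Finsupp.weight_single, hw]
  · intro m h0
    simpa [Finsupp.weight_single] using h h0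

end WeightedHomogeneous

namespace TropicalDatum

variable (T : TropicalDatum)

/-! ### Monomials in the root variables -/

theorem mono_add (x y : T.Root → ℚ) : T.mono (x + y) = T.mono x * T.mono y := by
  simp [mono, ← map_mul, AddMonoidAlgebra.single_mul_single]

theorem mono_zero : T.mono 0 = 1 := by
  rw [mono, ← AddMonoidAlgebra.one_def, map_one]

theorem mono_sum {ι : Type*} (s : Finset ι) (f : ι → T.Root → ℚ) :
    T.mono (∑ i ∈ s, f i) = ∏ i ∈ s, T.mono (f i) := by
  classical
  induction s using Finset.induction_on with
  | empty => exact T.mono_zero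
  | insert i s hi ih => rw [Finset.sum_insert hi, Finset.prod_insert hi, mono_add, ih]

theorem mono_ne_zero (x : T.Root → ℚ) : T.mono x ≠ 0 := by
  intro h
  have := T.mono_add x (-x)
  rw [h, zero_mul, add_neg_cancel, mono_zero] at this
  exact one_ne_zero this

theorem mono_injective : Function.Injective T.mono :=
  (IsFractionRing.injective (T.Puiseux ℂ) T.K).comp
    (AddMonoidAlgebra.single_left_injective one_ne_zero)

theorem mono_neg (x : T.Root → ℚ) : T.mono (-x) = (T.mono x)⁻¹ := by
  refine eq_inv_of_mul_eq_one_left ?_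
  rw [← mono_add, neg_add_cancel, mono_zero]

/-- The monic monomial `a^x` in the ring of sums of monomials with integral multiplicities. -/
def monoZ (x : T.Root → ℚ) : T.Puiseux ℤ := AddMonoidAlgebra.single x 1

theorem monoZ_add (x y : T.Root → ℚ) : T.monoZ (x + y) = T.monoZ x * T.monoZ y := by
  simp [monoZ, AddMonoidAlgebra.single_mul_single]

theorem monoZ_zero : T.monoZ 0 = 1 := rfl

theorem monoZ_neg_mul (x : T.Root → ℚ) : T.monoZ (-x) * T.monoZ x = 1 := by
  rw [← monoZ_add, neg_add_cancel, monoZ_zero]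

theorem puiseuxToK_monoZ (x : T.Root → ℚ) : T.puiseuxToK (T.monoZ x) = T.mono x := by
  simp [puiseuxToK, monoZ, mono]

theorem puiseuxToK_injective : Function.Injective T.puiseuxToK := by
  refine (IsFractionRing.injective (T.Puiseux ℂ) T.K).comp ?_
  exact AddMonoidAlgebra.map_injective (Int.castRingHom ℂ).toAddMonoidHom
    (RingHom.injective_int (Int.castRingHom ℂ))

/-- The action of a simple reflection on sums of monomials with integral multiplicities. -/
def sZ (r : T.Root) : T.Puiseux ℤ →+* T.Puiseux ℤ :=
  ((AddMonoidAlgebra.domCongr ℤ ℤ (T.expAct r)).toRingEquiv : T.Puiseux ℤ →+* T.Puiseux ℤ)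

theorem sZ_single (r : T.Root) (x : T.Root → ℚ) (c : ℤ) :
    T.sZ r (AddMonoidAlgebra.single x c) = AddMonoidAlgebra.single (T.expAct r x) c := by
  simp [sZ]

theorem sZ_monoZ (r : T.Root) (x : T.Root → ℚ) :
    T.sZ r (T.monoZ x) = T.monoZ (T.expAct r x) := T.sZ_single r x 1

theorem sK_algebraMap_single (r : T.Root) (x : T.Root → ℚ) (c : ℂ) :
    T.sK r (algebraMap _ _ (AddMonoidAlgebra.single x c)) =
      algebraMap (T.Puiseux ℂ) T.K (AddMonoidAlgebra.single (T.expAct r x) c) := by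
  simp [sK]

theorem sK_mono (r : T.Root) (x : T.Root → ℚ) :
    T.sK r (T.mono x) = T.mono (T.expAct r x) := T.sK_algebraMap_single r x 1

theorem puiseuxToK_comp_sZ (r : T.Root) :
    T.puiseuxToK.comp (T.sZ r) = (T.sK r : T.K →+* T.K).comp T.puiseuxToK := by
  refine AddMonoidAlgebra.ringHom_ext ?_ ?_
  · intro c
    simp [sZ, puiseuxToK, sK]
  · intro x
    simp [sZ, puiseuxToK, sK]

theorem expAct_expAct (r : T.Root) (x : T.Root → ℚ) : T.expAct r (T.expAct r x) = x :=
  (T.expAct r).left_inv x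

theorem ringHom_K_ext {S : Type*} [CommRing S] {f g : T.K →+* S}
    (h : ∀ x c, f (algebraMap (T.Puiseux ℂ) T.K (AddMonoidAlgebra.single x c)) =
      g (algebraMap (T.Puiseux ℂ) T.K (AddMonoidAlgebra.single x c))) : f = g := by
  refine IsLocalization.ringHom_ext (nonZeroDivisors (T.Puiseux ℂ)) ?_
  refine AddMonoidAlgebra.ringHom_ext (fun c => h _ _) (fun x => h _ _)

theorem sK_sK (r : T.Root) (x : T.K) : T.sK r (T.sK r x) = x := by
  have : (T.sK r : T.K →+* T.K).comp (T.sK r : T.K →+* T.K) = RingHom.id _ := by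
    refine T.ringHom_K_ext fun x c => ?_
    simp only [RingHom.comp_apply, RingHom.coe_coe, sK_algebraMap_single, expAct_expAct,
      RingHom.id_apply]
  exact RingHom.congr_fun this x

/-! ### Simple reflections in coordinates -/

theorem root_mem (r : T.Root) : -(T.ℓ r.1 : ℤ) + 1 ≤ r.2 ∧ (r.2 : ℤ) ≤ T.k r.1 - 1 :=
  Finset.mem_Icc.1 r.2.2

theorem center_mem (c : T.Center) :
    (c.2 : ℤ) ≠ 0 ∧ -(T.ℓ c.1 : ℤ) ≤ c.2 ∧ (c.2 : ℤ) ≤ T.k c.1 := by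
  have h := c.2.2
  rwa [Finset.mem_erase, Finset.mem_Icc] at h

/-- One of the two centers involved in a simple root: `C_n^1` for `α_n^0` and `C_n^i` for `α_n^i`,
`i ≠ 0`. -/
def near (r : T.Root) : T.Center :=
  T.ctr r.1 (if (r.2 : ℤ) = 0 then 1 else r.2) (by
    have := T.root_mem r
    have := T.k_pos r.1
    split_ifs <;> omega)

/-- The other center involved in a simple root: `C_n^{-1}` for `α_n^0` and `C_n^{±(i+1)}` for
`α_n^{±i}`, `i > 0`. -/
def far (r : T.Root) : T.Center :=
  T.ctr r.1 (if (r.2 : ℤ) = 0 then -1 else if 0 < (r.2 : ℤ) then r.2 + 1 else r.2 - 1) (by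
    have := T.root_mem r
    have := T.ℓ_pos r.1
    split_ifs <;> omega)

@[simp] theorem near_fst (r : T.Root) : (T.near r).1 = r.1 := rfl
@[simp] theorem far_fst (r : T.Root) : (T.far r).1 = r.1 := rfl

theorem near_snd (r : T.Root) : ((T.near r).2 : ℤ) =
    if (r.2 : ℤ) = 0 then 1 else (r.2 : ℤ) := rfl

theorem far_snd (r : T.Root) : ((T.far r).2 : ℤ) =
    if (r.2 : ℤ) = 0 then -1 else if 0 < (r.2 : ℤ) then (r.2 : ℤ) + 1 else r.2 - 1 := rfl

theorem near_ne_far (r : T.Root) : T.near r ≠ T.far r := by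
  intro h
  have := (Sigma.subtype_ext_iff.1 h).2
  rw [near_snd, far_snd] at this
  split_ifs at this <;> omega

/-- The transposition of the two centers involved in a simple root. -/
def centerSwap (r : T.Root) : Equiv.Perm T.Center := Equiv.swap (T.near r) (T.far r)

@[simp] theorem centerSwap_near (r : T.Root) : T.centerSwap r (T.near r) = T.far r :=
  Equiv.swap_apply_left _ _

@[simp] theorem centerSwap_far (r : T.Root) : T.centerSwap r (T.far r) = T.near r :=
  Equiv.swap_apply_right _ _

@[simp] theorem centerSwap_centerSwap (r : T.Root) (c : T.Center) :
    T.centerSwap r (T.centerSwap r c) = c :=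
  Equiv.swap_apply_self _ _ _

theorem centerSwap_of_ne {r : T.Root} {c : T.Center} (h : c ≠ T.near r) (h' : c ≠ T.far r) :
    T.centerSwap r c = c := Equiv.swap_apply_of_ne_of_ne h h'

@[simp] theorem centerSwap_fst (r : T.Root) (c : T.Center) : (T.centerSwap r c).1 = c.1 := by
  by_cases h : c = T.near r
  · subst h; simp
  by_cases h' : c = T.far r
  · subst h'; simp
  rw [T.centerSwap_of_ne h h']

theorem E_center (c : T.Center) : T.E c.1 c.2 = (0, Pi.single c 1) :=
  T.E_ctr _ _ (T.center_mem c)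

variable {T} in
theorem E_eq_single {n : ZMod T.N} {i : ℤ} (c : T.Center) (hn : c.1 = n) (hi : (c.2 : ℤ) = i) :
    T.E n i = (0, Pi.single c 1) := by
  subst hn hi
  exact T.E_center c

theorem α_of_eq_zero {r : T.Root} (h : (r.2 : ℤ) = 0) :
    T.α r = (Pi.single r.1 1, -Pi.single (T.near r) 1 - Pi.single (T.far r) 1) := by
  rw [α, if_pos h, E_eq_single (T.near r) (T.near_fst r) (by simp [near_snd, h]),
    E_eq_single (T.far r) (T.far_fst r) (by simp [far_snd, h]), H]
  simp

theorem α_of_ne_zero {r : T.Root} (h : (r.2 : ℤ) ≠ 0) :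
    T.α r = (0, Pi.single (T.near r) 1 - Pi.single (T.far r) 1) := by
  rw [α, if_neg h]
  split_ifs with h1 <;>
  · rw [E_eq_single (T.near r) (T.near_fst r) (by simp [near_snd, h]),
      E_eq_single (T.far r) (T.far_fst r) (by simp [far_snd, h, h1])]
    simp

theorem coα_of_eq_zero {r : T.Root} (h : (r.2 : ℤ) = 0) :
    T.coα r = (Pi.single (r.1 - 1) 1 + Pi.single (r.1 + 1) 1,
      -Pi.single (T.near r) 1 - Pi.single (T.far r) 1) := by
  rw [coα, if_pos h, E_eq_single (T.near r) (T.near_fst r) (by simp [near_snd, h]),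
    E_eq_single (T.far r) (T.far_fst r) (by simp [far_snd, h]), H, H]
  simp

theorem coα_of_ne_zero {r : T.Root} (h : (r.2 : ℤ) ≠ 0) :
    T.coα r = (0, Pi.single (T.near r) 1 - Pi.single (T.far r) 1) := by
  rw [← T.α_of_ne_zero h, coα, α, if_neg h, if_neg h]

theorem pairing_of_eq_zero {r : T.Root} (h : (r.2 : ℤ) = 0) (Λ : T.NS) :
    T.pairing (T.coα r) Λ =
      T.deg Λ (r.1 - 1) + T.deg Λ (r.1 + 1) - T.mult Λ (T.near r) - T.mult Λ (T.far r) := by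
  simp only [pairing, T.coα_of_eq_zero h, deg, mult, LinearMap.coe_mk, AddHom.coe_mk, Pi.add_apply,
    Pi.sub_apply, Pi.neg_apply, mul_add, mul_sub, mul_neg, Finset.sum_add_distrib,
    Finset.sum_sub_distrib, Finset.sum_neg_distrib, Pi.single_apply, mul_ite, mul_one, mul_zero,
    Finset.sum_ite_eq', Finset.mem_univ, if_true]
  ring

theorem pairing_of_ne_zero {r : T.Root} (h : (r.2 : ℤ) ≠ 0) (Λ : T.NS) :
    T.pairing (T.coα r) Λ = T.mult Λ (T.near r) - T.mult Λ (T.far r) := by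
  simp only [pairing, T.coα_of_ne_zero h, mult, LinearMap.coe_mk, AddHom.coe_mk, Pi.zero_apply,
    Pi.sub_apply, mul_sub, Finset.sum_sub_distrib, Pi.single_apply, mul_ite, mul_one, mul_zero,
    Finset.sum_ite_eq', Finset.mem_univ, if_true, Finset.sum_const_zero]
  ring

theorem s_apply (r : T.Root) (Λ : T.NS) :
    T.s r Λ = Λ + T.pairing (T.coα r) Λ • T.α r := rfl

theorem s_s (r : T.Root) (Λ : T.NS) : T.s r (T.s r Λ) = Λ := (T.s r).left_inv Λ

theorem deg_s_of_ne_zero {r : T.Root} (h : (r.2 : ℤ) ≠ 0) (Λ : T.NS) :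
    T.deg (T.s r Λ) = T.deg Λ := by
  funext n
  simp [deg, s_apply, T.α_of_ne_zero h]

theorem mult_s_of_ne_zero {r : T.Root} (h : (r.2 : ℤ) ≠ 0) (Λ : T.NS) (c : T.Center) :
    T.mult (T.s r Λ) c = T.mult Λ (T.centerSwap r c) := by
  have hne := T.near_ne_far r
  simp only [mult, s_apply, T.α_of_ne_zero h, T.pairing_of_ne_zero h, Prod.smul_mk, Prod.snd_add,
    Pi.add_apply, Pi.smul_apply, Pi.sub_apply, smul_eq_mul]
  by_cases h1 : c = T.near r
  · subst h1; simp [hne]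
  by_cases h2 : c = T.far r
  · subst h2; simp [hne.symm]
  simp [T.centerSwap_of_ne h1 h2, h1, h2]

theorem deg_s_of_eq_zero {r : T.Root} (h : (r.2 : ℤ) = 0) (Λ : T.NS) :
    T.deg (T.s r Λ) = T.deg Λ + Pi.single r.1 (T.deg Λ (r.1 - 1) + T.deg Λ (r.1 + 1)
      - T.mult Λ (T.near r) - T.mult Λ (T.far r)) := by
  rw [← T.pairing_of_eq_zero h]
  funext n
  simp [deg, s_apply, T.α_of_eq_zero h, Pi.single_apply]

theorem mult_s_near {r : T.Root} (h : (r.2 : ℤ) = 0) (Λ : T.NS) :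
    T.mult (T.s r Λ) (T.near r) =
      T.deg Λ (r.1 - 1) + T.deg Λ (r.1 + 1) - T.mult Λ (T.far r) := by
  have : T.mult (T.s r Λ) (T.near r) = T.mult Λ (T.near r) + T.pairing (T.coα r) Λ := by
    simp [mult, s_apply, T.α_of_eq_zero h, T.near_ne_far r, add_comm]
  rw [this, T.pairing_of_eq_zero h]
  ring

theorem mult_s_far {r : T.Root} (h : (r.2 : ℤ) = 0) (Λ : T.NS) :
    T.mult (T.s r Λ) (T.far r) =
      T.deg Λ (r.1 - 1) + T.deg Λ (r.1 + 1) - T.mult Λ (T.near r) := by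
  have : T.mult (T.s r Λ) (T.far r) = T.mult Λ (T.far r) + T.pairing (T.coα r) Λ := by
    simp [mult, s_apply, T.α_of_eq_zero h, (T.near_ne_far r).symm, add_comm]
  rw [this, T.pairing_of_eq_zero h]
  ring

theorem mult_s_of_ne {r : T.Root} (h : (r.2 : ℤ) = 0) (Λ : T.NS) {c : T.Center}
    (h1 : c ≠ T.near r) (h2 : c ≠ T.far r) : T.mult (T.s r Λ) c = T.mult Λ c := by
  simp [mult, s_apply, T.α_of_eq_zero h, h1, h2]

/-! ### The root lattice with rational coefficients -/

/-- The coefficient `x_{(n, j)}` of an exponent vector, set to `0` where there is no root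
`α_n^j`. The coefficient of `H_n` in `∑ x_t α_t` is `extendZero x n 0`. -/
def extendZero (x : T.Root → ℚ) (n : ZMod T.N) (j : ℤ) : ℚ :=
  if h : j ∈ Finset.Icc (-(T.ℓ n : ℤ) + 1) ((T.k n : ℤ) - 1) then x ⟨n, j, h⟩ else 0

theorem extendZero_root (x : T.Root → ℚ) (r : T.Root) : T.extendZero x r.1 r.2 = x r := by
  rw [extendZero, dif_pos r.2.2]

/-- The coefficient of `E_n^i` in `∑ x_t α_t`. -/
def coeffE (x : T.Root → ℚ) (c : T.Center) : ℚ :=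
  T.extendZero x c.1 c.2 - T.extendZero x c.1 (c.2 - (c.2 : ℤ).sign)

theorem sum_mul_indicator (x : T.Root → ℚ) (n : ZMod T.N) (j : ℤ) :
    ∑ t : T.Root, x t * (if t.1 = n ∧ (t.2 : ℤ) = j then 1 else 0) = T.extendZero x n j := by
  by_cases h : j ∈ Finset.Icc (-(T.ℓ n : ℤ) + 1) ((T.k n : ℤ) - 1)
  · rw [extendZero, dif_pos h, Finset.sum_eq_single ⟨n, j, h⟩]
    · simp
    · intro t _ ht
      rw [if_neg, mul_zero]
      exact fun h' => ht (Sigma.subtype_ext h'.1 h'.2)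
    · simp
  · rw [extendZero, dif_neg h]
    refine Finset.sum_eq_zero fun t _ => ?_
    rw [if_neg, mul_zero]
    rintro ⟨rfl, rfl⟩
    exact h t.2.2

theorem α_fst (t : T.Root) (n : ZMod T.N) :
    (T.α t).1 n = if t.1 = n ∧ (t.2 : ℤ) = 0 then 1 else 0 := by
  by_cases h : (t.2 : ℤ) = 0
  · simp [T.α_of_eq_zero h, h, Pi.single_apply, eq_comm]
  · simp [T.α_of_ne_zero h, h]

theorem α_snd (t : T.Root) (c : T.Center) :
    (T.α t).2 c = (if t.1 = c.1 ∧ (t.2 : ℤ) = c.2 then 1 else 0) -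
      (if t.1 = c.1 ∧ (t.2 : ℤ) = c.2 - (c.2 : ℤ).sign then 1 else 0) := by
  have hc := T.center_mem c
  have h_near : c = T.near t ↔ t.1 = c.1 ∧ (c.2 : ℤ) =
      if (t.2 : ℤ) = 0 then 1 else (t.2 : ℤ) :=
    Sigma.subtype_ext_iff.trans (and_congr eq_comm Iff.rfl)
  have h_far : c = T.far t ↔ t.1 = c.1 ∧ (c.2 : ℤ) =
      if (t.2 : ℤ) = 0 then -1 else if 0 < (t.2 : ℤ) then (t.2 : ℤ) + 1 else t.2 - 1 :=
    Sigma.subtype_ext_iff.trans (and_congr eq_comm Iff.rfl)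
  by_cases hn : t.1 = c.1
  swap
  · by_cases h : (t.2 : ℤ) = 0
    · simp [T.α_of_eq_zero h, h_near, h_far, hn]
    · simp [T.α_of_ne_zero h, h_near, h_far, hn]
  have hsign := sign_cases_of_ne_zero hc.1
  by_cases h : (t.2 : ℤ) = 0
  · simp only [T.α_of_eq_zero h, Pi.sub_apply, Pi.neg_apply, Pi.single_apply, h_near, h_far, hn, h,
      true_and, if_true]
    split_ifs <;> omega
  · simp only [T.α_of_ne_zero h, Pi.sub_apply, Pi.single_apply, h_near, h_far, hn, h,
      true_and, if_false]
    split_ifs <;> omega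

theorem sum_mul_α_fst (x : T.Root → ℚ) (n : ZMod T.N) :
    ∑ t, x t * ((T.α t).1 n : ℚ) = T.extendZero x n 0 := by
  rw [← sum_mul_indicator]
  refine Finset.sum_congr rfl fun t _ => ?_
  rw [α_fst]
  push_cast
  rfl

theorem sum_mul_α_snd (x : T.Root → ℚ) (c : T.Center) :
    ∑ t, x t * ((T.α t).2 c : ℚ) = T.coeffE x c := by
  rw [coeffE, ← sum_mul_indicator, ← sum_mul_indicator, ← Finset.sum_sub_distrib]
  refine Finset.sum_congr rfl fun t _ => ?_
  rw [α_snd]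
  push_cast
  ring

theorem expAct_apply (r : T.Root) (x : T.Root → ℚ) :
    T.expAct r x = x + Pi.single r (∑ t, x t * (T.pairing (T.coα r) (T.α t) : ℚ)) := rfl

theorem expAct_of_ne_zero {r : T.Root} (h : (r.2 : ℤ) ≠ 0) (x : T.Root → ℚ) :
    T.expAct r x = x + Pi.single r (T.coeffE x (T.far r) - T.coeffE x (T.near r)) := by
  rw [expAct_apply]
  congr 2
  rw [← sum_mul_α_snd, ← sum_mul_α_snd, ← Finset.sum_sub_distrib]
  refine Finset.sum_congr rfl fun t _ => ?_
  rw [T.pairing_of_ne_zero h, mult, mult]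
  push_cast
  ring

theorem expAct_of_eq_zero {r : T.Root} (h : (r.2 : ℤ) = 0) (x : T.Root → ℚ) :
    T.expAct r x = x + Pi.single r (T.extendZero x (r.1 - 1) 0 + T.extendZero x (r.1 + 1) 0 +
      T.coeffE x (T.near r) + T.coeffE x (T.far r)) := by
  rw [expAct_apply]
  congr 2
  rw [← sum_mul_α_snd, ← sum_mul_α_snd, ← sum_mul_α_fst, ← sum_mul_α_fst,
    ← Finset.sum_add_distrib, ← Finset.sum_add_distrib, ← Finset.sum_add_distrib]
  refine Finset.sum_congr rfl fun t _ => ?_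
  rw [T.pairing_of_eq_zero h, mult, mult, deg, deg]
  push_cast
  ring

theorem extendZero_of_notMem (x : T.Root → ℚ) {n : ZMod T.N} {j : ℤ}
    (h : ¬(-(T.ℓ n : ℤ) + 1 ≤ j ∧ j ≤ T.k n - 1)) : T.extendZero x n j = 0 :=
  dif_neg (mt Finset.mem_Icc.1 h)

theorem extendZero_sub_sign {x : T.Root → ℚ} (hx : ∀ c, T.coeffE x c = 0) (n : ZMod T.N) {j : ℤ}
    (hj : j ≠ 0) : T.extendZero x n j = T.extendZero x n (j - j.sign) := by
  by_cases hc : -(T.ℓ n : ℤ) ≤ j ∧ j ≤ T.k n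
  · exact sub_eq_zero.1 (hx (T.ctr n j ⟨hj, hc⟩))
  · have hsign := sign_cases_of_ne_zero hj
    rw [T.extendZero_of_notMem x (by omega), T.extendZero_of_notMem x (by omega)]

/-- This is the linear independence of the simple roots. -/
theorem eq_zero_of_coeffE_eq_zero {x : T.Root → ℚ} (h0 : ∀ n, T.extendZero x n 0 = 0)
    (h : ∀ c, T.coeffE x c = 0) : x = 0 := by
  have hzero : ∀ n j, T.extendZero x n j = 0 := by
    intro n j
    induction j with
    | zero => exact h0 n
    | succ j ih =>
      rw [T.extendZero_sub_sign h n (by omega), Int.sign_eq_one_of_pos (by omega),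
        add_sub_cancel_right, ih]
    | pred j ih =>
      rw [T.extendZero_sub_sign h n (by omega), Int.sign_eq_neg_one_of_neg (by omega),
        sub_neg_eq_add, sub_add_cancel, ih]
  funext r
  rw [← T.extendZero_root x r, hzero, Pi.zero_apply]

/-! ### The parameters of the centers -/

/-- The integral part of the exponents of the parameter of `C_n^i`: the root variable `a_n^j` enters
it with exponent `(ℓ_n + j) / (k_n + ℓ_n) - paramStep j`. -/
def paramStep (c : T.Center) (j : ℤ) : ℚ :=
  if 0 < (c.2 : ℤ) then (if (c.2 : ℤ) ≤ j then 1 else 0) else (if (c.2 : ℤ) < j then 1 else 0)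

/-- The exponent vector of the parameter `u_n^i` of `C_n^i`, resp. `1 / v_n^{-j}` of `C_n^{-j}`. -/
def paramExp (c : T.Center) : T.Root → ℚ := fun r =>
  if r.1 = c.1 then (T.ℓ c.1 + (r.2 : ℤ)) / (T.k c.1 + T.ℓ c.1) - T.paramStep c r.2 else 0

theorem k_add_ℓ_pos (n : ZMod T.N) : (0 : ℚ) < T.k n + T.ℓ n := by
  have := T.k_pos n
  positivity

theorem u_eq_mono (c : T.Center) (h : 0 < (c.2 : ℤ)) : T.u c.1 c.2 = T.mono (T.paramExp c) := by
  rw [u]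
  congr 1
  funext r
  have hk : (0 : ℚ) < T.k c.1 := by exact_mod_cast T.k_pos c.1
  have hl : (0 : ℚ) < T.ℓ c.1 := by exact_mod_cast T.ℓ_pos c.1
  simp only [Pi.add_apply, uExp, paramExp, paramStep, h, if_true]
  by_cases hn : r.1 = c.1
  swap
  · simp [hn]
  simp only [hn, ne_eq, not_true, if_false, true_and, if_true]
  by_cases h0 : (r.2 : ℤ) = 0
  · rw [if_pos h0, if_neg (by omega), if_neg (by omega), h0]
    simp
  · split_ifs <;> first | omega | (field_simp; ring)

theorem vInv_eq_mono (c : T.Center) (h : ¬ 0 < (c.2 : ℤ)) :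
    T.vInv c.1 c.2 = T.mono (T.paramExp c) := by
  have hc := (T.center_mem c).1
  rw [vInv, ← mono_neg]
  congr 1
  funext r
  have hk : (0 : ℚ) < T.k c.1 := by exact_mod_cast T.k_pos c.1
  have hl : (0 : ℚ) < T.ℓ c.1 := by exact_mod_cast T.ℓ_pos c.1
  simp only [Pi.neg_apply, Pi.add_apply, vExp, paramExp, paramStep, h, if_false]
  by_cases hn : r.1 = c.1
  swap
  · simp [hn]
  simp only [hn, ne_eq, not_true, if_false, true_and, if_true]
  by_cases h0 : (r.2 : ℤ) = 0
  · rw [if_pos h0, if_neg (by omega), if_pos (by omega), h0]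
    field_simp
    ring
  · split_ifs <;> first | omega | (field_simp; ring)

theorem uExp_eq {r : T.Root} (h : (r.2 : ℤ) = 0) : T.uExp r.1 = T.paramExp (T.near r) := by
  have := T.u_eq_mono (T.near r) (by rw [near_snd, if_pos h]; omega)
  rw [u] at this
  rw [← T.mono_injective this]
  funext t
  rw [near_snd, if_pos h, Pi.add_apply, if_neg (by omega), add_zero]
  rfl

theorem vExp_eq {r : T.Root} (h : (r.2 : ℤ) = 0) : T.vExp r.1 = -T.paramExp (T.far r) := by
  have := T.vInv_eq_mono (T.far r) (by rw [far_snd, if_pos h]; omega)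
  rw [vInv, ← mono_neg] at this
  rw [← T.mono_injective this]
  funext t
  rw [far_snd, if_pos h, neg_neg, Pi.add_apply, if_neg (by omega), add_zero]
  rfl

theorem extendZero_paramExp (c : T.Center) (n : ZMod T.N) (j : ℤ) (h : -(T.ℓ n : ℤ) ≤ j)
    (h' : j ≤ T.k n) : T.extendZero (T.paramExp c) n j =
      if n = c.1 then (T.ℓ c.1 + j) / (T.k c.1 + T.ℓ c.1) - T.paramStep c j else 0 := by
  have hs := T.k_add_ℓ_pos c.1
  have hc := T.center_mem c
  rw [extendZero]
  split_ifs with h1 h2 h2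
  · simp [paramExp, h2]
  · simp [paramExp, h2]
  · subst h2
    rw [Finset.mem_Icc] at h1
    obtain rfl | rfl : j = -(T.ℓ c.1 : ℤ) ∨ j = T.k c.1 := by omega
    · rw [paramStep]
      split_ifs <;> first | omega | simp
    · rw [paramStep]
      have : ((T.ℓ c.1 : ℚ) + ((T.k c.1 : ℤ) : ℚ)) / (T.k c.1 + T.ℓ c.1) = 1 := by
        rw [div_eq_one_iff_eq hs.ne']
        push_cast
        ring
      rw [this]
      split_ifs <;> first | omega | simp
  · rfl

theorem extendZero_paramExp_zero (c : T.Center) (n : ZMod T.N) :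
    T.extendZero (T.paramExp c) n 0 =
      if n = c.1 then (T.ℓ c.1 : ℚ) / (T.k c.1 + T.ℓ c.1) - (if 0 < (c.2 : ℤ) then 0 else 1)
      else 0 := by
  have hc := (T.center_mem c).1
  have hstep : T.paramStep c 0 = if 0 < (c.2 : ℤ) then 0 else 1 := by
    rw [paramStep]
    split_ifs <;> first | omega | rfl
  rw [T.extendZero_paramExp c n 0 (by omega) (by omega), hstep, Int.cast_zero, add_zero]

theorem paramStep_sub_paramStep (c : T.Center) {j : ℤ} (hj : j ≠ 0) :
    T.paramStep c j - T.paramStep c (j - j.sign) = if j = c.2 then ((c.2 : ℤ).sign : ℚ) else 0 := by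
  have hc := (T.center_mem c).1
  unfold paramStep
  obtain ⟨hlt, hsgn⟩ | ⟨hlt, hsgn⟩ := sign_cases_of_ne_zero hj <;>
  obtain ⟨hlt', hsgn'⟩ | ⟨hlt', hsgn'⟩ := sign_cases_of_ne_zero hc <;>
  · rw [hsgn, hsgn']
    split_ifs <;> first | omega | norm_num

theorem coeffE_paramExp (c c' : T.Center) : T.coeffE (T.paramExp c) c' =
    (if c'.1 = c.1 then ((c'.2 : ℤ).sign : ℚ) / (T.k c.1 + T.ℓ c.1) else 0) -
      if c' = c then ((c.2 : ℤ).sign : ℚ) else 0 := by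
  have hc' := T.center_mem c'
  have hsign := sign_cases_of_ne_zero hc'.1
  rw [coeffE, T.extendZero_paramExp c c'.1 _ (by omega) (by omega),
    T.extendZero_paramExp c c'.1 _ (by omega) (by omega)]
  by_cases hn : c'.1 = c.1
  · have hcc : c' = c ↔ (c'.2 : ℤ) = c.2 :=
      Sigma.subtype_ext_iff.trans (and_iff_right hn)
    simp only [if_pos hn, hcc, ← T.paramStep_sub_paramStep c hc'.1]
    push_cast
    ring
  · rw [if_neg hn, if_neg hn, if_neg hn, if_neg (mt (congrArg Sigma.fst) hn)]

theorem coeffE_paramExp_of_fst_ne {c c' : T.Center} (h : c'.1 ≠ c.1) :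
    T.coeffE (T.paramExp c) c' = 0 := by
  rw [coeffE_paramExp, if_neg h, if_neg (mt (congrArg Sigma.fst) h), sub_zero]

theorem paramExp_near (r : T.Root) : T.paramExp (T.near r) = T.paramExp (T.far r) +
    Pi.single r (if (r.2 : ℤ) = 0 then 1 else -((r.2 : ℤ).sign : ℚ)) := by
  funext t
  simp only [paramExp, near_fst, far_fst, paramStep, near_snd, far_snd, Pi.add_apply,
    Pi.single_apply, Sigma.subtype_ext_iff]
  by_cases hn : t.1 = r.1
  swap
  · simp [hn]
  simp only [hn, true_and, if_true]
  by_cases h0 : (r.2 : ℤ) = 0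
  · simp only [h0, if_true]
    split_ifs <;> first | omega | ring
  · simp only [h0, if_false]
    obtain ⟨hlt, hsgn⟩ | ⟨hlt, hsgn⟩ := sign_cases_of_ne_zero h0 <;>
    · rw [hsgn]
      push_cast
      split_ifs <;> first | omega | ring

theorem paramExp_centerSwap {r : T.Root} {a : ℚ}
    (ha : T.paramExp (T.near r) = T.paramExp (T.far r) + Pi.single r a) (c : T.Center) :
    T.paramExp (T.centerSwap r c) = T.paramExp c +
      Pi.single r ((if T.far r = c then a else 0) - if T.near r = c then a else 0) := by
  have hne := T.near_ne_far r
  by_cases h1 : T.near r = c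
  · subst h1
    simp [hne.symm, ha, add_assoc, ← Pi.single_add]
  by_cases h2 : T.far r = c
  · subst h2
    simp [hne, ha]
  · simp [T.centerSwap_of_ne (Ne.symm h1) (Ne.symm h2), h1, h2]

theorem add_one_ne_sub_one (n : ZMod T.N) : n + 1 ≠ n - 1 := by
  have h3 := T.three_le
  intro h
  have h' : ((2 : ℕ) : ZMod T.N) = 0 := by
    have : (n + 1) - (n - 1) = 0 := sub_eq_zero.2 h
    push_cast
    rw [← this]
    ring
  rw [ZMod.natCast_eq_zero_iff] at h'
  have := Nat.le_of_dvd two_pos h'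
  omega

theorem sign_near {r : T.Root} (h : (r.2 : ℤ) ≠ 0) : ((T.near r).2 : ℤ).sign = (r.2 : ℤ).sign := by
  rw [near_snd, if_neg h]

theorem sign_far {r : T.Root} (h : (r.2 : ℤ) ≠ 0) : ((T.far r).2 : ℤ).sign = (r.2 : ℤ).sign := by
  rw [far_snd, if_neg h]
  obtain ⟨hlt, hsgn⟩ | ⟨hlt, hsgn⟩ := sign_cases_of_ne_zero h
  · rw [if_pos hlt, hsgn, Int.sign_eq_one_of_pos (by omega)]
  · rw [if_neg (by omega), hsgn, Int.sign_eq_neg_one_of_neg (by omega)]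

theorem expAct_paramExp_of_ne_zero {r : T.Root} (h : (r.2 : ℤ) ≠ 0) (c : T.Center) :
    T.expAct r (T.paramExp c) = T.paramExp (T.centerSwap r c) := by
  have hnear := T.paramExp_near r
  rw [if_neg h] at hnear
  rw [T.expAct_of_ne_zero h, T.paramExp_centerSwap hnear, coeffE_paramExp, coeffE_paramExp,
    T.sign_near h, T.sign_far h, near_fst, far_fst]
  congr 2
  have hsign : ∀ c' : T.Center, (c'.2 : ℤ).sign = (r.2 : ℤ).sign →
      (if c' = c then (((c.2 : ℤ).sign : ℤ) : ℚ) else 0) =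
        if c' = c then (((r.2 : ℤ).sign : ℤ) : ℚ) else 0 := by
    rintro c' hc'
    split_ifs with h'
    · rw [← h', hc']
    · rfl
  rw [hsign _ (T.sign_near h), hsign _ (T.sign_far h)]
  split_ifs <;> ring

theorem expAct_paramExp_of_fst_eq {r : T.Root} (h0 : (r.2 : ℤ) = 0) {c : T.Center}
    (hc : c.1 = r.1) : T.expAct r (T.paramExp c) = T.paramExp (T.centerSwap r c) := by
  obtain ⟨n, i⟩ := c
  obtain rfl : n = r.1 := hc
  have hnear := T.paramExp_near r
  rw [if_pos h0] at hnear
  have near_eq : ((T.near r).2 : ℤ) = 1 := by rw [near_snd, if_pos h0]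
  have far_eq : ((T.far r).2 : ℤ) = -1 := by rw [far_snd, if_pos h0]
  have hsign : ∀ c' : T.Center, (if c' = ⟨r.1, i⟩ then (((i : ℤ).sign : ℤ) : ℚ) else 0) =
      if c' = ⟨r.1, i⟩ then (((c'.2 : ℤ).sign : ℤ) : ℚ) else 0 := by
    intro c'
    split_ifs with h'
    · rw [h']
    · rfl
  rw [T.expAct_of_eq_zero h0, T.paramExp_centerSwap hnear, extendZero_paramExp_zero,
    extendZero_paramExp_zero, coeffE_paramExp, coeffE_paramExp, if_neg (T.sub_one_ne r.1),
    if_neg (T.add_one_ne r.1), hsign, hsign, near_eq, far_eq]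
  congr 2
  simp only [near_fst, far_fst, if_true]
  norm_num
  split_ifs <;> ring

theorem expAct_paramExp {r : T.Root} {c : T.Center} (h : (r.2 : ℤ) ≠ 0 ∨ c.1 = r.1) :
    T.expAct r (T.paramExp c) = T.paramExp (T.centerSwap r c) := by
  by_cases h0 : (r.2 : ℤ) = 0
  · exact T.expAct_paramExp_of_fst_eq h0 (h.resolve_left (not_not_intro h0))
  · exact T.expAct_paramExp_of_ne_zero h0 c

theorem expAct_paramExp_of_ne {r : T.Root} (h0 : (r.2 : ℤ) = 0) {c : T.Center} (h : c.1 ≠ r.1)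
    (h1 : c.1 ≠ r.1 - 1) (h2 : c.1 ≠ r.1 + 1) : T.expAct r (T.paramExp c) = T.paramExp c := by
  rw [T.expAct_of_eq_zero h0, extendZero_paramExp_zero, extendZero_paramExp_zero,
    T.coeffE_paramExp_of_fst_ne h.symm, T.coeffE_paramExp_of_fst_ne h.symm, if_neg h1.symm,
    if_neg h2.symm]
  simp

theorem θ0_pos (n : ZMod T.N) : 0 < T.θ0 n := by
  have := T.k_pos (n + 1)
  unfold θ0
  positivity

theorem θinf_pos (n : ZMod T.N) : 0 < T.θinf n := by
  have := T.k_pos (n - 1)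
  unfold θinf
  positivity

theorem one_sub_ω (n : ZMod T.N) : 1 - T.ω n = T.θinf n / (T.θ0 n + T.θinf n) := by
  have := T.θ0_pos n
  have := T.θinf_pos n
  rw [ω]
  field_simp
  ring

theorem ω_eq (hT : ∀ n : ZMod T.N, T.k (n - 1) * T.k (n + 1) = T.ℓ (n - 1) * T.ℓ (n + 1))
    (n : ZMod T.N) : T.ω n = T.ℓ (n - 1) / (T.k (n - 1) + T.ℓ (n - 1)) := by
  have h0 := T.θ0_pos n
  have hinf := T.θinf_pos n
  have hT' : (T.k (n - 1) : ℚ) * T.k (n + 1) = T.ℓ (n - 1) * T.ℓ (n + 1) := by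
    exact_mod_cast hT n
  rw [ω, div_eq_div_iff (by positivity) (T.k_add_ℓ_pos _).ne', θ0, θinf]
  linear_combination hT'

theorem one_sub_ω_eq
    (hT : ∀ n : ZMod T.N, T.k (n - 1) * T.k (n + 1) = T.ℓ (n - 1) * T.ℓ (n + 1))
    (n : ZMod T.N) : 1 - T.ω n = T.ℓ (n + 1) / (T.k (n + 1) + T.ℓ (n + 1)) := by
  have h0 := T.θ0_pos n
  have hinf := T.θinf_pos n
  have hT' : (T.k (n - 1) : ℚ) * T.k (n + 1) = T.ℓ (n - 1) * T.ℓ (n + 1) := by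
    exact_mod_cast hT n
  rw [one_sub_ω, div_eq_div_iff (by positivity) (T.k_add_ℓ_pos _).ne', θ0, θinf]
  linear_combination hT'

theorem expAct_paramExp_sub_one
    (hT : ∀ n : ZMod T.N, T.k (n - 1) * T.k (n + 1) = T.ℓ (n - 1) * T.ℓ (n + 1))
    {r : T.Root} (h0 : (r.2 : ℤ) = 0) {c : T.Center} (h : c.1 = r.1 - 1) :
    T.expAct r (T.paramExp c) =
      T.paramExp c + Pi.single r (T.ω r.1 - if 0 < (c.2 : ℤ) then 0 else 1) := by
  obtain ⟨n, i⟩ := c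
  obtain rfl : n = r.1 - 1 := h
  have hne := (T.sub_one_ne r.1).symm
  rw [T.expAct_of_eq_zero h0, extendZero_paramExp_zero, extendZero_paramExp_zero,
    T.coeffE_paramExp_of_fst_ne hne, T.coeffE_paramExp_of_fst_ne hne,
    if_pos rfl, if_neg (T.add_one_ne_sub_one r.1), T.ω_eq hT, add_zero, add_zero, add_zero]

theorem expAct_paramExp_add_one
    (hT : ∀ n : ZMod T.N, T.k (n - 1) * T.k (n + 1) = T.ℓ (n - 1) * T.ℓ (n + 1))
    {r : T.Root} (h0 : (r.2 : ℤ) = 0) {c : T.Center} (h : c.1 = r.1 + 1) :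
    T.expAct r (T.paramExp c) =
      T.paramExp c + Pi.single r ((1 - T.ω r.1) - if 0 < (c.2 : ℤ) then 0 else 1) := by
  obtain ⟨n, i⟩ := c
  obtain rfl : n = r.1 + 1 := h
  have hne := (T.add_one_ne r.1).symm
  rw [T.expAct_of_eq_zero h0, extendZero_paramExp_zero, extendZero_paramExp_zero,
    T.coeffE_paramExp_of_fst_ne hne, T.coeffE_paramExp_of_fst_ne hne,
    if_pos rfl, if_neg (T.add_one_ne_sub_one r.1).symm, T.one_sub_ω_eq hT, add_zero, add_zero,
    zero_add]

/-! ### Multihomogeneous polynomials -/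

/-- `f` is multihomogeneous of multidegree `d`. -/
abbrev IsMultihomogeneous {A : Type*} [CommSemiring A] (d : ZMod T.N → ℤ)
    (f : MvPolynomial T.Coord A) : Prop :=
  MvPolynomial.IsWeightedHomogeneous (fun z : T.Coord => (Pi.single z.1 1 : ZMod T.N → ℤ)) f d

theorem weight_coord (m : T.Coord →₀ ℕ) (n : ZMod T.N) :
    Finsupp.weight (fun z : T.Coord => (Pi.single z.1 1 : ZMod T.N → ℤ)) m n =
      ((m (n, 0) : ℕ) : ℤ) + (m (n, 1) : ℕ) := by
  rw [Finsupp.weight_apply, Finsupp.sum_fintype _ _ (by simp), Fintype.sum_prod_type]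
  simp [Finset.sum_apply, Pi.single_apply, Finset.sum_add_distrib]

theorem mem_iInf_weightedHomogeneousSubmodule (d : ZMod T.N → ℤ) (f : MvPolynomial T.Coord T.K) :
    f ∈ (⨅ n : ZMod T.N, MvPolynomial.weightedHomogeneousSubmodule T.K
      (fun z : T.Coord => if z.1 = n then (1 : ℤ) else 0) (d n)) ↔ T.IsMultihomogeneous d f := by
  have hw : ∀ (m : T.Coord →₀ ℕ) n,
      Finsupp.weight (fun z : T.Coord => if z.1 = n then (1 : ℤ) else 0) m =
        Finsupp.weight (fun z : T.Coord => (Pi.single z.1 1 : ZMod T.N → ℤ)) m n := by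
    intro m n
    simp [Finsupp.weight_apply, Finsupp.sum, Finset.sum_apply, Pi.single_apply, eq_comm]
  simp only [Submodule.mem_iInf, MvPolynomial.mem_weightedHomogeneousSubmodule,
    MvPolynomial.IsWeightedHomogeneous, hw]
  exact ⟨fun h m hm => funext fun n => h n hm, fun h n m hm => congrFun (h hm) n⟩

section Multihomogeneous

variable {T} {A B : Type*} [CommRing A] [CommRing B] {d : ZMod T.N → ℤ}
  {f : MvPolynomial T.Coord A}

namespace IsMultihomogeneous

theorem degree_eq (hf : T.IsMultihomogeneous d f) {m : T.Coord →₀ ℕ} (hm : f.coeff m ≠ 0)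
    (n : ZMod T.N) : ((m (n, 0) : ℕ) : ℤ) + (m (n, 1) : ℕ) = d n := by
  rw [← T.weight_coord, hf hm]

theorem nonneg (hf : T.IsMultihomogeneous d f) (h : f ≠ 0) (n : ZMod T.N) : 0 ≤ d n := by
  obtain ⟨m, hm⟩ := MvPolynomial.ne_zero_iff.1 h
  rw [← hf.degree_eq hm n]
  positivity

theorem eval₂_mul (hf : T.IsMultihomogeneous d f) (φ : A →+* B) (c : ZMod T.N → B)
    (x : T.Coord → B) : MvPolynomial.eval₂ φ (fun z => c z.1 * x z) f =
      (∏ n, c n ^ (d n).toNat) * MvPolynomial.eval₂ φ x f := by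
  simp only [MvPolynomial.eval₂_eq', Finset.mul_sum]
  refine Finset.sum_congr rfl fun m hm => ?_
  have hd : ∀ n, (d n).toNat = m (n, 0) + m (n, 1) := fun n => by
    rw [← hf.degree_eq (MvPolynomial.mem_support_iff.1 hm) n]
    omega
  have hprod : ∏ z : T.Coord, (c z.1 * x z) ^ m z =
      (∏ n, c n ^ (d n).toNat) * ∏ z : T.Coord, x z ^ m z := by
    simp only [mul_pow, Finset.prod_mul_distrib]
    congr 1
    rw [Fintype.prod_prod_type]
    refine Finset.prod_congr rfl fun n _ => ?_
    rw [Fin.prod_univ_two, hd, pow_add]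
  rw [hprod]
  ring

end IsMultihomogeneous

end Multihomogeneous

/-! ### Ideals and linear forms of the centers -/

/-- The homogeneous coordinate number `n - 1` (`0` or `1` for `0` or `∞`) vanishing on `C_n^i`. -/
def side (c : T.Center) : Fin 2 := if 0 < (c.2 : ℤ) then 0 else 1

/-- The homogeneous coordinate number `n + 1` (`0` or `1` for `0` or `∞`) vanishing on `C_n^i`. -/
def coside (c : T.Center) : Fin 2 := if 0 < (c.2 : ℤ) then 1 else 0

section Forms

variable {A B : Type*} [CommRing A] [CommRing B] (e : (T.Root → ℚ) → A) (φ : A →+* B)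

/-- The linear form in the coordinates number `n` vanishing on the center `C_n^i`, where `e x` is
the monomial `a^x` of the coefficient ring. -/
def centerForm (c : T.Center) : MvPolynomial T.Coord A :=
  MvPolynomial.X (c.1, 0) + MvPolynomial.C (e (T.paramExp c)) * MvPolynomial.X (c.1, 1)

/-- The form `centerForm` in the scaling for which the substitution of `zeta` turns it into
`s_n^0(τ_n^{±1}) τ_n^{∓1}`. -/
def scaledForm (c : T.Center) : MvPolynomial T.Coord A :=
  MvPolynomial.C (e (-T.ω c.1 • T.paramExp c)) * T.centerForm e c

/-- The factor by which a simple reflection multiplies a homogeneous coordinate. -/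
def multiplier (r : T.Root) (z : T.Coord) : MvPolynomial T.Coord A :=
  if (r.2 : ℤ) = 0 then
    if z.1 = r.1 - 1 then T.scaledForm e (if z.2 = 0 then T.far r else T.near r)
    else if z.1 = r.1 + 1 then T.scaledForm e (if z.2 = 0 then T.near r else T.far r)
    else 1
  else 1

/-- The substitution of polynomials which acts on coefficients by `s` and multiplies the homogeneous
coordinates by `multiplier e r`. -/
def coordSubst (s : A →+* A) (r : T.Root) : MvPolynomial T.Coord A →+* MvPolynomial T.Coord A :=
  MvPolynomial.eval₂Hom (MvPolynomial.C.comp s)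
    (fun z => T.multiplier e r z * MvPolynomial.X z)

/-- The product of linear forms split off by the substitution `coordSubst` from a form belonging
to `Λ`. -/
def reflDenom (r : T.Root) (Λ : T.NS) : MvPolynomial T.Coord A :=
  if (r.2 : ℤ) = 0 then
    T.scaledForm e (T.near r) ^ (T.mult Λ (T.far r)).toNat *
      T.scaledForm e (T.far r) ^ (T.mult Λ (T.near r)).toNat
  else 1

/-- The product of linear forms acquired under a simple reflection by a form belonging to `Λ`; it
differs from `1` only in the presence of negative multiplicities. -/
def reflNumer (r : T.Root) (Λ : T.NS) : MvPolynomial T.Coord A :=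
  if (r.2 : ℤ) = 0 then
    T.scaledForm e (T.near r) ^ (-T.mult Λ (T.far r)).toNat *
      T.scaledForm e (T.far r) ^ (-T.mult Λ (T.near r)).toNat
  else 1

variable {T e}

theorem map_scaledForm (c : T.Center) :
    MvPolynomial.map φ (T.scaledForm e c) = T.scaledForm (fun x => φ (e x)) c := by
  simp [scaledForm, centerForm]

theorem map_multiplier (r : T.Root) (z : T.Coord) :
    MvPolynomial.map φ (T.multiplier e r z) = T.multiplier (fun x => φ (e x)) r z := by
  unfold multiplier
  split_ifs <;> simp [map_scaledForm]

theorem map_reflDenom (r : T.Root) (Λ : T.NS) :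
    MvPolynomial.map φ (T.reflDenom e r Λ) = T.reflDenom (fun x => φ (e x)) r Λ := by
  unfold reflDenom
  split_ifs <;> simp [map_scaledForm]

theorem map_reflNumer (r : T.Root) (Λ : T.NS) :
    MvPolynomial.map φ (T.reflNumer e r Λ) = T.reflNumer (fun x => φ (e x)) r Λ := by
  unfold reflNumer
  split_ifs <;> simp [map_scaledForm]

theorem multiplier_of_ne_zero {r : T.Root} (h : (r.2 : ℤ) ≠ 0) (z : T.Coord) :
    T.multiplier e r z = 1 := by
  rw [multiplier, if_neg h]

theorem multiplier_of_ne (r : T.Root) {z : T.Coord} (h1 : z.1 ≠ r.1 - 1)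
    (h2 : z.1 ≠ r.1 + 1) : T.multiplier e r z = 1 := by
  rw [multiplier, if_neg h1, if_neg h2, ite_self]

theorem multiplier_sub_one {r : T.Root} (h : (r.2 : ℤ) = 0) (i : Fin 2) :
    T.multiplier e r (r.1 - 1, i) = T.scaledForm e (if i = 0 then T.far r else T.near r) := by
  rw [multiplier, if_pos h, if_pos rfl]

theorem multiplier_add_one {r : T.Root} (h : (r.2 : ℤ) = 0) (i : Fin 2) :
    T.multiplier e r (r.1 + 1, i) = T.scaledForm e (if i = 0 then T.near r else T.far r) := by
  rw [multiplier, if_pos h, if_neg (T.add_one_ne_sub_one _), if_pos rfl]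

theorem isMultihomogeneous_scaledForm (c : T.Center) :
    T.IsMultihomogeneous (Pi.single c.1 1) (T.scaledForm e c) :=
  MvPolynomial.IsWeightedHomogeneous.C_mul
    ((MvPolynomial.isWeightedHomogeneous_X A _ ((c.1, 0) : T.Coord)).add
      ((MvPolynomial.isWeightedHomogeneous_X A _ ((c.1, 1) : T.Coord)).C_mul _)) _

end Forms

theorem centerIdeal_eq (c : T.Center) : T.centerIdeal c = Ideal.span
    {MvPolynomial.X (c.1 - 1, T.side c), T.centerForm T.mono c,
      MvPolynomial.X (c.1 + 1, T.coside c)} := by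
  unfold centerIdeal side coside centerForm
  split_ifs with h
  · rw [T.u_eq_mono c h]
  · rw [T.vInv_eq_mono c h]

theorem X_sub_mem (c : T.Center) : MvPolynomial.X (c.1 - 1, T.side c) ∈ T.centerIdeal c := by
  rw [centerIdeal_eq]
  exact Ideal.subset_span (by simp)

theorem X_add_mem (c : T.Center) : MvPolynomial.X (c.1 + 1, T.coside c) ∈ T.centerIdeal c := by
  rw [centerIdeal_eq]
  exact Ideal.subset_span (by simp)

theorem centerForm_mem (c : T.Center) : T.centerForm T.mono c ∈ T.centerIdeal c := by
  rw [centerIdeal_eq]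
  exact Ideal.subset_span (by simp)

theorem scaledForm_mem (c : T.Center) : T.scaledForm T.mono c ∈ T.centerIdeal c :=
  Ideal.mul_mem_left _ _ (T.centerForm_mem c)

theorem centerIdeal_le {c : T.Center} {I : Ideal (MvPolynomial T.Coord T.K)}
    (h1 : MvPolynomial.X (c.1 - 1, T.side c) ∈ I) (h2 : T.centerForm T.mono c ∈ I)
    (h3 : MvPolynomial.X (c.1 + 1, T.coside c) ∈ I) : T.centerIdeal c ≤ I := by
  rw [centerIdeal_eq, Ideal.span_le]
  rintro x (rfl | rfl | rfl) <;> assumption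

/-- A point of the center `C_n^i` lying on no other center. -/
def point (c : T.Center) (z : T.Coord) : T.K :=
  if z = (c.1 - 1, T.side c) ∨ z = (c.1 + 1, T.coside c) then 0
  else if z = (c.1, 0) then -T.mono (T.paramExp c) else 1

theorem point_row (c : T.Center) (i : Fin 2) :
    T.point c (c.1, i) = if i = 0 then -T.mono (T.paramExp c) else 1 := by
  have h1 := T.sub_one_ne c.1
  have h2 := T.add_one_ne c.1
  simp [point, Prod.ext_iff, h1.symm, h2.symm]

theorem centerIdeal_le_ker_eval (c : T.Center) :
    T.centerIdeal c ≤ RingHom.ker (MvPolynomial.eval (T.point c)) := by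
  refine T.centerIdeal_le ?_ ?_ ?_
  · simp [RingHom.mem_ker, point]
  · simp [RingHom.mem_ker, centerForm, point_row]
  · simp [RingHom.mem_ker, point]

theorem paramExp_injective : Function.Injective T.paramExp := by
  intro c c' h
  by_contra hne
  have hsign : ((c.2 : ℤ).sign : ℚ) ≠ 0 :=
    Int.cast_ne_zero.2 (mt Int.sign_eq_zero_iff_zero.1 (T.center_mem c).1)
  have hcoeff := congrArg (fun x => T.coeffE x c) h
  simp only [coeffE_paramExp, if_true, if_neg hne, sub_zero] at hcoeff
  by_cases hn : c.1 = c'.1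
  · rw [if_pos hn, ← hn] at hcoeff
    exact hsign (sub_eq_self.1 hcoeff)
  · have hk : (1 : ℚ) ≤ T.k c.1 := by exact_mod_cast T.k_pos c.1
    have hl : (1 : ℚ) ≤ T.ℓ c.1 := by exact_mod_cast T.ℓ_pos c.1
    rw [if_neg hn, sub_eq_zero, div_eq_iff (by positivity), eq_comm, mul_eq_left₀ hsign] at hcoeff
    linarith

theorem coside_eq (c : T.Center) : T.coside c = 1 - T.side c := by
  unfold coside side
  split_ifs <;> rfl

theorem point_of_ne {c : T.Center} {n : ZMod T.N} (h : n ≠ c.1) (i : Fin 2) : T.point c (n, i) =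
    if n = c.1 - 1 ∧ i = T.side c ∨ n = c.1 + 1 ∧ i = T.coside c then 0 else 1 := by
  simp [point, h]

theorem point_ne_zero_or {c : T.Center} {n : ZMod T.N} (h : n ≠ c.1) :
    T.point c (n, 0) ≠ 0 ∨ T.point c (n, 1) ≠ 0 := by
  rw [T.point_of_ne h, T.point_of_ne h, coside_eq]
  generalize T.side c = i
  by_cases hsub : n = c.1 - 1
  · have hadd : n ≠ c.1 + 1 := fun h => T.add_one_ne_sub_one c.1 (h.symm.trans hsub)
    fin_cases i <;> simp [hadd]
  · fin_cases i <;> simp [hsub]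

theorem eval_point_scaledForm {c c' : T.Center} (h : c ≠ c') :
    MvPolynomial.eval (T.point c) (T.scaledForm T.mono c') ≠ 0 := by
  simp only [scaledForm, centerForm, map_mul, map_add, MvPolynomial.eval_C, MvPolynomial.eval_X]
  refine mul_ne_zero (T.mono_ne_zero _) ?_
  by_cases hn : c'.1 = c.1
  · rw [hn, point_row, point_row, if_pos rfl, if_neg one_ne_zero, mul_one, neg_add_eq_sub,
      sub_ne_zero]
    exact T.mono_injective.ne (T.paramExp_injective.ne h.symm)
  · have hmem : ∀ i, T.point c (c'.1, i) = 0 ∨ T.point c (c'.1, i) = 1 := fun i => by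
      rw [T.point_of_ne hn]
      exact ite_eq_or_eq _ _ _
    have hne := T.point_ne_zero_or hn
    have hadd := T.mono_add_mono_ne_zero 0 (T.paramExp c')
    rw [mono_zero] at hadd
    rcases hmem 0 with h0 | h0 <;> rcases hmem 1 with h1 | h1 <;> rw [h0, h1] at hne ⊢
    · simp at hne
    · simpa using T.mono_ne_zero _
    · simp
    · simpa using hadd

/-- The degeneration `f ↦ f(t x₁, t x₂, t x₃, …)` to the normal cone of a center, where the `xᵢ` are
the linear forms cutting out the center. -/
def deformation (c : T.Center) :
    MvPolynomial T.Coord T.K →+* Polynomial (MvPolynomial T.Coord T.K) :=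
  MvPolynomial.eval₂Hom (Polynomial.C.comp MvPolynomial.C) fun z =>
    if z = (c.1 - 1, T.side c) ∨ z = (c.1 + 1, T.coside c) then
      Polynomial.X * Polynomial.C (MvPolynomial.X z)
    else if z = (c.1, 0) then Polynomial.X * Polynomial.C (T.centerForm T.mono c) -
      Polynomial.C (MvPolynomial.C (T.mono (T.paramExp c)) * MvPolynomial.X (c.1, 1))
    else Polynomial.C (MvPolynomial.X z)

theorem deformation_C (c : T.Center) (a : T.K) :
    T.deformation c (MvPolynomial.C a) = Polynomial.C (MvPolynomial.C a) := by
  simp [deformation]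

theorem deformation_X_row (c : T.Center) (i : Fin 2) : T.deformation c (MvPolynomial.X (c.1, i)) =
    if i = 0 then Polynomial.X * Polynomial.C (T.centerForm T.mono c) -
      Polynomial.C (MvPolynomial.C (T.mono (T.paramExp c)) * MvPolynomial.X (c.1, 1))
    else Polynomial.C (MvPolynomial.X (c.1, i)) := by
  have h1 := T.sub_one_ne c.1
  have h2 := T.add_one_ne c.1
  simp [deformation, h1.symm, h2.symm]

theorem deformation_centerForm (c : T.Center) : T.deformation c (T.centerForm T.mono c) =
    Polynomial.X * Polynomial.C (T.centerForm T.mono c) := by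
  conv_lhs => rw [centerForm]
  rw [map_add, map_mul, deformation_X_row, deformation_X_row, deformation_C, if_pos rfl,
    if_neg (by simp), Polynomial.C_mul]
  ring

theorem deformation_mem_reesAlgebra (c : T.Center) (f : MvPolynomial T.Coord T.K) :
    T.deformation c f ∈ reesAlgebra (T.centerIdeal c) := by
  have hC : ∀ a, Polynomial.C a ∈ reesAlgebra (T.centerIdeal c) :=
    fun a => (reesAlgebra (T.centerIdeal c)).algebraMap_mem a
  induction f using MvPolynomial.induction_on with
  | C a => rw [deformation_C]; exact hC _
  | add p q hp hq => rw [map_add]; exact add_mem hp hq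
  | mul_X p z hp =>
    rw [map_mul]
    refine mul_mem hp ?_
    rw [deformation, MvPolynomial.coe_eval₂Hom, MvPolynomial.eval₂_X]
    split_ifs with h1 h2
    · rcases h1 with rfl | rfl
      · exact X_mul_C_mem_reesAlgebra (T.X_sub_mem c)
      · exact X_mul_C_mem_reesAlgebra (T.X_add_mem c)
    · exact sub_mem (X_mul_C_mem_reesAlgebra (T.centerForm_mem c)) (hC _)
    · exact hC _

theorem eval_one_deformation (c : T.Center) (f : MvPolynomial T.Coord T.K) :
    (T.deformation c f).eval 1 = f := by
  induction f using MvPolynomial.induction_on with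
  | C a => simp [deformation_C]
  | add p q hp hq => rw [map_add, Polynomial.eval_add, hp, hq]
  | mul_X p z hp =>
    rw [map_mul, Polynomial.eval_mul, hp]
    congr 1
    rw [deformation, MvPolynomial.coe_eval₂Hom, MvPolynomial.eval₂_X]
    split_ifs with h1 h2
    · simp
    · simp [h2, centerForm]
    · simp

theorem X_dvd_deformation (c : T.Center) (f : MvPolynomial T.Coord T.K) (hf : f ∈ T.centerIdeal c) :
    Polynomial.X ∣ T.deformation c f := by
  have : T.centerIdeal c ≤ (Ideal.span {Polynomial.X}).comap (T.deformation c) := by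
    refine T.centerIdeal_le ?_ ?_ ?_ <;> rw [Ideal.mem_comap, Ideal.mem_span_singleton]
    · simp [deformation]
    · rw [deformation_centerForm]; exact dvd_mul_right _ _
    · simp [deformation]
  have h := this hf
  rwa [Ideal.mem_comap, Ideal.mem_span_singleton] at h

theorem mem_centerIdeal_pow (c : T.Center) (f : MvPolynomial T.Coord T.K) (n : ℕ) :
    f ∈ T.centerIdeal c ^ n ↔ Polynomial.X ^ n ∣ T.deformation c f :=
  mem_ideal_pow_iff_X_pow_dvd (T.deformation_mem_reesAlgebra c) (T.eval_one_deformation c)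
    (T.X_dvd_deformation c) f n

theorem not_X_dvd_deformation {c : T.Center} {G : MvPolynomial T.Coord T.K}
    (hG : MvPolynomial.eval (T.point c) G ≠ 0) : ¬ Polynomial.X ∣ T.deformation c G := by
  intro h
  have : G ∈ T.centerIdeal c ^ 1 := by rwa [mem_centerIdeal_pow, pow_one]
  rw [pow_one] at this
  exact hG (T.centerIdeal_le_ker_eval c this)

theorem mem_pow_of_mul {c : T.Center} {G Q : MvPolynomial T.Coord T.K} {n : ℕ}
    (hG : MvPolynomial.eval (T.point c) G ≠ 0) (h : G * Q ∈ T.centerIdeal c ^ n) :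
    Q ∈ T.centerIdeal c ^ n := by
  rw [mem_centerIdeal_pow, map_mul] at h
  rw [mem_centerIdeal_pow]
  exact Polynomial.prime_X.pow_dvd_of_dvd_mul_left n (T.not_X_dvd_deformation hG) h

theorem centerForm_ne_zero (c : T.Center) : T.centerForm T.mono c ≠ 0 :=
  (prime_X_add_C_mul_X (i := ((c.1, 0) : T.Coord)) (j := (c.1, 1)) (by simp) _).ne_zero

theorem scaledForm_ne_zero (c : T.Center) : T.scaledForm T.mono c ≠ 0 :=
  mul_ne_zero (by simpa using T.mono_ne_zero _) (T.centerForm_ne_zero c)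

theorem deformation_scaledForm (c : T.Center) : T.deformation c (T.scaledForm T.mono c) =
    Polynomial.X * Polynomial.C (T.scaledForm T.mono c) := by
  rw [scaledForm, map_mul, deformation_C, deformation_centerForm, Polynomial.C_mul]
  ring

theorem mem_pow_of_scaledForm_pow_mul {c : T.Center} {Q : MvPolynomial T.Coord T.K} {n a : ℕ}
    (h : T.scaledForm T.mono c ^ a * Q ∈ T.centerIdeal c ^ n) : Q ∈ T.centerIdeal c ^ (n - a) := by
  rcases le_total n a with hna | hna
  · simp [Nat.sub_eq_zero_of_le hna]
  · obtain ⟨k, rfl⟩ := Nat.exists_eq_add_of_le hna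
    rw [mem_centerIdeal_pow, map_mul, map_pow, deformation_scaledForm, mul_pow, mul_assoc, pow_add,
      mul_dvd_mul_iff_left (pow_ne_zero _ Polynomial.X_ne_zero)] at h
    rw [Nat.add_sub_cancel_left, mem_centerIdeal_pow]
    refine Polynomial.prime_X.pow_dvd_of_dvd_mul_left k ?_ h
    rw [← Polynomial.C_pow, Polynomial.X_dvd_iff, Polynomial.coeff_C_zero]
    exact pow_ne_zero _ (T.scaledForm_ne_zero c)

theorem prime_scaledForm (c : T.Center) : Prime (T.scaledForm T.mono c) := by
  have h : Associated (T.centerForm T.mono c) (T.scaledForm T.mono c) := by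
    exact associated_unit_mul_right _ _ ((T.mono_ne_zero _).isUnit.map MvPolynomial.C)
  exact h.prime (prime_X_add_C_mul_X (by simp) _)

theorem not_scaledForm_dvd {c c' : T.Center} (h : c ≠ c') :
    ¬ T.scaledForm T.mono c ∣ T.scaledForm T.mono c' := by
  rintro ⟨q, hq⟩
  have := T.eval_point_scaledForm h
  rw [hq, map_mul, T.centerIdeal_le_ker_eval c (T.scaledForm_mem c), zero_mul] at this
  exact this rfl

theorem C_mono_mul_scaledForm (c : T.Center) :
    MvPolynomial.C (T.mono (T.ω c.1 • T.paramExp c)) * T.scaledForm T.mono c =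
      T.centerForm T.mono c := by
  rw [scaledForm, ← mul_assoc, ← MvPolynomial.C_mul, ← mono_add, neg_smul, add_neg_cancel,
    mono_zero, MvPolynomial.C_1, one_mul]

variable {T} in
theorem IsMultihomogeneous.of_scaledForm_pow_mul (c : T.Center) {d : ZMod T.N → ℤ}
    {g : MvPolynomial T.Coord T.K} {a : ℕ}
    (h : T.IsMultihomogeneous (d + a • Pi.single c.1 1) (T.scaledForm T.mono c ^ a * g)) :
    T.IsMultihomogeneous d g := by
  induction a generalizing d with
  | zero => simpa using h
  | succ a ih =>
    rw [succ_nsmul, ← add_assoc, pow_succ', mul_assoc] at h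
    have hform := h.C_mul (T.mono (T.ω c.1 • T.paramExp c))
    rw [← mul_assoc, C_mono_mul_scaledForm] at hform
    exact ih (isWeightedHomogeneous_of_X_add_C_mul_X_mul (i := ((c.1, 0) : T.Coord)) (j := (c.1, 1))
      (by simp) rfl _ hform)

/-! ### The substitution attached to a simple reflection -/

/-- The semilinear substitution of polynomials over `𝕂` attached to a simple reflection. -/
abbrev coordSubstK (r : T.Root) : MvPolynomial T.Coord T.K →+* MvPolynomial T.Coord T.K :=
  T.coordSubst T.mono (T.sK r : T.K →+* T.K) r

theorem coordSubstK_X (r : T.Root) (z : T.Coord) :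
    T.coordSubstK r (MvPolynomial.X z) = T.multiplier T.mono r z * MvPolynomial.X z := by
  simp [coordSubst]

theorem coordSubstK_C (r : T.Root) (a : T.K) :
    T.coordSubstK r (MvPolynomial.C a) = MvPolynomial.C (T.sK r a) := by
  simp [coordSubst]

theorem X_dvd_coordSubstK_X (r : T.Root) (z : T.Coord) :
    (MvPolynomial.X z : MvPolynomial T.Coord T.K) ∣ T.coordSubstK r (MvPolynomial.X z) := by
  rw [coordSubstK_X]
  exact dvd_mul_left _ _

theorem multiplier_row {A : Type*} [CommRing A] {e : (T.Root → ℚ) → A} {r : T.Root} {c : T.Center}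
    (h : (r.2 : ℤ) ≠ 0 ∨ c.1 = r.1) (i : Fin 2) : T.multiplier e r (c.1, i) = 1 := by
  rcases h with h | h
  · exact multiplier_of_ne_zero h _
  · exact multiplier_of_ne r (h ▸ (T.sub_one_ne _).symm) (h ▸ (T.add_one_ne _).symm)

theorem coordSubstK_centerForm {r : T.Root} {c : T.Center} (h : (r.2 : ℤ) ≠ 0 ∨ c.1 = r.1) :
    T.coordSubstK r (T.centerForm T.mono c) = T.centerForm T.mono (T.centerSwap r c) := by
  rw [centerForm, centerForm, map_add, map_mul, coordSubstK_X, coordSubstK_X, coordSubstK_C,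
    T.multiplier_row h, T.multiplier_row h, one_mul, one_mul, sK_mono, T.expAct_paramExp h,
    centerSwap_fst]

theorem coordSubstK_scaledForm {r : T.Root} {c : T.Center} (h : (r.2 : ℤ) ≠ 0 ∨ c.1 = r.1) :
    T.coordSubstK r (T.scaledForm T.mono c) = T.scaledForm T.mono (T.centerSwap r c) := by
  rw [scaledForm, scaledForm, map_mul, coordSubstK_C, T.coordSubstK_centerForm h, sK_mono,
    map_rat_smul, T.expAct_paramExp h, centerSwap_fst]

theorem sign_centerSwap {r : T.Root} (h : (r.2 : ℤ) ≠ 0) (c : T.Center) :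
    ((T.centerSwap r c).2 : ℤ).sign = (c.2 : ℤ).sign := by
  by_cases hnear : c = T.near r
  · rw [hnear, centerSwap_near, T.sign_far h, T.sign_near h]
  by_cases hfar : c = T.far r
  · rw [hfar, centerSwap_far, T.sign_near h, T.sign_far h]
  · rw [T.centerSwap_of_ne hnear hfar]

theorem side_centerSwap {r : T.Root} (h : (r.2 : ℤ) ≠ 0) (c : T.Center) :
    T.side (T.centerSwap r c) = T.side c := by
  simp only [side, ← Int.sign_eq_one_iff_pos, T.sign_centerSwap h]

theorem centerIdeal_le_comap_of_ne_zero {r : T.Root} (h : (r.2 : ℤ) ≠ 0) (c : T.Center) :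
    T.centerIdeal c ≤ (T.centerIdeal (T.centerSwap r c)).comap (T.coordSubstK r) := by
  have hsub := T.X_sub_mem (T.centerSwap r c)
  have hadd := T.X_add_mem (T.centerSwap r c)
  rw [centerSwap_fst, T.side_centerSwap h] at hsub
  rw [centerSwap_fst, coside_eq, T.side_centerSwap h, ← coside_eq] at hadd
  refine T.centerIdeal_le ?_ ?_ ?_ <;> rw [Ideal.mem_comap]
  · exact Ideal.mem_of_dvd _ (T.X_dvd_coordSubstK_X r _) hsub
  · rw [T.coordSubstK_centerForm (Or.inl h)]
    exact T.centerForm_mem _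
  · exact Ideal.mem_of_dvd _ (T.X_dvd_coordSubstK_X r _) hadd

theorem single_eq_smul (r : T.Root) (q : ℚ) : (Pi.single r q : T.Root → ℚ) = q • Pi.single r 1 := by
  rw [← Pi.single_smul, smul_eq_mul, mul_one]

theorem scaledForm_dvd_iff (c : T.Center) (f : MvPolynomial T.Coord T.K) :
    T.scaledForm T.mono c ∣ f ↔ T.centerForm T.mono c ∣ f :=
  ((T.mono_ne_zero _).isUnit.map MvPolynomial.C).mul_left_dvd

theorem isMultihomogeneous_coordSubst_of_ne_zero {A : Type*} [CommRing A] {e : (T.Root → ℚ) → A}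
    {s : A →+* A} {r : T.Root} (h : (r.2 : ℤ) ≠ 0) {d : ZMod T.N → ℤ} {f : MvPolynomial T.Coord A}
    (hf : T.IsMultihomogeneous d f) : T.IsMultihomogeneous d (T.coordSubst e s r f) := by
  refine isWeightedHomogeneous_eval₂ hf s (AddMonoidHom.id _) fun z => ?_
  rw [multiplier_of_ne_zero h, one_mul]
  exact MvPolynomial.isWeightedHomogeneous_X _ _ _

theorem coordSubstK_mem_pow_of_le {r : T.Root} {I J : Ideal (MvPolynomial T.Coord T.K)}
    (h : I ≤ J.comap (T.coordSubstK r)) {f : MvPolynomial T.Coord T.K} {n : ℕ} (hf : f ∈ I ^ n) :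
    T.coordSubstK r f ∈ J ^ n :=
  Ideal.le_comap_pow (T.coordSubstK r) n (Ideal.pow_right_mono h n hf)

theorem reflDenom_ne_zero (r : T.Root) (Λ : T.NS) : T.reflDenom T.mono r Λ ≠ 0 := by
  rw [reflDenom]
  split_ifs
  · exact mul_ne_zero (pow_ne_zero _ (T.scaledForm_ne_zero _))
      (pow_ne_zero _ (T.scaledForm_ne_zero _))
  · exact one_ne_zero

theorem reflNumer_ne_zero (r : T.Root) (Λ : T.NS) : T.reflNumer T.mono r Λ ≠ 0 := by
  rw [reflNumer]
  split_ifs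
  · exact mul_ne_zero (pow_ne_zero _ (T.scaledForm_ne_zero _))
      (pow_ne_zero _ (T.scaledForm_ne_zero _))
  · exact one_ne_zero

theorem mem_pow_sub_toNat {c c' : T.Center} (hne : c ≠ c') {F g : MvPolynomial T.Coord T.K}
    {a b : ℤ} {m : ℕ} (hF : F ∈ T.centerIdeal c ^ m)
    (h : T.scaledForm T.mono c ^ b.toNat * (T.scaledForm T.mono c' ^ a.toNat * g) =
      T.scaledForm T.mono c ^ (-b).toNat * (T.scaledForm T.mono c' ^ (-a).toNat * F)) :
    g ∈ T.centerIdeal c ^ (m - b).toNat := by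
  have hmem : T.scaledForm T.mono c ^ (-b).toNat * (T.scaledForm T.mono c' ^ (-a).toNat * F) ∈
      T.centerIdeal c ^ ((-b).toNat + m) := by
    rw [pow_add]
    exact Ideal.mul_mem_mul (Ideal.pow_mem_pow (T.scaledForm_mem c) _) (Ideal.mul_mem_left _ _ hF)
  have heval : MvPolynomial.eval (T.point c) (T.scaledForm T.mono c' ^ a.toNat) ≠ 0 := by
    rw [map_pow]
    exact pow_ne_zero _ (T.eval_point_scaledForm hne)
  rw [← h] at hmem
  refine Ideal.pow_le_pow_right ?_ (T.mem_pow_of_mul heval (T.mem_pow_of_scaledForm_pow_mul hmem))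
  omega

theorem mem_linearSystem (Λ : T.NS) (f : MvPolynomial T.Coord T.K) : f ∈ T.linearSystem Λ ↔
    T.IsMultihomogeneous (T.deg Λ) f ∧ ∀ c, f ∈ T.centerIdeal c ^ (T.mult Λ c).toNat := by
  rw [linearSystem, Submodule.mem_inf, mem_iInf_weightedHomogeneousSubmodule]
  simp only [Submodule.mem_iInf, Submodule.restrictScalars_mem]

section ZeroRoot

variable {T}
variable (hT : ∀ n : ZMod T.N, T.k (n - 1) * T.k (n + 1) = T.ℓ (n - 1) * T.ℓ (n + 1))
  {r : T.Root} (h0 : (r.2 : ℤ) = 0)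
include h0

theorem side_near : T.side (T.near r) = 0 := by
  simp [side, near_snd, h0]

theorem side_far : T.side (T.far r) = 1 := by
  simp [side, far_snd, h0]

theorem coside_near : T.coside (T.near r) = 1 := by
  simp [coside, near_snd, h0]

theorem coside_far : T.coside (T.far r) = 0 := by
  simp [coside, far_snd, h0]

include hT in
theorem coordSubstK_centerForm_mem_of_sub_one {c : T.Center} (hc : c.1 = r.1 - 1) :
    T.coordSubstK r (T.centerForm T.mono c) ∈ T.centerIdeal c := by
  have hX : MvPolynomial.X (r.1, T.coside c) ∈ T.centerIdeal c := by
    simpa only [hc, sub_add_cancel] using T.X_add_mem c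
  have hsubst : T.coordSubstK r (T.centerForm T.mono c) = T.scaledForm T.mono (T.far r) *
      MvPolynomial.X (c.1, 0) + MvPolynomial.C (T.mono (T.expAct r (T.paramExp c))) *
        (T.scaledForm T.mono (T.near r) * MvPolynomial.X (c.1, 1)) := by
    rw [centerForm, map_add, map_mul, coordSubstK_X, coordSubstK_X, coordSubstK_C, hc,
      multiplier_sub_one h0, multiplier_sub_one h0, sK_mono, if_pos rfl, if_neg one_ne_zero]
  rw [hsubst, T.expAct_paramExp_sub_one hT h0 hc]
  refine mul_add_mul_mem_of_add_mul_mem (T.centerForm_mem c) ?_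
  simp only [near_fst, far_fst, ← MvPolynomial.C_mul, ← mono_add, paramExp_near, if_pos h0,
    T.single_eq_smul r (_ - _)]
  rw [coside] at hX
  split_ifs at hX ⊢
  · exact .inl ⟨hX, by congr 2; module⟩
  · exact .inr ⟨hX, by congr 2; module⟩

include hT in
theorem coordSubstK_centerForm_mem_of_add_one {c : T.Center} (hc : c.1 = r.1 + 1) :
    T.coordSubstK r (T.centerForm T.mono c) ∈ T.centerIdeal c := by
  have hX : MvPolynomial.X (r.1, T.side c) ∈ T.centerIdeal c := by
    simpa only [hc, add_sub_cancel_right] using T.X_sub_mem c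
  have hsubst : T.coordSubstK r (T.centerForm T.mono c) = T.scaledForm T.mono (T.near r) *
      MvPolynomial.X (c.1, 0) + MvPolynomial.C (T.mono (T.expAct r (T.paramExp c))) *
        (T.scaledForm T.mono (T.far r) * MvPolynomial.X (c.1, 1)) := by
    rw [centerForm, map_add, map_mul, coordSubstK_X, coordSubstK_X, coordSubstK_C, hc,
      multiplier_add_one h0, multiplier_add_one h0, sK_mono, if_pos rfl, if_neg one_ne_zero]
  rw [hsubst, T.expAct_paramExp_add_one hT h0 hc]
  refine mul_add_mul_mem_of_add_mul_mem (T.centerForm_mem c) ?_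
  simp only [near_fst, far_fst, ← MvPolynomial.C_mul, ← mono_add, paramExp_near, if_pos h0,
    T.single_eq_smul r (_ - _)]
  rw [side] at hX
  split_ifs at hX ⊢
  · exact .inr ⟨hX, by congr 2; module⟩
  · exact .inl ⟨hX, by congr 2; module⟩

include hT in
theorem coordSubstK_centerForm_mem {c : T.Center} (hc : c.1 ≠ r.1) :
    T.coordSubstK r (T.centerForm T.mono c) ∈ T.centerIdeal c := by
  by_cases hsub : c.1 = r.1 - 1
  · exact coordSubstK_centerForm_mem_of_sub_one hT h0 hsub
  by_cases hadd : c.1 = r.1 + 1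
  · exact coordSubstK_centerForm_mem_of_add_one hT h0 hadd
  · rw [centerForm, map_add, map_mul, coordSubstK_X, coordSubstK_X, coordSubstK_C,
      multiplier_of_ne r hsub hadd, multiplier_of_ne r hsub hadd, one_mul, one_mul, sK_mono,
      T.expAct_paramExp_of_ne h0 hc hsub hadd]
    exact T.centerForm_mem c

include hT in
theorem centerIdeal_le_comap {c : T.Center} (hnear : c ≠ T.near r) (hfar : c ≠ T.far r) :
    T.centerIdeal c ≤ (T.centerIdeal c).comap (T.coordSubstK r) := by
  refine T.centerIdeal_le ?_ ?_ ?_ <;> rw [Ideal.mem_comap]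
  · exact Ideal.mem_of_dvd _ (T.X_dvd_coordSubstK_X r _) (T.X_sub_mem c)
  · by_cases hc : c.1 = r.1
    · rw [T.coordSubstK_centerForm (Or.inr hc), T.centerSwap_of_ne hnear hfar]
      exact T.centerForm_mem c
    · exact coordSubstK_centerForm_mem hT h0 hc
  · exact Ideal.mem_of_dvd _ (T.X_dvd_coordSubstK_X r _) (T.X_add_mem c)

theorem centerIdeal_near_le : T.centerIdeal (T.near r) ≤
    (Ideal.span {T.scaledForm T.mono (T.far r)}).comap (T.coordSubstK r) := by
  refine T.centerIdeal_le ?_ ?_ ?_ <;> rw [Ideal.mem_comap, Ideal.mem_span_singleton]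
  · rw [side_near h0, coordSubstK_X, near_fst, multiplier_sub_one h0, if_pos rfl]
    exact dvd_mul_right _ _
  · rw [T.coordSubstK_centerForm (Or.inr rfl), centerSwap_near, scaledForm_dvd_iff]
  · rw [coside_near h0, coordSubstK_X, near_fst, multiplier_add_one h0, if_neg one_ne_zero]
    exact dvd_mul_right _ _

theorem centerIdeal_far_le : T.centerIdeal (T.far r) ≤
    (Ideal.span {T.scaledForm T.mono (T.near r)}).comap (T.coordSubstK r) := by
  refine T.centerIdeal_le ?_ ?_ ?_ <;> rw [Ideal.mem_comap, Ideal.mem_span_singleton]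
  · rw [side_far h0, coordSubstK_X, far_fst, multiplier_sub_one h0, if_neg one_ne_zero]
    exact dvd_mul_right _ _
  · rw [T.coordSubstK_centerForm (Or.inr rfl), centerSwap_far, scaledForm_dvd_iff]
  · rw [coside_far h0, coordSubstK_X, far_fst, multiplier_add_one h0, if_pos rfl]
    exact dvd_mul_right _ _

theorem coordSubstK_X_mem {c : T.Center} (hc : c = T.near r ∨ c = T.far r) {z : T.Coord}
    (hz : z.1 = r.1 - 1 ∨ z.1 = r.1 + 1) :
    T.coordSubstK r (MvPolynomial.X z) ∈ T.centerIdeal c := by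
  have hsub := T.X_sub_mem c
  have hadd := T.X_add_mem c
  have hform := T.scaledForm_mem c
  obtain ⟨n, i⟩ := z
  rw [coordSubstK_X]
  rcases hc with rfl | rfl
  · rw [side_near h0, near_fst] at hsub
    rw [coside_near h0, near_fst] at hadd
    rcases hz with rfl | rfl <;> simp only [multiplier_sub_one h0, multiplier_add_one h0] <;>
      fin_cases i
    · exact Ideal.mul_mem_left _ _ hsub
    · exact Ideal.mul_mem_right _ _ hform
    · exact Ideal.mul_mem_right _ _ hform
    · exact Ideal.mul_mem_left _ _ hadd
  · rw [side_far h0, far_fst] at hsub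
    rw [coside_far h0, far_fst] at hadd
    rcases hz with rfl | rfl <;> simp only [multiplier_sub_one h0, multiplier_add_one h0] <;>
      fin_cases i
    · exact Ideal.mul_mem_right _ _ hform
    · exact Ideal.mul_mem_left _ _ hsub
    · exact Ideal.mul_mem_left _ _ hadd
    · exact Ideal.mul_mem_right _ _ hform

theorem coordSubstK_mem_pow {c : T.Center} (hc : c = T.near r ∨ c = T.far r) {d : ZMod T.N → ℤ}
    {f : MvPolynomial T.Coord T.K} (hf : T.IsMultihomogeneous d f) :
    T.coordSubstK r f ∈ T.centerIdeal c ^ ((d (r.1 - 1)).toNat + (d (r.1 + 1)).toNat) := by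
  rw [mem_centerIdeal_pow]
  let w : ZMod T.N → Polynomial (MvPolynomial T.Coord T.K) := fun n =>
    if n = r.1 - 1 ∨ n = r.1 + 1 then Polynomial.X else 1
  have hw : ∀ z : T.Coord, w z.1 ∣ T.deformation c (T.coordSubstK r (MvPolynomial.X z)) := by
    intro z
    by_cases hz : z.1 = r.1 - 1 ∨ z.1 = r.1 + 1
    · simpa only [w, if_pos hz] using T.X_dvd_deformation c _ (coordSubstK_X_mem h0 hc hz)
    · simp only [w, if_neg hz, one_dvd]
  choose x hx using hw
  have heval : T.deformation c (T.coordSubstK r f) = MvPolynomial.eval₂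
      ((T.deformation c).comp (MvPolynomial.C.comp (T.sK r : T.K →+* T.K)))
      (fun z => w z.1 * x z) f := by
    simp only [← hx, coordSubstK_X]
    exact MvPolynomial.hom_eval₂ _ _ _ _
  have hprod : ∏ n ∈ {r.1 - 1, r.1 + 1}, w n ^ (d n).toNat =
      Polynomial.X ^ ((d (r.1 - 1)).toNat + (d (r.1 + 1)).toNat) := by
    rw [Finset.prod_pair (T.add_one_ne_sub_one _).symm, pow_add]
    simp [w]
  rw [heval.trans (hf.eval₂_mul _ w x), ← hprod]
  exact (Finset.prod_dvd_prod_of_subset _ _ _ (Finset.subset_univ _)).mul_right _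

theorem isMultihomogeneous_multiplier {A : Type*} [CommRing A] {e : (T.Root → ℚ) → A}
    (z : T.Coord) :
    T.IsMultihomogeneous (if z.1 = r.1 - 1 ∨ z.1 = r.1 + 1 then Pi.single r.1 1 else 0)
      (T.multiplier e r z) := by
  have hnear : T.IsMultihomogeneous (Pi.single r.1 1) (T.scaledForm e (T.near r)) :=
    isMultihomogeneous_scaledForm _
  have hfar : T.IsMultihomogeneous (Pi.single r.1 1) (T.scaledForm e (T.far r)) :=
    isMultihomogeneous_scaledForm _
  by_cases hsub : z.1 = r.1 - 1
  · rw [if_pos (Or.inl hsub), multiplier, if_pos h0, if_pos hsub]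
    split_ifs <;> assumption
  by_cases hadd : z.1 = r.1 + 1
  · rw [if_pos (Or.inr hadd), multiplier, if_pos h0, if_neg hsub, if_pos hadd]
    split_ifs <;> assumption
  · rw [if_neg (not_or.2 ⟨hsub, hadd⟩), multiplier_of_ne r hsub hadd]
    exact MvPolynomial.isWeightedHomogeneous_one _ _

theorem isMultihomogeneous_coordSubst {A : Type*} [CommRing A] {e : (T.Root → ℚ) → A}
    {s : A →+* A} {d : ZMod T.N → ℤ} {f : MvPolynomial T.Coord A}
    (hf : T.IsMultihomogeneous d f) : T.IsMultihomogeneous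
      (d + Pi.single r.1 (d (r.1 - 1) + d (r.1 + 1))) (T.coordSubst e s r f) := by
  let L : (ZMod T.N → ℤ) →+ (ZMod T.N → ℤ) := AddMonoidHom.id _ +
    (AddMonoidHom.single (fun _ => ℤ) r.1).comp
      (Pi.evalAddMonoidHom (fun _ => ℤ) (r.1 - 1) + Pi.evalAddMonoidHom (fun _ => ℤ) (r.1 + 1))
  refine isWeightedHomogeneous_eval₂ hf s L fun z => ?_
  convert (isMultihomogeneous_multiplier h0 z).mul (MvPolynomial.isWeightedHomogeneous_X A _ z)
    using 1
  have hne := T.add_one_ne_sub_one r.1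
  by_cases hsub : z.1 = r.1 - 1
  · simp [L, hsub, hne, add_comm]
  · by_cases hadd : z.1 = r.1 + 1
    · simp [L, hadd, hne.symm, add_comm]
    · simp [L, hsub, hadd, Ne.symm hsub, Ne.symm hadd]

theorem reflDenom_dvd_coordSubstK {Λ : T.NS} {f : MvPolynomial T.Coord T.K}
    (hnear : f ∈ T.centerIdeal (T.near r) ^ (T.mult Λ (T.near r)).toNat)
    (hfar : f ∈ T.centerIdeal (T.far r) ^ (T.mult Λ (T.far r)).toNat) :
    T.reflDenom T.mono r Λ ∣ T.coordSubstK r f := by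
  have hdvd_far := T.coordSubstK_mem_pow_of_le (centerIdeal_near_le h0) hnear
  have hdvd_near := T.coordSubstK_mem_pow_of_le (centerIdeal_far_le h0) hfar
  rw [Ideal.span_singleton_pow, Ideal.mem_span_singleton] at hdvd_far hdvd_near
  obtain ⟨q, hq⟩ := hdvd_far
  have hprime := T.prime_scaledForm (T.near r)
  have hcoprime : ¬ T.scaledForm T.mono (T.near r) ∣
      T.scaledForm T.mono (T.far r) ^ (T.mult Λ (T.near r)).toNat :=
    fun h => T.not_scaledForm_dvd (T.near_ne_far r) (hprime.dvd_of_dvd_pow h)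
  rw [hq] at hdvd_near ⊢
  rw [reflDenom, if_pos h0, mul_comm (_ ^ _)]
  exact mul_dvd_mul_left _ (hprime.pow_dvd_of_dvd_mul_left _ hcoprime hdvd_near)

theorem isMultihomogeneous_of_reflDenom_mul {Λ : T.NS} {f g : MvPolynomial T.Coord T.K}
    (hf : T.IsMultihomogeneous (T.deg Λ) f)
    (h : T.reflDenom T.mono r Λ * g = T.reflNumer T.mono r Λ * T.coordSubstK r f) :
    T.IsMultihomogeneous (T.deg (T.s r Λ)) g := by
  refine IsMultihomogeneous.of_scaledForm_pow_mul (T.far r) (a := (T.mult Λ (T.near r)).toNat) ?_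
  refine IsMultihomogeneous.of_scaledForm_pow_mul (T.near r) (a := (T.mult Λ (T.far r)).toNat) ?_
  rw [reflDenom, reflNumer, if_pos h0, if_pos h0, mul_assoc] at h
  rw [h]
  convert (((isMultihomogeneous_scaledForm (T.near r)).pow _).mul
    ((isMultihomogeneous_scaledForm (T.far r)).pow _)).mul (isMultihomogeneous_coordSubst h0 hf)
    using 1
  have hnear := Int.toNat_sub_toNat_neg (T.mult Λ (T.near r))
  have hfar := Int.toNat_sub_toNat_neg (T.mult Λ (T.far r))
  rw [T.deg_s_of_eq_zero h0, near_fst, far_fst]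
  simp only [← Pi.single_smul, nsmul_eq_mul, mul_one]
  funext n
  simp only [Pi.add_apply, Pi.single_apply]
  split_ifs <;> linarith

include hT in
theorem mem_centerIdeal_pow_of_reflDenom_mul {Λ : T.NS} {f g : MvPolynomial T.Coord T.K}
    (hf : f ∈ T.linearSystem Λ) (hf0 : f ≠ 0)
    (h : T.reflDenom T.mono r Λ * g = T.reflNumer T.mono r Λ * T.coordSubstK r f) (c : T.Center) :
    g ∈ T.centerIdeal c ^ (T.mult (T.s r Λ) c).toNat := by
  obtain ⟨hd, hm⟩ := (T.mem_linearSystem Λ f).1 hf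
  have hneg_sub := hd.nonneg hf0 (r.1 - 1)
  have hneg_add := hd.nonneg hf0 (r.1 + 1)
  by_cases hnear : c = T.near r
  · rw [reflDenom, reflNumer, if_pos h0, if_pos h0, mul_assoc, mul_assoc] at h
    have := T.mem_pow_sub_toNat (T.near_ne_far r) (coordSubstK_mem_pow h0 (Or.inl rfl) hd) h
    rw [hnear, T.mult_s_near h0]
    simpa only [Nat.cast_add, Int.toNat_of_nonneg hneg_sub, Int.toNat_of_nonneg hneg_add] using this
  by_cases hfar : c = T.far r
  · rw [reflDenom, reflNumer, if_pos h0, if_pos h0, mul_assoc, mul_assoc, mul_left_comm,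
      mul_left_comm (_ ^ (-T.mult Λ (T.far r)).toNat)] at h
    have := T.mem_pow_sub_toNat (T.near_ne_far r).symm (coordSubstK_mem_pow h0 (Or.inr rfl) hd) h
    rw [hfar, T.mult_s_far h0]
    simpa only [Nat.cast_add, Int.toNat_of_nonneg hneg_sub, Int.toNat_of_nonneg hneg_add] using this
  · rw [T.mult_s_of_ne h0 Λ hnear hfar]
    refine T.mem_pow_of_mul (G := T.reflDenom T.mono r Λ) ?_ ?_
    · rw [reflDenom, if_pos h0, map_mul, map_pow, map_pow]
      exact mul_ne_zero (pow_ne_zero _ (T.eval_point_scaledForm hnear))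
        (pow_ne_zero _ (T.eval_point_scaledForm hfar))
    · rw [h]
      exact Ideal.mul_mem_left _ _
        (T.coordSubstK_mem_pow_of_le (centerIdeal_le_comap hT h0 hnear hfar) (hm c))

end ZeroRoot

theorem coordSubstK_mem_linearSystem {r : T.Root} (h : (r.2 : ℤ) ≠ 0) {Λ : T.NS}
    {f : MvPolynomial T.Coord T.K} (hf : f ∈ T.linearSystem Λ) :
    T.coordSubstK r f ∈ T.linearSystem (T.s r Λ) := by
  obtain ⟨hd, hm⟩ := (T.mem_linearSystem Λ f).1 hf
  refine (T.mem_linearSystem _ _).2 ⟨?_, fun c => ?_⟩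
  · rw [T.deg_s_of_ne_zero h]
    exact T.isMultihomogeneous_coordSubst_of_ne_zero h hd
  · rw [T.mult_s_of_ne_zero h]
    simpa only [centerSwap_centerSwap] using T.coordSubstK_mem_pow_of_le
      (T.centerIdeal_le_comap_of_ne_zero h (T.centerSwap r c)) (hm (T.centerSwap r c))

theorem exists_mem_linearSystem_s
    (hT : ∀ n : ZMod T.N, T.k (n - 1) * T.k (n + 1) = T.ℓ (n - 1) * T.ℓ (n + 1))
    (r : T.Root) (Λ : T.NS) {f : MvPolynomial T.Coord T.K} (hf : f ∈ T.linearSystem Λ) :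
    ∃ g ∈ T.linearSystem (T.s r Λ),
      T.reflDenom T.mono r Λ * g = T.reflNumer T.mono r Λ * T.coordSubstK r f := by
  by_cases hf0 : f = 0
  · exact ⟨0, zero_mem _, by rw [hf0, map_zero, mul_zero, mul_zero]⟩
  by_cases h0 : (r.2 : ℤ) = 0
  · obtain ⟨hd, hm⟩ := (T.mem_linearSystem Λ f).1 hf
    obtain ⟨q, hq⟩ := reflDenom_dvd_coordSubstK h0 (hm (T.near r)) (hm (T.far r))
    have heq : T.reflDenom T.mono r Λ * (T.reflNumer T.mono r Λ * q) =
        T.reflNumer T.mono r Λ * T.coordSubstK r f := by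
      rw [hq, mul_left_comm]
    exact ⟨T.reflNumer T.mono r Λ * q, (T.mem_linearSystem _ _).2
      ⟨isMultihomogeneous_of_reflDenom_mul h0 hd heq,
        mem_centerIdeal_pow_of_reflDenom_mul hT h0 hf hf0 heq⟩, heq⟩
  · exact ⟨T.coordSubstK r f, T.coordSubstK_mem_linearSystem h0 hf, by
      rw [reflDenom, reflNumer, if_neg h0, if_neg h0]⟩

/-! ### Uniqueness of sections -/

/-- The factor acquired by the coordinates of the `n`-th line when `coordSubstK` is applied twice:
`coordSubstK` is an involution up to these factors. -/
def squareFactor (r : T.Root) (n : ZMod T.N) : MvPolynomial T.Coord T.K :=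
  if (r.2 : ℤ) = 0 ∧ (n = r.1 - 1 ∨ n = r.1 + 1) then
    T.scaledForm T.mono (T.near r) * T.scaledForm T.mono (T.far r)
  else 1

theorem squareFactor_ne_zero (r : T.Root) (n : ZMod T.N) : T.squareFactor r n ≠ 0 := by
  rw [squareFactor]
  split_ifs
  · exact mul_ne_zero (T.scaledForm_ne_zero _) (T.scaledForm_ne_zero _)
  · exact one_ne_zero

theorem coordSubstK_coordSubstK_X (r : T.Root) (z : T.Coord) :
    T.coordSubstK r (T.coordSubstK r (MvPolynomial.X z)) =
      T.squareFactor r z.1 * MvPolynomial.X z := by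
  obtain ⟨n, i⟩ := z
  have hnear : T.coordSubstK r (T.scaledForm T.mono (T.near r)) =
      T.scaledForm T.mono (T.far r) := by
    rw [T.coordSubstK_scaledForm (Or.inr rfl), centerSwap_near]
  have hfar : T.coordSubstK r (T.scaledForm T.mono (T.far r)) =
      T.scaledForm T.mono (T.near r) := by
    rw [T.coordSubstK_scaledForm (Or.inr rfl), centerSwap_far]
  rw [coordSubstK_X, map_mul, coordSubstK_X, ← mul_assoc, squareFactor]
  congr 1
  by_cases h0 : (r.2 : ℤ) = 0
  · by_cases hsub : n = r.1 - 1
    · rw [if_pos ⟨h0, Or.inl hsub⟩, hsub, multiplier_sub_one h0]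
      split_ifs
      · rw [hfar]
      · rw [hnear, mul_comm]
    by_cases hadd : n = r.1 + 1
    · rw [if_pos ⟨h0, Or.inr hadd⟩, hadd, multiplier_add_one h0]
      split_ifs
      · rw [hnear, mul_comm]
      · rw [hfar]
    · rw [if_neg fun h => h.2.elim hsub hadd, multiplier_of_ne r hsub hadd, map_one, one_mul]
  · rw [if_neg fun h => h0 h.1, multiplier_of_ne_zero h0, map_one, one_mul]

theorem coordSubstK_coordSubstK (r : T.Root) {d : ZMod T.N → ℤ} {f : MvPolynomial T.Coord T.K}
    (hf : T.IsMultihomogeneous d f) : T.coordSubstK r (T.coordSubstK r f) =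
      (∏ n, T.squareFactor r n ^ (d n).toNat) * f := by
  have hcomp : (T.coordSubstK r).comp (T.coordSubstK r) = MvPolynomial.eval₂Hom MvPolynomial.C
      (fun z => T.squareFactor r z.1 * MvPolynomial.X z) := by
    refine MvPolynomial.ringHom_ext (fun a => ?_) (fun z => ?_)
    · simp only [RingHom.comp_apply, coordSubstK_C, MvPolynomial.coe_eval₂Hom,
        MvPolynomial.eval₂_C, sK_sK]
    · simp only [RingHom.comp_apply, coordSubstK_coordSubstK_X, MvPolynomial.coe_eval₂Hom,
        MvPolynomial.eval₂_X]
  calc T.coordSubstK r (T.coordSubstK r f)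
      = MvPolynomial.eval₂ MvPolynomial.C
          (fun z => T.squareFactor r z.1 * MvPolynomial.X z) f := RingHom.congr_fun hcomp f
    _ = _ := by rw [hf.eval₂_mul _ (T.squareFactor r), MvPolynomial.eval₂_eta]

theorem coordSubstK_ne_zero (r : T.Root) {d : ZMod T.N → ℤ} {f : MvPolynomial T.Coord T.K}
    (hf : T.IsMultihomogeneous d f) (h : f ≠ 0) : T.coordSubstK r f ≠ 0 := by
  intro h0
  have hsq := T.coordSubstK_coordSubstK r hf
  rw [h0, map_zero] at hsq
  exact mul_ne_zero (Finset.prod_ne_zero_iff.2 fun n _ =>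
    pow_ne_zero _ (T.squareFactor_ne_zero r n)) h hsq.symm

theorem ne_zero_of_reflDenom_mul {r : T.Root} {Λ : T.NS} {f g : MvPolynomial T.Coord T.K}
    (hf : f ∈ T.linearSystem Λ) (h : f ≠ 0)
    (hg : T.reflDenom T.mono r Λ * g = T.reflNumer T.mono r Λ * T.coordSubstK r f) : g ≠ 0 := by
  rintro rfl
  rw [mul_zero] at hg
  exact mul_ne_zero (T.reflNumer_ne_zero r Λ)
    (T.coordSubstK_ne_zero r ((T.mem_linearSystem Λ f).1 hf).1 h) hg.symm

theorem sK_smul_eq_of_reflDenom_mul {r : T.Root} {Λ Λ' : T.NS} {f g g' : MvPolynomial T.Coord T.K}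
    (hg : g ∈ T.linearSystem Λ') (hg' : g' ∈ T.linearSystem Λ') {a b : T.K}
    (ha : T.reflDenom T.mono r Λ * a • f = T.reflNumer T.mono r Λ * T.coordSubstK r g)
    (hb : T.reflDenom T.mono r Λ * b • f = T.reflNumer T.mono r Λ * T.coordSubstK r g') :
    T.sK r b • g = T.sK r a • g' := by
  have hmem : T.sK r b • g - T.sK r a • g' ∈ T.linearSystem Λ' :=
    sub_mem (Submodule.smul_mem _ _ hg) (Submodule.smul_mem _ _ hg')
  by_contra hne
  have h0 := T.coordSubstK_ne_zero r ((T.mem_linearSystem _ _).1 hmem).1 (sub_ne_zero.2 hne)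
  refine mul_ne_zero (T.reflNumer_ne_zero r Λ) h0 ?_
  simp only [MvPolynomial.smul_eq_C_mul, map_sub, map_mul, coordSubstK_C, sK_sK, mul_sub] at ha hb ⊢
  linear_combination MvPolynomial.C a * hb - MvPolynomial.C b * ha

/-- `Λ` has exactly one nonzero section up to scalars, i.e. it is the class of a unique
hypersurface. -/
def IsRigid (Λ : T.NS) : Prop :=
  ∃ f ∈ T.linearSystem Λ, f ≠ 0 ∧ ∀ g ∈ T.linearSystem Λ, ∃ a : T.K, g = a • f

theorem weyl_induction {Q : T.NS → Prop} (h : ∀ r Λ, Q Λ → Q (T.s r Λ)) {w : T.NS ≃ₗ[ℤ] T.NS}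
    (hw : w ∈ T.W) (Λ : T.NS) (hΛ : Q Λ) : Q (w Λ) := by
  suffices hiff : ∀ Λ, Q Λ ↔ Q (w Λ) from (hiff Λ).1 hΛ
  induction hw using Subgroup.closure_induction with
  | mem x hx =>
    obtain ⟨r, rfl⟩ := hx
    exact fun Λ => ⟨h r Λ, fun h' => T.s_s r Λ ▸ h r _ h'⟩
  | one => exact fun Λ => Iff.rfl
  | mul x y _ _ hx hy => exact fun Λ => (hy Λ).trans (hx _)
  | inv x _ hx =>
    intro Λ
    rw [hx (x⁻¹ Λ), ← LinearEquiv.mul_apply, mul_inv_cancel, LinearEquiv.coe_one, id]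

theorem deg_sub (Λ Λ' : T.NS) : T.deg (Λ - Λ') = T.deg Λ - T.deg Λ' := rfl

theorem mult_sub (Λ Λ' : T.NS) (c : T.Center) :
    T.mult (Λ - Λ') c = T.mult Λ c - T.mult Λ' c := by
  simp only [mult, Prod.snd_sub, Pi.sub_apply]
  ring

variable {T} in
theorem eq_of_deg_eq_of_mult_eq {Λ Λ' : T.NS} (hd : T.deg Λ = T.deg Λ')
    (hm : ∀ c, T.mult Λ c = T.mult Λ' c) : Λ = Λ' :=
  Prod.ext hd (funext fun c => neg_injective (hm c))

theorem deg_E (c : T.Center) : T.deg (T.E c.1 c.2) = 0 := by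
  rw [E_center]
  rfl

theorem mult_E (c c' : T.Center) : T.mult (T.E c.1 c.2) c' = if c' = c then -1 else 0 := by
  rw [E_center, mult]
  simp only [Pi.single_apply]
  split_ifs <;> rfl

theorem one_mem_linearSystem_E (c : T.Center) : 1 ∈ T.linearSystem (T.E c.1 c.2) := by
  refine (T.mem_linearSystem _ _).2 ⟨?_, fun c' => ?_⟩
  · rw [deg_E]
    exact MvPolynomial.isWeightedHomogeneous_one _ _
  · rw [mult_E]
    split_ifs <;> simp

theorem eq_C_of_isMultihomogeneous_zero {f : MvPolynomial T.Coord T.K}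
    (hf : T.IsMultihomogeneous 0 f) : f = MvPolynomial.C (f.coeff 0) := by
  classical
  ext m
  rw [MvPolynomial.coeff_C]
  split_ifs with h
  · rw [h]
  · by_contra hm
    refine h (Finsupp.ext ?_).symm
    rintro ⟨n, i⟩
    have hdeg := hf.degree_eq hm n
    rw [Pi.zero_apply] at hdeg
    rw [Finsupp.zero_apply]
    fin_cases i
    · simp only [Fin.zero_eta]; omega
    · simp only [Fin.mk_one]; omega

theorem isRigid_E (c : T.Center) : T.IsRigid (T.E c.1 c.2) := by
  refine ⟨1, T.one_mem_linearSystem_E c, one_ne_zero, fun g hg => ⟨g.coeff 0, ?_⟩⟩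
  have hdeg := ((T.mem_linearSystem _ _).1 hg).1
  rw [deg_E] at hdeg
  rw [MvPolynomial.smul_eq_C_mul, mul_one, ← T.eq_C_of_isMultihomogeneous_zero hdeg]

theorem C_notMem_centerIdeal (c : T.Center) {a : T.K} (ha : a ≠ 0) :
    (MvPolynomial.C a : MvPolynomial T.Coord T.K) ∉ T.centerIdeal c := by
  intro h
  have := T.centerIdeal_le_ker_eval c h
  rw [RingHom.mem_ker, MvPolynomial.eval_C] at this
  exact ha this

theorem notMem_centerIdeal_of_isMultihomogeneous_zero (c : T.Center)
    {f : MvPolynomial T.Coord T.K} (hf : T.IsMultihomogeneous 0 f) (h : f ≠ 0) :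
    f ∉ T.centerIdeal c := by
  rw [T.eq_C_of_isMultihomogeneous_zero hf] at h ⊢
  exact T.C_notMem_centerIdeal c fun h0 => h (by rw [h0, MvPolynomial.C_0])

section NonzeroSection

variable {T} {Λ : T.NS} {f : MvPolynomial T.Coord T.K} (hf : f ∈ T.linearSystem Λ) (hf0 : f ≠ 0)
include hf hf0

theorem deg_nonneg_of_mem_linearSystem (n : ZMod T.N) : 0 ≤ T.deg Λ n :=
  ((T.mem_linearSystem Λ f).1 hf).1.nonneg hf0 n

theorem mult_nonpos_of_mem_linearSystem (hd : T.deg Λ = 0) (c : T.Center) : T.mult Λ c ≤ 0 := by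
  obtain ⟨hdeg, hmult⟩ := (T.mem_linearSystem Λ f).1 hf
  rw [hd] at hdeg
  by_contra! hpos
  exact T.notMem_centerIdeal_of_isMultihomogeneous_zero c hdeg hf0
    (Ideal.pow_le_self (by omega) (hmult c))

theorem eq_E_of_mem_linearSystem_E_sub (hΛ : Λ ≠ 0) (c : T.Center)
    {g : MvPolynomial T.Coord T.K} (hg : g ∈ T.linearSystem (T.E c.1 c.2 - Λ)) (hg0 : g ≠ 0) :
    Λ = T.E c.1 c.2 := by
  have hdeg : T.deg Λ = 0 := by
    funext n
    have hle := deg_nonneg_of_mem_linearSystem hg hg0 n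
    rw [deg_sub, deg_E, zero_sub, Pi.neg_apply, neg_nonneg] at hle
    exact le_antisymm hle (deg_nonneg_of_mem_linearSystem hf hf0 n)
  have hle := mult_nonpos_of_mem_linearSystem hf hf0 hdeg
  have hge := mult_nonpos_of_mem_linearSystem hg hg0 (by rw [deg_sub, deg_E, hdeg, sub_zero])
  simp only [mult_sub, mult_E] at hge
  have hother : ∀ x, x ≠ c → T.mult Λ x = 0 := fun x hx => by
    have := hge x
    rw [if_neg hx] at this
    exact le_antisymm (hle x) (by omega)
  have hself : T.mult Λ c = -1 := by
    have hne : T.mult Λ c ≠ 0 := fun h0 => hΛ <| eq_of_deg_eq_of_mult_eq hdeg fun x => by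
      by_cases hx : x = c
      · rw [hx, h0]; rfl
      · rw [hother x hx]; rfl
    have := hge c
    rw [if_pos rfl] at this
    have := hle c
    omega
  refine eq_of_deg_eq_of_mult_eq (by rw [hdeg, deg_E]) fun x => ?_
  rw [mult_E]
  split_ifs with hx
  · rw [hx, hself]
  · exact hother x hx

end NonzeroSection

section Rigidity

variable {T} (hT : ∀ n : ZMod T.N, T.k (n - 1) * T.k (n + 1) = T.ℓ (n - 1) * T.ℓ (n + 1))
include hT

theorem linearSystem_s_ne_bot (r : T.Root) (Λ : T.NS) (h : T.linearSystem Λ ≠ ⊥) :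
    T.linearSystem (T.s r Λ) ≠ ⊥ := by
  obtain ⟨f, hf, hf0⟩ := Submodule.exists_mem_ne_zero_of_ne_bot h
  obtain ⟨g, hg, hfg⟩ := T.exists_mem_linearSystem_s hT r Λ hf
  exact Submodule.ne_bot_iff _ |>.2 ⟨g, hg, T.ne_zero_of_reflDenom_mul hf hf0 hfg⟩

theorem isRigid_s (r : T.Root) (Λ : T.NS) (h : T.IsRigid Λ) : T.IsRigid (T.s r Λ) := by
  obtain ⟨f, hf, hf0, hspan⟩ := h
  have hback : ∀ g ∈ T.linearSystem (T.s r Λ), ∃ a : T.K, T.reflDenom T.mono r (T.s r Λ) * a • f =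
      T.reflNumer T.mono r (T.s r Λ) * T.coordSubstK r g := by
    intro g hg
    obtain ⟨f', hf', hgf'⟩ := T.exists_mem_linearSystem_s hT r (T.s r Λ) hg
    rw [s_s] at hf'
    obtain ⟨a, rfl⟩ := hspan f' hf'
    exact ⟨a, hgf'⟩
  obtain ⟨g, hg, hfg⟩ := T.exists_mem_linearSystem_s hT r Λ hf
  have hg0 := T.ne_zero_of_reflDenom_mul hf hf0 hfg
  obtain ⟨a, ha⟩ := hback g hg
  have ha0 : T.sK r a ≠ 0 := by
    rw [map_ne_zero]
    rintro rfl
    exact T.ne_zero_of_reflDenom_mul hg hg0 ha (zero_smul _ _)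
  refine ⟨g, hg, hg0, fun g' hg' => ?_⟩
  obtain ⟨b, hb⟩ := hback g' hg'
  refine ⟨(T.sK r a)⁻¹ * T.sK r b, ?_⟩
  rw [mul_smul, T.sK_smul_eq_of_reflDenom_mul hg hg' ha hb, inv_smul_smul₀ ha0]

theorem isRigid_of_mem {Λ : T.NS} (h : Λ ∈ T.M) : T.IsRigid Λ := by
  obtain ⟨w, hw, c, rfl⟩ := h
  exact T.weyl_induction (isRigid_s hT) hw _ (T.isRigid_E c)

theorem finrank_linearSystem {Λ : T.NS} (h : Λ ∈ T.M) :
    Module.finrank T.K (T.linearSystem Λ) = 1 := by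
  obtain ⟨f, hf, hf0, hspan⟩ := isRigid_of_mem hT h
  refine finrank_eq_one (⟨f, hf⟩ : T.linearSystem Λ) (fun h => hf0 (congrArg Subtype.val h)) ?_
  rintro ⟨g, hg⟩
  obtain ⟨a, rfl⟩ := hspan g hg
  exact ⟨a, rfl⟩

theorem eq_E_of_linearSystem_sub_ne_bot {Λ : T.NS} (h : Λ ∈ T.M) (c : T.Center)
    (hsub : T.linearSystem (Λ - T.E c.1 c.2) ≠ ⊥) : Λ = T.E c.1 c.2 := by
  obtain ⟨w, hw, c', rfl⟩ := h
  -- Transporting by `w⁻¹` turns the larger class into an exceptional one.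
  have hcancel : ∀ Λ, w⁻¹ (w Λ) = Λ := fun Λ => w.symm_apply_apply Λ
  have hne : w⁻¹ (T.E c.1 c.2) ≠ 0 := fun h0 => by
    have hE : T.E c.1 c.2 = 0 := (w⁻¹).injective (h0.trans (map_zero _).symm)
    have hmult := T.mult_E c c
    rw [hE, if_pos rfl] at hmult
    exact absurd hmult (by simp [mult])
  have hsub' := T.weyl_induction (linearSystem_s_ne_bot hT) (inv_mem hw) _ hsub
  rw [map_sub, hcancel] at hsub'
  obtain ⟨g, hg, hg0⟩ := Submodule.exists_mem_ne_zero_of_ne_bot hsub'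
  obtain ⟨f, hf, hf0, -⟩ := isRigid_of_mem hT ⟨w⁻¹, inv_mem hw, c, rfl⟩
  rw [← eq_E_of_mem_linearSystem_E_sub hf hf0 hne c' hg hg0]
  exact w.apply_symm_apply _

theorem isDefiningPolynomial {Λ : T.NS} (h : Λ ∈ T.M) {f : MvPolynomial T.Coord T.K}
    (hf : f ∈ T.linearSystem Λ) (hf0 : f ≠ 0) : T.IsDefiningPolynomial Λ f := by
  refine ⟨hf0, hf, fun c hc => ?_⟩
  obtain ⟨hdeg, hmult⟩ := (T.mem_linearSystem Λ f).1 hf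
  have hsub : f ∈ T.linearSystem (Λ - T.E c.1 c.2) := by
    refine (T.mem_linearSystem _ f).2 ⟨by rwa [deg_sub, deg_E, sub_zero], fun x => ?_⟩
    rw [mult_sub, mult_E]
    split_ifs with hx
    · exact hx ▸ Ideal.pow_le_pow_right (by omega) hc
    · rw [sub_zero]
      exact hmult x
  have hΛ := eq_E_of_linearSystem_sub_ne_bot hT h c ((Submodule.ne_bot_iff _).2 ⟨f, hsub, hf0⟩)
  rw [hΛ, deg_E] at hdeg
  exact T.notMem_centerIdeal_of_isMultihomogeneous_zero c hdeg hf0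
    (Ideal.pow_le_self (Nat.succ_ne_zero _) hc)

end Rigidity

/-! ### Normalized polynomials -/

/-- The integral form of the substitution `coordSubstK`. -/
abbrev coordSubstZ (r : T.Root) :
    MvPolynomial T.Coord (T.Puiseux ℤ) →+* MvPolynomial T.Coord (T.Puiseux ℤ) :=
  T.coordSubst T.monoZ (T.sZ r) r

theorem puiseuxToK_comp_monoZ : (fun x => T.puiseuxToK (T.monoZ x)) = T.mono :=
  funext T.puiseuxToK_monoZ

theorem map_coordSubstZ (r : T.Root) (P : MvPolynomial T.Coord (T.Puiseux ℤ)) :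
    MvPolynomial.map T.puiseuxToK (T.coordSubstZ r P) =
      T.coordSubstK r (MvPolynomial.map T.puiseuxToK P) := by
  suffices h : (MvPolynomial.map T.puiseuxToK).comp (T.coordSubstZ r) =
      (T.coordSubstK r).comp (MvPolynomial.map T.puiseuxToK) from RingHom.congr_fun h P
  refine MvPolynomial.ringHom_ext (fun a => ?_) (fun z => ?_)
  · have := RingHom.congr_fun (T.puiseuxToK_comp_sZ r) a
    simp only [RingHom.comp_apply, RingHom.coe_coe] at this
    simp [coordSubst, this]
  · simp [coordSubst, map_multiplier, puiseuxToK_comp_monoZ]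

theorem mem_range_map_of_scaledForm_pow_mul (c : T.Center) (a : ℕ) {g : MvPolynomial T.Coord T.K}
    (h : T.scaledForm T.mono c ^ a * g ∈ (MvPolynomial.map (σ := T.Coord) T.puiseuxToK).range) :
    g ∈ (MvPolynomial.map (σ := T.Coord) T.puiseuxToK).range := by
  induction a with
  | zero => simpa using h
  | succ a ih =>
    refine ih (mem_range_map_of_X_add_C_mul_X_mul (i := (c.1, 0)) (j := (c.1, 1)) (by simp)
      (T.monoZ (T.paramExp c)) ?_)
    have hmono : MvPolynomial.C (T.mono (T.ω c.1 • T.paramExp c)) ∈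
        (MvPolynomial.map (σ := T.Coord) T.puiseuxToK).range :=
      ⟨MvPolynomial.C (T.monoZ (T.ω c.1 • T.paramExp c)),
        by rw [MvPolynomial.map_C, puiseuxToK_monoZ]⟩
    have := Subring.mul_mem _ hmono h
    rwa [pow_succ', mul_assoc, ← mul_assoc, C_mono_mul_scaledForm, centerForm,
      ← puiseuxToK_monoZ] at this

theorem mem_range_map_of_reflDenom_mul (r : T.Root) (Λ : T.NS) {g : MvPolynomial T.Coord T.K}
    (h : T.reflDenom T.mono r Λ * g ∈ (MvPolynomial.map (σ := T.Coord) T.puiseuxToK).range) :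
    g ∈ (MvPolynomial.map (σ := T.Coord) T.puiseuxToK).range := by
  rw [reflDenom] at h
  split_ifs at h
  · rw [mul_assoc] at h
    exact T.mem_range_map_of_scaledForm_pow_mul _ _ (T.mem_range_map_of_scaledForm_pow_mul _ _ h)
  · rwa [one_mul] at h

theorem map_puiseuxToK_injective :
    Function.Injective (MvPolynomial.map (σ := T.Coord) T.puiseuxToK) :=
  MvPolynomial.map_injective _ T.puiseuxToK_injective

section Submonoid

variable {A : Type*} [CommRing A] {e : (T.Root → ℚ) → A} {S : Submonoid (MvPolynomial T.Coord A)}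

theorem multiplier_mem (h : ∀ c, T.scaledForm e c ∈ S) (r : T.Root) (z : T.Coord) :
    T.multiplier e r z ∈ S := by
  rw [multiplier]
  by_cases h0 : (r.2 : ℤ) = 0
  · by_cases hsub : z.1 = r.1 - 1
    · simpa only [if_pos h0, if_pos hsub] using h _
    by_cases hadd : z.1 = r.1 + 1
    · simpa only [if_pos h0, if_neg hsub, if_pos hadd] using h _
    · simpa only [if_pos h0, if_neg hsub, if_neg hadd] using S.one_mem
  · simpa only [if_neg h0] using S.one_mem

theorem reflDenom_mem (h : ∀ c, T.scaledForm e c ∈ S) (r : T.Root) (Λ : T.NS) :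
    T.reflDenom e r Λ ∈ S := by
  rw [reflDenom]
  split_ifs
  · exact S.mul_mem (S.pow_mem (h _) _) (S.pow_mem (h _) _)
  · exact S.one_mem

theorem reflNumer_mem (h : ∀ c, T.scaledForm e c ∈ S) (r : T.Root) (Λ : T.NS) :
    T.reflNumer e r Λ ∈ S := by
  rw [reflNumer]
  split_ifs
  · exact S.mul_mem (S.pow_mem (h _) _) (S.pow_mem (h _) _)
  · exact S.one_mem

end Submonoid

/-- The torus-fixed point at which, on the `n`-th line, only the coordinate `S n` is nonzero; a form
takes there the value of its coefficient at the corner monomial given by `S`. -/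
def cornerPoint {A : Type*} [CommRing A] (S : ZMod T.N → Fin 2) (z : T.Coord) : A :=
  if z.2 = S z.1 then 1 else 0

theorem eq_corner_iff {A : Type*} [CommRing A] {d : ZMod T.N → ℤ} {f : MvPolynomial T.Coord A}
    (hf : T.IsMultihomogeneous d f) {m : T.Coord →₀ ℕ} (hm : f.coeff m ≠ 0)
    (S : ZMod T.N → Fin 2) : m = T.corner d S ↔ ∀ z : T.Coord, z.2 ≠ S z.1 → m z = 0 := by
  constructor
  · rintro rfl z hz
    simp [corner, hz]
  · intro h
    ext ⟨n, i⟩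
    have hdeg := hf.degree_eq hm n
    have h0 := h (n, 0)
    have h1 := h (n, 1)
    simp only [corner, Finsupp.equivFunOnFinite_symm_apply_apply]
    generalize S n = s at *
    fin_cases s <;> fin_cases i <;> simp at h0 h1 ⊢ <;> omega

theorem coeff_corner {A : Type*} [CommRing A] {d : ZMod T.N → ℤ} {f : MvPolynomial T.Coord A}
    (hf : T.IsMultihomogeneous d f) (S : ZMod T.N → Fin 2) :
    f.coeff (T.corner d S) = MvPolynomial.eval (T.cornerPoint S) f := by
  classical
  have hterm : ∀ m ∈ f.support, f.coeff m * ∏ z, T.cornerPoint S z ^ m z =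
      if m = T.corner d S then f.coeff m else 0 := by
    intro m hm
    rw [MvPolynomial.mem_support_iff] at hm
    simp only [T.eq_corner_iff hf hm, cornerPoint]
    split_ifs with h
    · rw [Finset.prod_eq_one, mul_one]
      intro z _
      split_ifs with hz
      · rw [one_pow]
      · rw [h z hz, pow_zero]
    · push Not at h
      obtain ⟨z, hz, hmz⟩ := h
      rw [Finset.prod_eq_zero (Finset.mem_univ z), mul_zero]
      rw [if_neg hz, zero_pow hmz]
  rw [MvPolynomial.eval_eq', Finset.sum_congr rfl hterm, Finset.sum_ite_eq']
  split_ifs with h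
  · rfl
  · exact MvPolynomial.notMem_support_iff.1 h

/-- The polynomials all of whose corner coefficients are monic monomials. -/
def monicCorners : Submonoid (MvPolynomial T.Coord (T.Puiseux ℤ)) where
  carrier := {P | ∀ S, ∃ x, MvPolynomial.eval (T.cornerPoint S) P = T.monoZ x}
  one_mem' _ := ⟨0, by rw [map_one, monoZ_zero]⟩
  mul_mem' := fun hP hQ S => by
    obtain ⟨x, hx⟩ := hP S
    obtain ⟨y, hy⟩ := hQ S
    exact ⟨x + y, by rw [map_mul, hx, hy, monoZ_add]⟩

section MonicCorners

variable {T}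

theorem mem_monicCorners_of_mul {P Q : MvPolynomial T.Coord (T.Puiseux ℤ)}
    (hP : P ∈ T.monicCorners) (hQ : P * Q ∈ T.monicCorners) : Q ∈ T.monicCorners := by
  intro S
  obtain ⟨x, hx⟩ := hP S
  obtain ⟨y, hy⟩ := hQ S
  refine ⟨-x + y, ?_⟩
  rw [map_mul, hx] at hy
  rw [monoZ_add, ← hy, ← mul_assoc, monoZ_neg_mul, one_mul]

theorem scaledForm_mem_monicCorners (c : T.Center) : T.scaledForm T.monoZ c ∈ T.monicCorners := by
  intro S
  rcases (show S c.1 = 0 ∨ S c.1 = 1 by omega) with h | h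
  · exact ⟨-T.ω c.1 • T.paramExp c, by simp [scaledForm, centerForm, cornerPoint, h]⟩
  · exact ⟨-T.ω c.1 • T.paramExp c + T.paramExp c,
      by simp [scaledForm, centerForm, cornerPoint, h, monoZ_add]⟩

theorem map_cornerPoint {A B : Type*} [CommRing A] [CommRing B] (φ : A →+* B)
    (S : ZMod T.N → Fin 2) (z : T.Coord) : φ (T.cornerPoint S z) = T.cornerPoint S z := by
  rw [cornerPoint, cornerPoint, apply_ite φ, map_one, map_zero]

theorem eval_cornerPoint_map {A B : Type*} [CommRing A] [CommRing B] (φ : A →+* B)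
    (S : ZMod T.N → Fin 2) (P : MvPolynomial T.Coord A) :
    MvPolynomial.eval (T.cornerPoint S) (MvPolynomial.map φ P) =
      φ (MvPolynomial.eval (T.cornerPoint S) P) := by
  rw [MvPolynomial.eval_map, MvPolynomial.eval, MvPolynomial.coe_eval₂Hom, MvPolynomial.hom_eval₂]
  simp only [map_cornerPoint, RingHom.comp_id]

theorem IsMultihomogeneous.eval₂_coordSubst {A B : Type*} [CommRing A] [CommRing B]
    {e : (T.Root → ℚ) → A} {P : MvPolynomial T.Coord A} {d : ZMod T.N → ℤ}
    (hP : T.IsMultihomogeneous d P) (s : A →+* A) (r : T.Root) (φ : A →+* B) (x : T.Coord → B)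
    (w : ZMod T.N → B)
    (hw : ∀ z, MvPolynomial.eval₂ φ x (T.multiplier e r z) * x z = w z.1 * x z) :
    MvPolynomial.eval₂ φ x (T.coordSubst e s r P) =
      (∏ n, w n ^ (d n).toNat) * MvPolynomial.eval₂ (φ.comp s) x P := by
  suffices h : (MvPolynomial.eval₂Hom φ x).comp (T.coordSubst e s r) =
      MvPolynomial.eval₂Hom (φ.comp s) (fun z => w z.1 * x z) from
    (RingHom.congr_fun h P).trans (hP.eval₂_mul (φ.comp s) w x)
  refine MvPolynomial.ringHom_ext (fun a => ?_) (fun z => ?_)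
  · simp only [coordSubst, RingHom.comp_apply, MvPolynomial.coe_eval₂Hom, MvPolynomial.eval₂_C]
  · simp only [coordSubst, RingHom.comp_apply, MvPolynomial.coe_eval₂Hom, MvPolynomial.eval₂_X,
      MvPolynomial.eval₂_mul, hw]

theorem eval_cornerPoint_coordSubstZ {P : MvPolynomial T.Coord (T.Puiseux ℤ)} {d : ZMod T.N → ℤ}
    (hP : T.IsMultihomogeneous d P) (r : T.Root) (S : ZMod T.N → Fin 2) :
    MvPolynomial.eval (T.cornerPoint S) (T.coordSubstZ r P) =
      MvPolynomial.eval (T.cornerPoint S)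
          (∏ n, T.multiplier T.monoZ r (n, S n) ^ (d n).toNat) *
        T.sZ r (MvPolynomial.eval (T.cornerPoint S) P) := by
  rw [← eval_cornerPoint_map, MvPolynomial.eval_map, map_prod]
  simp only [map_pow]
  refine hP.eval₂_coordSubst (T.sZ r) r (RingHom.id _) (T.cornerPoint S) _ fun z => ?_
  by_cases h : z.2 = S z.1
  · rw [← h]
    rfl
  · rw [cornerPoint, if_neg h, mul_zero, mul_zero]

theorem coordSubstZ_mem_monicCorners {P : MvPolynomial T.Coord (T.Puiseux ℤ)} {d : ZMod T.N → ℤ}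
    (hd : T.IsMultihomogeneous d P) (hP : P ∈ T.monicCorners) (r : T.Root) :
    T.coordSubstZ r P ∈ T.monicCorners := by
  intro S
  obtain ⟨x, hx⟩ := hP S
  obtain ⟨y, hy⟩ := prod_mem (S := T.monicCorners) (t := Finset.univ)
    (fun n _ => pow_mem (T.multiplier_mem scaledForm_mem_monicCorners r (n, S n)) (d n).toNat) S
  exact ⟨y + T.expAct r x, by rw [eval_cornerPoint_coordSubstZ hd, hy, hx, sZ_monoZ, monoZ_add]⟩

end MonicCorners

open TrivSqZeroExt in
/-- The homomorphism `a^x ↦ 1 + φ(x) ε` to the dual numbers. -/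
def tangent (φ : (T.Root → ℚ) →+ ℚ) : T.Puiseux ℤ →+* DualNumber ℚ :=
  (AddMonoidAlgebra.lift ℤ (DualNumber ℚ) (T.Root → ℚ)
    { toFun := fun x => inl 1 + inr (φ x.toAdd)
      map_one' := by ext <;> simp
      map_mul' := fun x y => by ext <;> simp [add_comm] } : T.Puiseux ℤ →ₐ[ℤ] DualNumber ℚ)

/-- The coordinates `1/θ` of the base point of the normalization. -/
def thetaInv (z : T.Coord) : ℚ := if z.2 = 0 then 1 / T.θ0 z.1 else 1 / T.θinf z.1

/-- The first order expansion of a polynomial at the base point `a = 1`, `ζ = 1/θ`, in the direction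
`φ` of the parameters. -/
def expand (φ : (T.Root → ℚ) →+ ℚ) : MvPolynomial T.Coord (T.Puiseux ℤ) →+* DualNumber ℚ :=
  MvPolynomial.eval₂Hom (T.tangent φ) fun z => TrivSqZeroExt.inl (T.thetaInv z)

/-- The polynomials whose value at the base point `a = 1`, `ζ = 1/θ` is nonzero and stationary
under variation of the parameters. -/
def balanced : Submonoid (MvPolynomial T.Coord (T.Puiseux ℤ)) where
  carrier := {P | ∃ e : ℚ, e ≠ 0 ∧ ∀ φ, T.expand φ P = TrivSqZeroExt.inl e}
  one_mem' := ⟨1, one_ne_zero, fun φ => by rw [map_one, TrivSqZeroExt.inl_one]⟩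
  mul_mem' := by
    rintro P Q ⟨a, ha, hP⟩ ⟨b, hb, hQ⟩
    exact ⟨a * b, mul_ne_zero ha hb, fun φ => by rw [map_mul, hP, hQ, TrivSqZeroExt.inl_mul]⟩

section Balanced

variable {T}

open TrivSqZeroExt in
theorem tangent_single (φ : (T.Root → ℚ) →+ ℚ) (x : T.Root → ℚ) (c : ℤ) :
    T.tangent φ (AddMonoidAlgebra.single x c) = inl (c : ℚ) + inr ((c : ℚ) * φ x) := by
  have h : T.tangent φ (AddMonoidAlgebra.single x c) = c • (inl 1 + inr (φ x)) := by
    simp [tangent]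
  rw [h]
  ext
  · simp
  · simp [mul_comm]

open TrivSqZeroExt in
theorem tangent_monoZ (φ : (T.Root → ℚ) →+ ℚ) (x : T.Root → ℚ) :
    T.tangent φ (T.monoZ x) = inl 1 + inr (φ x) := by
  rw [monoZ, tangent_single, Int.cast_one, one_mul]

theorem tangent_comp_sZ (φ : (T.Root → ℚ) →+ ℚ) (r : T.Root) :
    (T.tangent φ).comp (T.sZ r) =
      T.tangent (φ.comp (T.expAct r : (T.Root → ℚ) →+ (T.Root → ℚ))) := by
  refine AddMonoidAlgebra.ringHom_ext ?_ ?_ <;>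
  · intro c
    rw [RingHom.comp_apply, sZ_single, tangent_single, tangent_single]
    rfl

theorem mem_balanced_of_mul {P Q : MvPolynomial T.Coord (T.Puiseux ℤ)} (hP : P ∈ T.balanced)
    (hQ : P * Q ∈ T.balanced) : Q ∈ T.balanced := by
  obtain ⟨a, ha, hP⟩ := hP
  obtain ⟨b, hb, hQ⟩ := hQ
  refine ⟨a⁻¹ * b, mul_ne_zero (inv_ne_zero ha) hb, fun φ => ?_⟩
  rw [TrivSqZeroExt.inl_mul, ← hQ φ, map_mul, hP, ← mul_assoc, ← TrivSqZeroExt.inl_mul,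
    inv_mul_cancel₀ ha, TrivSqZeroExt.inl_one, one_mul]

-- The exponent `ω` is chosen so that the first order terms of the two summands cancel.
theorem expand_scaledForm (φ : (T.Root → ℚ) →+ ℚ) (c : T.Center) :
    T.expand φ (T.scaledForm T.monoZ c) =
      TrivSqZeroExt.inl (1 / T.θ0 c.1 + 1 / T.θinf c.1) := by
  have h0 := T.θ0_pos c.1
  have hinf := T.θinf_pos c.1
  have hφ : φ (-T.ω c.1 • T.paramExp c) = -T.ω c.1 * φ (T.paramExp c) := map_rat_smul φ _ _
  have hω : φ (T.paramExp c) * (T.θinf c.1)⁻¹ =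
      T.ω c.1 * φ (T.paramExp c) * ((T.θ0 c.1)⁻¹ + (T.θinf c.1)⁻¹) := by
    rw [ω]
    field_simp
    ring
  simp only [scaledForm, centerForm, expand, map_mul, map_add, MvPolynomial.coe_eval₂Hom,
    MvPolynomial.eval₂_C, MvPolynomial.eval₂_X,
    tangent_monoZ, thetaInv, hφ, if_true, one_ne_zero, if_false]
  ext
  · simp
  · simp [hω]

theorem scaledForm_mem_balanced (c : T.Center) : T.scaledForm T.monoZ c ∈ T.balanced := by
  have h0 := T.θ0_pos c.1
  have hinf := T.θinf_pos c.1
  exact ⟨_, by positivity, fun φ => expand_scaledForm φ c⟩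

theorem expand_multiplier (φ : (T.Root → ℚ) →+ ℚ) (r : T.Root) (n : ZMod T.N) (i j : Fin 2) :
    T.expand φ (T.multiplier T.monoZ r (n, i)) = T.expand φ (T.multiplier T.monoZ r (n, j)) := by
  simp only [multiplier, apply_ite (T.expand φ), expand_scaledForm]
  split_ifs <;> rfl

theorem coordSubstZ_mem_balanced {P : MvPolynomial T.Coord (T.Puiseux ℤ)} {d : ZMod T.N → ℤ}
    (hd : T.IsMultihomogeneous d P) (hP : P ∈ T.balanced) (r : T.Root) :
    T.coordSubstZ r P ∈ T.balanced := by
  obtain ⟨e, he, hP⟩ := hP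
  choose w hw hm using fun n => T.multiplier_mem scaledForm_mem_balanced r (n, 0)
  refine ⟨(∏ n, w n ^ (d n).toNat) * e,
    mul_ne_zero (Finset.prod_ne_zero_iff.2 fun n _ => pow_ne_zero _ (hw n)) he, fun φ => ?_⟩
  have hrow (z : T.Coord) : T.expand φ (T.multiplier T.monoZ r z) = TrivSqZeroExt.inl (w z.1) := by
    rw [expand_multiplier φ r z.1 z.2 0, hm]
  have hsubst := hd.eval₂_coordSubst (e := T.monoZ) (T.sZ r) r (T.tangent φ)
    (fun z => TrivSqZeroExt.inl (T.thetaInv z)) (fun n => TrivSqZeroExt.inl (w n))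
    fun z => congrArg (· * _) (hrow z)
  rw [tangent_comp_sZ, prod_inl_pow] at hsubst
  rw [TrivSqZeroExt.inl_mul, ← hP (φ.comp (T.expAct r : (T.Root → ℚ) →+ (T.Root → ℚ)))]
  exact hsubst

/-- The exponent of the monomial `∏_{m,x} (a^x)^{c_{m,x} (1/θ)^m}`. -/
def weightedExponent (P : MvPolynomial T.Coord (T.Puiseux ℤ)) : T.Root → ℚ :=
  ∑ m ∈ P.support, (P.coeff m).coeff.sum fun x c => ((c : ℚ) * T.thetaWeight m) • x

theorem mono_weightedExponent (P : MvPolynomial T.Coord (T.Puiseux ℤ)) :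
    T.mono (weightedExponent P) = ∏ m ∈ P.support, (P.coeff m).coeff.prod
      (fun x c => T.mono (((c : ℚ) * T.thetaWeight m) • x)) := by
  rw [weightedExponent, mono_sum]
  refine Finset.prod_congr rfl fun m _ => ?_
  rw [Finsupp.sum, mono_sum, Finsupp.prod]

theorem snd_tangent (φ : (T.Root → ℚ) →+ ℚ) (p : T.Puiseux ℤ) :
    (T.tangent φ p).snd = p.coeff.sum fun x c => (c : ℚ) * φ x := by
  induction p using AddMonoidAlgebra.induction_linear with
  | zero => simp
  | add f g hf hg =>
    rw [map_add, TrivSqZeroExt.snd_add, hf, hg, AddMonoidAlgebra.coeff_add, Finsupp.sum_add_index']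
    · simp
    · intros; push_cast; ring
  | single x c =>
    rw [tangent_single, AddMonoidAlgebra.coeff_single, Finsupp.sum_single_index] <;> simp

theorem thetaWeight_eq (m : T.Coord →₀ ℕ) : T.thetaWeight m = ∏ z, T.thetaInv z ^ m z := by
  rw [thetaWeight, Fintype.prod_prod_type]
  simp [thetaInv]

theorem snd_expand (φ : (T.Root → ℚ) →+ ℚ) (P : MvPolynomial T.Coord (T.Puiseux ℤ)) :
    (T.expand φ P).snd = φ (weightedExponent P) := by
  rw [expand, MvPolynomial.coe_eval₂Hom, MvPolynomial.eval₂_eq', TrivSqZeroExt.snd_sum,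
    weightedExponent, map_sum]
  refine Finset.sum_congr rfl fun m _ => ?_
  rw [prod_inl_pow, ← thetaWeight_eq, Finsupp.sum, map_sum]
  simp only [TrivSqZeroExt.snd_mul, TrivSqZeroExt.snd_inl, TrivSqZeroExt.fst_inl, snd_tangent,
    op_smul_eq_smul, smul_eq_mul, mul_zero, zero_add]
  rw [Finsupp.sum, Finset.mul_sum]
  refine Finset.sum_congr rfl fun x _ => ?_
  rw [map_rat_smul φ, smul_eq_mul]
  ring

theorem weightedExponent_eq_zero {P : MvPolynomial T.Coord (T.Puiseux ℤ)} (h : P ∈ T.balanced) :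
    weightedExponent P = 0 := by
  obtain ⟨e, _, h⟩ := h
  exact eq_zero_of_forall_addMonoidHom fun φ => by rw [← snd_expand, h, TrivSqZeroExt.snd_inl]

theorem eq_zero_of_weightedExponent_C_mul_eq_zero {P : MvPolynomial T.Coord (T.Puiseux ℤ)}
    (hP : P ∈ T.balanced) {x : T.Root → ℚ}
    (h : weightedExponent (MvPolynomial.C (T.monoZ x) * P) = 0) : x = 0 := by
  obtain ⟨e, he, hP⟩ := hP
  refine eq_zero_of_forall_addMonoidHom fun φ => ?_
  have hsnd := snd_expand φ (MvPolynomial.C (T.monoZ x) * P)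
  rw [h, map_zero, map_mul, hP, expand, MvPolynomial.coe_eval₂Hom, MvPolynomial.eval₂_C,
    tangent_monoZ] at hsnd
  simpa [he] using hsnd

theorem isNormalized_iff {d : ZMod T.N → ℤ} {Φ : MvPolynomial T.Coord T.K}
    (hd : T.IsMultihomogeneous d Φ) : T.IsNormalized d Φ ↔ ∃ P,
      MvPolynomial.map T.puiseuxToK P = Φ ∧ P ∈ T.monicCorners ∧ weightedExponent P = 0 := by
  refine exists_congr fun P => and_congr_right fun hP => and_congr ?_ ?_
  · have hd' : T.IsMultihomogeneous d P :=
      isWeightedHomogeneous_of_map T.puiseuxToK_injective (hP ▸ hd)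
    simp only [T.coeff_corner hd']
    rfl
  · rw [← mono_weightedExponent, ← T.mono_zero, T.mono_injective.eq_iff]

theorem eq_of_map_eq_smul_map {P P' : MvPolynomial T.Coord (T.Puiseux ℤ)}
    (hc : P ∈ T.monicCorners) (hc' : P' ∈ T.monicCorners) (hb : P ∈ T.balanced)
    (hb' : weightedExponent P' = 0) {a : T.K}
    (h : MvPolynomial.map T.puiseuxToK P' = a • MvPolynomial.map T.puiseuxToK P) : P' = P := by
  obtain ⟨x, hx⟩ := hc 0
  obtain ⟨y, hy⟩ := hc' 0
  have ha : a = T.mono (y - x) := by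
    have hcorner := congrArg (MvPolynomial.eval (T.cornerPoint 0)) h
    rw [eval_cornerPoint_map, hy, MvPolynomial.smul_eval, eval_cornerPoint_map, hx,
      puiseuxToK_monoZ, puiseuxToK_monoZ] at hcorner
    rw [sub_eq_add_neg, mono_add, mono_neg, hcorner, mul_inv_cancel_right₀ (T.mono_ne_zero x)]
  have hmul : P' = MvPolynomial.C (T.monoZ (y - x)) * P := by
    refine T.map_puiseuxToK_injective ?_
    rw [h, map_mul, MvPolynomial.map_C, puiseuxToK_monoZ, ← ha, MvPolynomial.smul_eq_C_mul]
  have hyx : y - x = 0 := eq_zero_of_weightedExponent_C_mul_eq_zero hb (hmul ▸ hb')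
  rw [hmul, hyx, monoZ_zero, MvPolynomial.C_1, one_mul]

end Balanced

/-! ### Values of the `τ`-function -/

theorem sL_const (r : T.Root) (a : T.K) : T.sL r (T.const a) = T.const (T.sK r a) := by
  rw [const, RingHom.comp_apply, sL, IsFractionRing.lift_algebraMap, sPoly]
  simp [const]

theorem sL_tauVar (r : T.Root) (c : T.Center) : T.sL r (T.tauVar c) = T.sTau r c := by
  rw [tauVar, sL, IsFractionRing.lift_algebraMap, sPoly]
  simp

theorem tauVar_near (r : T.Root) : T.tauVar (T.near r) =
    T.tau r.1 (if (r.2 : ℤ) = 0 then 1 else r.2) := (T.tau_center (T.near r)).symm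

theorem tauVar_far (r : T.Root) : T.tauVar (T.far r) =
    T.tau r.1 (if (r.2 : ℤ) = 0 then -1 else if 0 < (r.2 : ℤ) then r.2 + 1 else r.2 - 1) :=
  (T.tau_center (T.far r)).symm

theorem sTau_of_ne {r : T.Root} {c : T.Center} (hnear : c ≠ T.near r) (hfar : c ≠ T.far r) :
    T.sTau r c = T.tauVar c := by
  have hnear' : ¬ (c.1 = r.1 ∧ (c.2 : ℤ) = if (r.2 : ℤ) = 0 then 1 else (r.2 : ℤ)) :=
    fun h => hnear (Sigma.subtype_ext h.1 h.2)
  have hfar' : ¬ (c.1 = r.1 ∧ (c.2 : ℤ) = if (r.2 : ℤ) = 0 then -1 else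
      if 0 < (r.2 : ℤ) then (r.2 : ℤ) + 1 else r.2 - 1) :=
    fun h => hfar (Sigma.subtype_ext h.1 h.2)
  rw [← tau_center, sTau]
  by_cases h : c.1 = r.1
  · rw [if_neg (not_not.2 h)]
    split_ifs <;> simp_all
  · rw [if_pos h]

theorem sTau_of_ne_zero {r : T.Root} (h : (r.2 : ℤ) ≠ 0) (c : T.Center) :
    T.sTau r c = T.tauVar (T.centerSwap r c) := by
  by_cases hnear : c = T.near r
  · subst hnear
    rw [centerSwap_near, tauVar_far]
    by_cases hpos : 0 < (r.2 : ℤ) <;> simp [sTau, near_snd, h, hpos]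
  by_cases hfar : c = T.far r
  · subst hfar
    rw [centerSwap_far, tauVar_near]
    by_cases hpos : 0 < (r.2 : ℤ) <;> simp [sTau, far_snd, h, hpos]
  rw [T.sTau_of_ne hnear hfar, T.centerSwap_of_ne hnear hfar]

theorem aeval_scaledForm (c : T.Center) : MvPolynomial.aeval T.zeta (T.scaledForm T.mono c) =
    T.const (T.mono (-T.ω c.1 • T.paramExp c)) * (T.ξ (c.1 + 1) * T.η (c.1 - 1)) +
      T.const (T.mono ((1 - T.ω c.1) • T.paramExp c)) * (T.ξ (c.1 - 1) * T.η (c.1 + 1)) := by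
  have hω : (1 - T.ω c.1) • T.paramExp c = -T.ω c.1 • T.paramExp c + T.paramExp c := by module
  rw [hω, mono_add, map_mul]
  simp only [scaledForm, centerForm, map_mul, map_add, MvPolynomial.aeval_C, MvPolynomial.aeval_X,
    ← const_eq, zeta, if_true, one_ne_zero, if_false]
  ring

theorem Fu_eq {r : T.Root} (h : (r.2 : ℤ) = 0) :
    T.Fu r.1 = MvPolynomial.aeval T.zeta (T.scaledForm T.mono (T.near r)) := by
  rw [aeval_scaledForm, Fu, T.uExp_eq h, near_fst]

theorem Fv_eq {r : T.Root} (h : (r.2 : ℤ) = 0) :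
    T.Fv r.1 = MvPolynomial.aeval T.zeta (T.scaledForm T.mono (T.far r)) := by
  rw [aeval_scaledForm, Fv, T.vExp_eq h, far_fst,
    show T.ω r.1 • -T.paramExp (T.far r) = -T.ω r.1 • T.paramExp (T.far r) by module,
    show (-1 + T.ω r.1) • -T.paramExp (T.far r) = (1 - T.ω r.1) • T.paramExp (T.far r) by module]

/-- The product of the two `τ`-variables involved in a simple reflection. -/
def pairTau (r : T.Root) : T.L := T.tauVar (T.near r) * T.tauVar (T.far r)

theorem pairTau_ne_zero (r : T.Root) : T.pairTau r ≠ 0 :=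
  mul_ne_zero (T.tauVar_ne_zero _) (T.tauVar_ne_zero _)

/-- The factor acquired by a `τ`-variable under `s_n^0`. -/
def tauFactor (r : T.Root) (c : T.Center) : T.L :=
  if c = T.near r then (T.pairTau r)⁻¹ * T.Fv r.1
  else if c = T.far r then (T.pairTau r)⁻¹ * T.Fu r.1 else 1

theorem tauFactor_near (r : T.Root) : T.tauFactor r (T.near r) = (T.pairTau r)⁻¹ * T.Fv r.1 :=
  if_pos rfl

theorem tauFactor_far (r : T.Root) : T.tauFactor r (T.far r) = (T.pairTau r)⁻¹ * T.Fu r.1 := by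
  rw [tauFactor, if_neg (T.near_ne_far r).symm, if_pos rfl]

theorem tauFactor_of_ne {r : T.Root} {c : T.Center} (hnear : c ≠ T.near r) (hfar : c ≠ T.far r) :
    T.tauFactor r c = 1 := by
  rw [tauFactor, if_neg hnear, if_neg hfar]

theorem sTau_near {r : T.Root} (h : (r.2 : ℤ) = 0) :
    T.sTau r (T.near r) = T.tauVar (T.near r) * T.tauFactor r (T.near r) := by
  have hdiv : T.sTau r (T.near r) = T.Fv r.1 / T.tauVar (T.far r) := by
    rw [tauVar_far]
    simp [sTau, near_snd, h]
  have hnear := T.tauVar_ne_zero (T.near r)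
  rw [hdiv, tauFactor_near, pairTau]
  field_simp

theorem sTau_far {r : T.Root} (h : (r.2 : ℤ) = 0) :
    T.sTau r (T.far r) = T.tauVar (T.far r) * T.tauFactor r (T.far r) := by
  have hdiv : T.sTau r (T.far r) = T.Fu r.1 / T.tauVar (T.near r) := by
    rw [tauVar_near]
    simp [sTau, far_snd, h]
  have hfar := T.tauVar_ne_zero (T.far r)
  rw [hdiv, tauFactor_far, pairTau]
  field_simp

theorem sTau_of_eq_zero {r : T.Root} (h : (r.2 : ℤ) = 0) (c : T.Center) :
    T.sTau r c = T.tauVar c * T.tauFactor r c := by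
  by_cases hnear : c = T.near r
  · rw [hnear, T.sTau_near h]
  by_cases hfar : c = T.far r
  · rw [hfar, T.sTau_far h]
  rw [T.sTau_of_ne hnear hfar, T.tauFactor_of_ne hnear hfar, mul_one]

/-- The product of the `τ`-variables on one side of row `n`: this is `ξ_n` for `i = 0` and `η_n` for
`i = 1`. -/
def sideTau (n : ZMod T.N) (i : Fin 2) : T.L :=
  ∏ c : T.Center, if c.1 = n ∧ T.side c = i then T.tauVar c else 1

theorem sideTau_eq (n : ZMod T.N) (i : Fin 2) : T.sideTau n i =
    ∏ j ∈ (Finset.Icc (-(T.ℓ n : ℤ)) (T.k n : ℤ)).erase 0,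
      if (if 0 < j then (0 : Fin 2) else 1) = i then T.tau n j else 1 := by
  rw [sideTau, Fintype.prod_sigma, Fintype.prod_eq_single n]
  · refine Eq.trans ?_ (Finset.prod_coe_sort ((Finset.Icc (-(T.ℓ n : ℤ)) (T.k n : ℤ)).erase 0)
      fun j => if (if 0 < j then (0 : Fin 2) else 1) = i then T.tau n j else 1)
    refine Fintype.prod_congr _ _ fun j => ?_
    simp only [true_and, side, ← T.tau_center ⟨n, j⟩]
  · intro m hm
    simp [hm]

theorem sideTau_zero (n : ZMod T.N) : T.sideTau n 0 = T.ξ n := by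
  have hside (j : ℤ) : (if 0 < j then (0 : Fin 2) else 1) = 0 ↔ 0 < j := by split_ifs <;> simp_all
  simp only [sideTau_eq, hside, ξ]
  rw [← Finset.prod_filter]
  refine Finset.prod_nbij' Int.toNat (fun i : ℕ => (i : ℤ)) ?_ ?_ ?_ ?_ ?_ <;>
    simp only [Finset.mem_filter, Finset.mem_erase, Finset.mem_Icc]
  · intro j hj; omega
  · intro i hi; omega
  · intro j hj; omega
  · intro i hi; omega
  · intro j hj; rw [Int.toNat_of_nonneg hj.2.le]

theorem sideTau_one (n : ZMod T.N) : T.sideTau n 1 = T.η n := by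
  have hside (j : ℤ) : (if 0 < j then (0 : Fin 2) else 1) = 1 ↔ j ≤ 0 := by
    split_ifs <;> simp <;> omega
  simp only [sideTau_eq, hside, η]
  rw [← Finset.prod_filter]
  refine Finset.prod_nbij' (fun j => (-j).toNat) (fun i : ℕ => -(i : ℤ)) ?_ ?_ ?_ ?_ ?_ <;>
    simp only [Finset.mem_filter, Finset.mem_erase, Finset.mem_Icc]
  · intro j hj; omega
  · intro i hi; omega
  · intro j hj; omega
  · intro i hi; omega
  · intro j hj; rw [Int.toNat_of_nonneg (by omega), neg_neg]

theorem zeta_eq (z : T.Coord) :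
    T.zeta z = T.sideTau (z.1 + 1) z.2 * T.sideTau (z.1 - 1) (1 - z.2) := by
  obtain ⟨n, i⟩ := z
  rw [zeta]
  simp only [← sideTau_zero, ← sideTau_one]
  fin_cases i
  · simp
  · exact mul_comm _ _

theorem sL_sideTau_of_ne_zero {r : T.Root} (h : (r.2 : ℤ) ≠ 0) (n : ZMod T.N) (i : Fin 2) :
    T.sL r (T.sideTau n i) = T.sideTau n i := by
  rw [sideTau, map_prod]
  refine Fintype.prod_equiv (T.centerSwap r) _ _ fun c => ?_
  rw [centerSwap_fst, T.side_centerSwap h c]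
  split_ifs
  · rw [sL_tauVar, T.sTau_of_ne_zero h]
  · rw [map_one]

theorem prod_tauFactor {r : T.Root} (h : (r.2 : ℤ) = 0) (n : ZMod T.N) (i : Fin 2) :
    (∏ c, if c.1 = n ∧ T.side c = i then T.tauFactor r c else 1) =
      if n = r.1 then (T.pairTau r)⁻¹ * (if i = 0 then T.Fv r.1 else T.Fu r.1) else 1 := by
  rw [Fintype.prod_eq_mul _ _ (T.near_ne_far r) fun c hc => by
      rw [T.tauFactor_of_ne hc.1 hc.2, ite_self],
    side_near h, side_far h, near_fst, far_fst, tauFactor_near, tauFactor_far]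
  by_cases hn : n = r.1
  · subst hn
    fin_cases i <;> simp
  · simp [hn, Ne.symm hn]

theorem sL_sideTau_of_eq_zero {r : T.Root} (h : (r.2 : ℤ) = 0) (n : ZMod T.N) (i : Fin 2) :
    T.sL r (T.sideTau n i) = T.sideTau n i *
      if n = r.1 then (T.pairTau r)⁻¹ * (if i = 0 then T.Fv r.1 else T.Fu r.1) else 1 := by
  rw [← T.prod_tauFactor h, sideTau, map_prod, ← Finset.prod_mul_distrib]
  refine Finset.prod_congr rfl fun c _ => ?_
  split_ifs
  · rw [sL_tauVar, T.sTau_of_eq_zero h]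
  · rw [map_one, one_mul]

/-- The denominators acquired by the coordinates of the `n`-th line under a simple reflection. -/
def zetaFactor (r : T.Root) (n : ZMod T.N) : T.L :=
  if (r.2 : ℤ) = 0 ∧ (n = r.1 - 1 ∨ n = r.1 + 1) then (T.pairTau r)⁻¹ else 1

theorem zetaFactor_of_ne_zero {r : T.Root} (h : (r.2 : ℤ) ≠ 0) (n : ZMod T.N) :
    T.zetaFactor r n = 1 := if_neg fun h' => h h'.1

theorem zetaFactor_of_ne {r : T.Root} {n : ZMod T.N} (hsub : n ≠ r.1 - 1) (hadd : n ≠ r.1 + 1) :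
    T.zetaFactor r n = 1 := if_neg fun h => not_or.2 ⟨hsub, hadd⟩ h.2

theorem zetaFactor_sub_one {r : T.Root} (h : (r.2 : ℤ) = 0) :
    T.zetaFactor r (r.1 - 1) = (T.pairTau r)⁻¹ := if_pos ⟨h, Or.inl rfl⟩

theorem zetaFactor_add_one {r : T.Root} (h : (r.2 : ℤ) = 0) :
    T.zetaFactor r (r.1 + 1) = (T.pairTau r)⁻¹ := if_pos ⟨h, Or.inr rfl⟩

theorem sL_zeta_of_eq_zero {r : T.Root} (h : (r.2 : ℤ) = 0) (z : T.Coord) :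
    T.sL r (T.zeta z) =
      T.zetaFactor r z.1 * MvPolynomial.aeval T.zeta (T.multiplier T.mono r z) * T.zeta z := by
  obtain ⟨n, i⟩ := z
  have hside : T.sL r (T.zeta (n, i)) =
      (if n = r.1 - 1 then (T.pairTau r)⁻¹ * (if i = 0 then T.Fv r.1 else T.Fu r.1) else 1) *
      (if n = r.1 + 1 then (T.pairTau r)⁻¹ * (if 1 - i = 0 then T.Fv r.1 else T.Fu r.1) else 1) *
      T.zeta (n, i) := by
    rw [zeta_eq, map_mul, T.sL_sideTau_of_eq_zero h, T.sL_sideTau_of_eq_zero h]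
    simp only [← eq_sub_iff_add_eq, sub_eq_iff_eq_add]
    ring
  rw [hside]
  congr 1
  by_cases hsub : n = r.1 - 1
  · rw [hsub, if_pos rfl, if_neg (T.add_one_ne_sub_one r.1).symm, mul_one, T.zetaFactor_sub_one h,
      multiplier_sub_one h, T.Fv_eq h, T.Fu_eq h]
    split_ifs <;> rfl
  by_cases hadd : n = r.1 + 1
  · rw [hadd, if_neg (T.add_one_ne_sub_one r.1), if_pos rfl, one_mul, T.zetaFactor_add_one h,
      multiplier_add_one h, T.Fv_eq h, T.Fu_eq h]
    fin_cases i <;> simp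
  · rw [multiplier_of_ne r hsub hadd, T.zetaFactor_of_ne hsub hadd, if_neg hsub, if_neg hadd,
      map_one]

theorem sL_zeta (r : T.Root) (z : T.Coord) : T.sL r (T.zeta z) =
    T.zetaFactor r z.1 * MvPolynomial.aeval T.zeta (T.coordSubstK r (MvPolynomial.X z)) := by
  rw [coordSubstK_X, map_mul, MvPolynomial.aeval_X, ← mul_assoc]
  by_cases h : (r.2 : ℤ) = 0
  · exact T.sL_zeta_of_eq_zero h z
  · rw [T.zetaFactor_of_ne_zero h, multiplier_of_ne_zero h, map_one, one_mul, one_mul,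
      zeta_eq, map_mul, T.sL_sideTau_of_ne_zero h, T.sL_sideTau_of_ne_zero h]

theorem sL_aeval_zeta (r : T.Root) {d : ZMod T.N → ℤ} {f : MvPolynomial T.Coord T.K}
    (hf : T.IsMultihomogeneous d f) : T.sL r (MvPolynomial.aeval T.zeta f) =
      (∏ n, T.zetaFactor r n ^ (d n).toNat) * MvPolynomial.aeval T.zeta (T.coordSubstK r f) := by
  let φ : T.K →+* T.L := T.const.comp (T.sK r : T.K →+* T.K)
  let aevalZeta : MvPolynomial T.Coord T.K →+* T.L :=
    (MvPolynomial.aeval T.zeta : _ →ₐ[T.K] T.L).toRingHom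
  have hsL : (T.sL r).comp aevalZeta = MvPolynomial.eval₂Hom φ
      (fun z => T.zetaFactor r z.1 * aevalZeta (T.coordSubstK r (MvPolynomial.X z))) := by
    refine MvPolynomial.ringHom_ext (fun a => ?_) (fun z => ?_)
    · simp [← const_eq, sL_const, φ, aevalZeta]
    · simp [sL_zeta, aevalZeta]
  have hsubst : aevalZeta.comp (T.coordSubstK r) = MvPolynomial.eval₂Hom φ
      (fun z => aevalZeta (T.coordSubstK r (MvPolynomial.X z))) := by
    refine MvPolynomial.ringHom_ext (fun a => ?_) (fun z => ?_)
    · simp [coordSubstK_C, ← const_eq, φ, aevalZeta]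
    · simp
  refine (RingHom.congr_fun hsL f).trans ((hf.eval₂_mul φ (T.zetaFactor r)
    (fun z => aevalZeta (T.coordSubstK r (MvPolynomial.X z)))).trans ?_)
  exact congrArg _ (RingHom.congr_fun hsubst f).symm

/-- The product of the `τ`-variables to the powers given by the multiplicities. -/
def multTau (Λ : T.NS) : T.L := ∏ c : T.Center, T.tauVar c ^ T.mult Λ c

theorem multTau_ne_zero (Λ : T.NS) : T.multTau Λ ≠ 0 :=
  Finset.prod_ne_zero_iff.2 fun c _ => zpow_ne_zero _ (T.tauVar_ne_zero c)

theorem sL_multTau_of_ne_zero {r : T.Root} (h : (r.2 : ℤ) ≠ 0) (Λ : T.NS) :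
    T.sL r (T.multTau Λ) = T.multTau (T.s r Λ) := by
  rw [multTau, map_prod]
  refine Fintype.prod_equiv (T.centerSwap r) _ _ fun c => ?_
  rw [map_zpow₀, sL_tauVar, T.sTau_of_ne_zero h, T.mult_s_of_ne_zero h, centerSwap_centerSwap]

theorem sL_multTau_of_eq_zero {r : T.Root} (h : (r.2 : ℤ) = 0) (Λ : T.NS) :
    T.sL r (T.multTau Λ) = T.multTau Λ * (T.tauFactor r (T.near r) ^ T.mult Λ (T.near r) *
      T.tauFactor r (T.far r) ^ T.mult Λ (T.far r)) := by
  rw [multTau, map_prod, ← Fintype.prod_eq_mul (T.near r) (T.far r)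
    (f := fun c => T.tauFactor r c ^ T.mult Λ c) (T.near_ne_far r) fun c hc => by
      rw [T.tauFactor_of_ne hc.1 hc.2, one_zpow], ← Finset.prod_mul_distrib]
  refine Finset.prod_congr rfl fun c _ => ?_
  rw [map_zpow₀, sL_tauVar, T.sTau_of_eq_zero h, mul_zpow]

theorem multTau_s_of_eq_zero {r : T.Root} (h : (r.2 : ℤ) = 0) (Λ : T.NS) :
    T.multTau (T.s r Λ) = T.multTau Λ * T.pairTau r ^ (T.deg Λ (r.1 - 1) + T.deg Λ (r.1 + 1)
      - T.mult Λ (T.near r) - T.mult Λ (T.far r)) := by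
  have hsplit (c : T.Center) : T.tauVar c ^ T.mult (T.s r Λ) c = T.tauVar c ^ T.mult Λ c *
      T.tauVar c ^ (T.mult (T.s r Λ) c - T.mult Λ c) := by
    rw [← zpow_add₀ (T.tauVar_ne_zero c), add_sub_cancel]
  rw [multTau, Finset.prod_congr rfl fun c _ => hsplit c, Finset.prod_mul_distrib, multTau]
  congr 1
  rw [Fintype.prod_eq_mul (T.near r) (T.far r) (T.near_ne_far r) fun c hc => by
    rw [T.mult_s_of_ne h Λ hc.1 hc.2, sub_self, zpow_zero], T.mult_s_near h, T.mult_s_far h,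
    pairTau, mul_zpow]
  congr 2
  ring

theorem prod_zetaFactor {r : T.Root} (h : (r.2 : ℤ) = 0) {d : ZMod T.N → ℤ} (hd : ∀ n, 0 ≤ d n) :
    ∏ n, T.zetaFactor r n ^ (d n).toNat = T.pairTau r ^ (-(d (r.1 - 1) + d (r.1 + 1))) := by
  rw [Fintype.prod_eq_mul (r.1 - 1) (r.1 + 1) (T.add_one_ne_sub_one r.1).symm fun n hn => by
      rw [T.zetaFactor_of_ne hn.1 hn.2, one_pow],
    T.zetaFactor_sub_one h, T.zetaFactor_add_one h, ← zpow_natCast, ← zpow_natCast,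
    Int.toNat_of_nonneg (hd _), Int.toNat_of_nonneg (hd _),
    ← zpow_add₀ (inv_ne_zero (T.pairTau_ne_zero r)), inv_zpow, zpow_neg]

/-- The value which a `τ`-function must take on `Λ` if the defining polynomial is `f`. -/
def tauValue (Λ : T.NS) (f : MvPolynomial T.Coord T.K) : T.L :=
  MvPolynomial.aeval T.zeta f / T.multTau Λ

theorem aeval_zeta_coordSubstK {r : T.Root} (h0 : (r.2 : ℤ) = 0) (Λ : T.NS)
    {f g : MvPolynomial T.Coord T.K}
    (h : T.reflDenom T.mono r Λ * g = T.reflNumer T.mono r Λ * T.coordSubstK r f) :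
    MvPolynomial.aeval T.zeta (T.coordSubstK r f) =
      T.Fu r.1 ^ T.mult Λ (T.far r) * T.Fv r.1 ^ T.mult Λ (T.near r) *
        MvPolynomial.aeval T.zeta g := by
  have hpow (x : T.L) (hx : x ≠ 0) (a : ℤ) : x ^ a = x ^ a.toNat / x ^ (-a).toNat := by
    conv_lhs => rw [← Int.toNat_sub_toNat_neg a]
    rw [zpow_sub₀ hx, zpow_natCast, zpow_natCast]
  have hu := T.Fu_ne_zero r.1
  have hv := T.Fv_ne_zero r.1
  replace h := congrArg (MvPolynomial.aeval T.zeta) h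
  rw [reflDenom, reflNumer, if_pos h0, if_pos h0] at h
  simp only [map_mul, map_pow, ← T.Fu_eq h0, ← T.Fv_eq h0] at h
  rw [hpow _ hu, hpow _ hv]
  field_simp
  linear_combination -h

theorem sL_tauValue_of_ne_zero {r : T.Root} (h0 : (r.2 : ℤ) ≠ 0) (Λ : T.NS)
    {f g : MvPolynomial T.Coord T.K} (hf : f ∈ T.linearSystem Λ)
    (h : T.reflDenom T.mono r Λ * g = T.reflNumer T.mono r Λ * T.coordSubstK r f) :
    T.sL r (T.tauValue Λ f) = T.tauValue (T.s r Λ) g := by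
  rw [reflDenom, reflNumer, if_neg h0, if_neg h0, one_mul, one_mul] at h
  rw [tauValue, tauValue, map_div₀, T.sL_aeval_zeta r ((T.mem_linearSystem Λ f).1 hf).1, h,
    T.sL_multTau_of_ne_zero h0, Finset.prod_eq_one, one_mul]
  intro n _
  rw [T.zetaFactor_of_ne_zero h0, one_pow]

theorem sL_tauValue_of_eq_zero {r : T.Root} (h0 : (r.2 : ℤ) = 0) (Λ : T.NS)
    {f g : MvPolynomial T.Coord T.K} (hf : f ∈ T.linearSystem Λ) (hf0 : f ≠ 0)
    (h : T.reflDenom T.mono r Λ * g = T.reflNumer T.mono r Λ * T.coordSubstK r f) :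
    T.sL r (T.tauValue Λ f) = T.tauValue (T.s r Λ) g := by
  have hd := ((T.mem_linearSystem Λ f).1 hf).1
  have hpair := T.pairTau_ne_zero r
  have hu := T.Fu_ne_zero r.1
  have hv := T.Fv_ne_zero r.1
  have hmult := T.multTau_ne_zero Λ
  rw [tauValue, tauValue, map_div₀, T.sL_aeval_zeta r hd, T.prod_zetaFactor h0 (hd.nonneg hf0),
    T.aeval_zeta_coordSubstK h0 Λ h, T.sL_multTau_of_eq_zero h0, T.multTau_s_of_eq_zero h0,
    tauFactor_near, tauFactor_far, mul_zpow, mul_zpow, inv_zpow, inv_zpow, zpow_neg,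
    zpow_sub₀ hpair, zpow_sub₀ hpair]
  field_simp

theorem sL_tauValue (r : T.Root) (Λ : T.NS) {f g : MvPolynomial T.Coord T.K}
    (hf : f ∈ T.linearSystem Λ)
    (h : T.reflDenom T.mono r Λ * g = T.reflNumer T.mono r Λ * T.coordSubstK r f) :
    T.sL r (T.tauValue Λ f) = T.tauValue (T.s r Λ) g := by
  by_cases hf0 : f = 0
  · rw [hf0, map_zero, mul_zero] at h
    have hg := (mul_eq_zero.1 h).resolve_left (T.reflDenom_ne_zero r Λ)
    rw [hf0, hg, tauValue, tauValue, map_zero, zero_div, zero_div, map_zero]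
  by_cases h0 : (r.2 : ℤ) = 0
  · exact T.sL_tauValue_of_eq_zero h0 Λ hf hf0 h
  · exact T.sL_tauValue_of_ne_zero h0 Λ hf h

/-- `P` is an integral form of a normalized section belonging to `Λ`. -/
structure IsNormalizedSection (Λ : T.NS) (P : MvPolynomial T.Coord (T.Puiseux ℤ)) : Prop where
  mem : MvPolynomial.map T.puiseuxToK P ∈ T.linearSystem Λ
  mem_monicCorners : P ∈ T.monicCorners
  mem_balanced : P ∈ T.balanced

theorem isNormalizedSection_E (c : T.Center) : T.IsNormalizedSection (T.E c.1 c.2) 1 :=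
  ⟨by rw [map_one]; exact T.one_mem_linearSystem_E c, one_mem _, one_mem _⟩

theorem tauValue_E (c : T.Center) : T.tauValue (T.E c.1 c.2) 1 = T.tauVar c := by
  rw [tauValue, map_one, multTau, Fintype.prod_eq_single c]
  · rw [mult_E, if_pos rfl, zpow_neg_one, one_div, inv_inv]
  · intro x hx
    rw [mult_E, if_neg hx, zpow_zero]

section NormalizedSection

variable {T}

theorem IsNormalizedSection.ne_zero {Λ : T.NS} {P : MvPolynomial T.Coord (T.Puiseux ℤ)}
    (h : T.IsNormalizedSection Λ P) : MvPolynomial.map T.puiseuxToK P ≠ 0 := by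
  intro h0
  have hP : P = 0 := T.map_puiseuxToK_injective (by rw [h0, map_zero])
  obtain ⟨x, hx⟩ := h.mem_monicCorners 0
  rw [hP, map_zero] at hx
  refine T.mono_ne_zero x ?_
  rw [← puiseuxToK_monoZ, ← hx, map_zero]

section Orbit

variable (hT : ∀ n : ZMod T.N, T.k (n - 1) * T.k (n + 1) = T.ℓ (n - 1) * T.ℓ (n + 1))
include hT

theorem exists_isNormalizedSection_s (r : T.Root) {Λ : T.NS}
    {P : MvPolynomial T.Coord (T.Puiseux ℤ)} (hP : T.IsNormalizedSection Λ P) :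
    ∃ Q, T.IsNormalizedSection (T.s r Λ) Q ∧
      T.sL r (T.tauValue Λ (MvPolynomial.map T.puiseuxToK P)) =
        T.tauValue (T.s r Λ) (MvPolynomial.map T.puiseuxToK Q) := by
  obtain ⟨g, hg, h⟩ := T.exists_mem_linearSystem_s hT r Λ hP.mem
  have hden : MvPolynomial.map T.puiseuxToK (T.reflDenom T.monoZ r Λ) = T.reflDenom T.mono r Λ := by
    rw [map_reflDenom, puiseuxToK_comp_monoZ]
  have hnum : MvPolynomial.map T.puiseuxToK (T.reflNumer T.monoZ r Λ) = T.reflNumer T.mono r Λ := by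
    rw [map_reflNumer, puiseuxToK_comp_monoZ]
  obtain ⟨Q, rfl⟩ := T.mem_range_map_of_reflDenom_mul r Λ (g := g)
    ⟨T.reflNumer T.monoZ r Λ * T.coordSubstZ r P, by rw [map_mul, hnum, map_coordSubstZ, h]⟩
  have hQ : T.reflDenom T.monoZ r Λ * Q = T.reflNumer T.monoZ r Λ * T.coordSubstZ r P := by
    refine T.map_puiseuxToK_injective ?_
    rw [map_mul, map_mul, hden, hnum, map_coordSubstZ, h]
  have hd : T.IsMultihomogeneous (T.deg Λ) P :=
    isWeightedHomogeneous_of_map T.puiseuxToK_injective ((T.mem_linearSystem Λ _).1 hP.mem).1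
  refine ⟨Q, ⟨hg, ?_, ?_⟩, T.sL_tauValue r Λ hP.mem h⟩
  · refine mem_monicCorners_of_mul (T.reflDenom_mem scaledForm_mem_monicCorners r Λ) ?_
    rw [hQ]
    exact mul_mem (T.reflNumer_mem scaledForm_mem_monicCorners r Λ)
      (coordSubstZ_mem_monicCorners hd hP.mem_monicCorners r)
  · refine mem_balanced_of_mul (T.reflDenom_mem scaledForm_mem_balanced r Λ) ?_
    rw [hQ]
    exact mul_mem (T.reflNumer_mem scaledForm_mem_balanced r Λ)
      (coordSubstZ_mem_balanced hd hP.mem_balanced r)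

theorem exists_isNormalizedSection {Λ : T.NS} (h : Λ ∈ T.M) :
    ∃ P, T.IsNormalizedSection Λ P := by
  obtain ⟨w, hw, c, rfl⟩ := h
  exact T.weyl_induction (Q := fun Λ => ∃ P, T.IsNormalizedSection Λ P)
    (fun r Λ ⟨P, hP⟩ => (exists_isNormalizedSection_s hT r hP).imp fun _ h => h.1) hw _
    ⟨1, T.isNormalizedSection_E c⟩

theorem exists_eq_smul {Λ : T.NS} (h : Λ ∈ T.M) {f g : MvPolynomial T.Coord T.K}
    (hf : f ∈ T.linearSystem Λ) (hf0 : f ≠ 0) (hg : g ∈ T.linearSystem Λ) :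
    ∃ a : T.K, g = a • f := by
  obtain ⟨f₀, _, _, hspan⟩ := isRigid_of_mem hT h
  obtain ⟨a, rfl⟩ := hspan f hf
  obtain ⟨b, rfl⟩ := hspan g hg
  have ha : a ≠ 0 := by
    rintro rfl
    exact hf0 (zero_smul _ _)
  exact ⟨b * a⁻¹, by rw [smul_smul, inv_mul_cancel_right₀ ha]⟩

theorem IsNormalizedSection.unique {Λ : T.NS} (h : Λ ∈ T.M)
    {P Q : MvPolynomial T.Coord (T.Puiseux ℤ)} (hP : T.IsNormalizedSection Λ P)
    (hQ : T.IsNormalizedSection Λ Q) : Q = P := by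
  obtain ⟨a, ha⟩ := exists_eq_smul hT h hP.mem hP.ne_zero hQ.mem
  exact eq_of_map_eq_smul_map hP.mem_monicCorners hQ.mem_monicCorners hP.mem_balanced
    (weightedExponent_eq_zero hQ.mem_balanced) ha

theorem isNormalizedDefiningPolynomial_iff {Λ : T.NS} (h : Λ ∈ T.M)
    {P : MvPolynomial T.Coord (T.Puiseux ℤ)} (hP : T.IsNormalizedSection Λ P)
    (Φ : MvPolynomial T.Coord T.K) :
    T.IsNormalizedDefiningPolynomial Λ Φ ↔ Φ = MvPolynomial.map T.puiseuxToK P := by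
  constructor
  · rintro ⟨hΦ, hnorm⟩
    have hd := ((T.mem_linearSystem Λ _).1 hΦ.mem_linearSystem).1
    obtain ⟨Q, rfl, hc, hw⟩ := (isNormalized_iff hd).1 hnorm
    obtain ⟨a, ha⟩ := exists_eq_smul hT h hP.mem hP.ne_zero hΦ.mem_linearSystem
    rw [eq_of_map_eq_smul_map hP.mem_monicCorners hc hP.mem_balanced hw ha]
  · rintro rfl
    refine ⟨isDefiningPolynomial hT h hP.mem hP.ne_zero, ?_⟩
    exact (isNormalized_iff ((T.mem_linearSystem Λ _).1 hP.mem).1).2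
      ⟨P, rfl, hP.mem_monicCorners, weightedExponent_eq_zero hP.mem_balanced⟩

end Orbit

end NormalizedSection

/-! ### The action of the Weyl group -/

section WeylAction

variable {T}

theorem ringHom_L_ext {S : Type*} [CommRing S] {f g : T.L →+* S}
    (h : ∀ x c, f (T.const (algebraMap (T.Puiseux ℂ) T.K (AddMonoidAlgebra.single x c))) =
      g (T.const (algebraMap (T.Puiseux ℂ) T.K (AddMonoidAlgebra.single x c))))
    (h' : ∀ c, f (T.tauVar c) = g (T.tauVar c)) : f = g := by
  refine IsLocalization.ringHom_ext (nonZeroDivisors (MvPolynomial T.Center T.K)) ?_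
  refine MvPolynomial.ringHom_ext (fun a => ?_) h'
  exact RingHom.congr_fun (T.ringHom_K_ext (f := f.comp T.const) (g := g.comp T.const) h) a

theorem linearIndependent_α : LinearIndependent ℤ T.α := by
  refine Fintype.linearIndependent_iff.2 fun z hz t => ?_
  have hzero : (fun t => (z t : ℚ)) = 0 := by
    refine T.eq_zero_of_coeffE_eq_zero (fun n => ?_) fun c => ?_
    · rw [← sum_mul_α_fst]
      have := congrFun (congrArg Prod.fst hz) n
      simp only [Prod.fst_sum, Finset.sum_apply, Prod.smul_fst, Pi.smul_apply, smul_eq_mul,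
        Prod.fst_zero, Pi.zero_apply] at this
      exact_mod_cast this
    · rw [← sum_mul_α_snd]
      have := congrFun (congrArg Prod.snd hz) c
      simp only [Prod.snd_sum, Finset.sum_apply, Prod.smul_snd, Pi.smul_apply, smul_eq_mul,
        Prod.snd_zero, Pi.zero_apply] at this
      exact_mod_cast this
  exact Int.cast_eq_zero.1 (congrFun hzero t)

variable (T) in
/-- The isomorphism of `ℤ^Root` with the root lattice sending `z` to `∑ z_t α_t`, as a map to the
lattice of classes. -/
def rootSum : (T.Root → ℤ) →ₗ[ℤ] T.NS := Fintype.linearCombination ℤ T.α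

theorem rootSum_injective : Function.Injective T.rootSum :=
  linearIndependent_α.fintypeLinearCombination_injective

theorem s_rootSum (r : T.Root) (z : T.Root → ℤ) : T.s r (T.rootSum z) =
    T.rootSum (z + Pi.single r (∑ t, z t * T.pairing (T.coα r) (T.α t))) := by
  have hpairing : T.pairing (T.coα r) (T.rootSum z) =
      ∑ t, z t * T.pairing (T.coα r) (T.α t) := by
    simp only [rootSum, Fintype.linearCombination_apply, map_sum, map_zsmul, smul_eq_mul]
  rw [map_add, rootSum, Fintype.linearCombination_apply_single, ← rootSum, s_apply, hpairing]

/-- `g` acts on terms in the root variables as `w` does on the root lattice. Exponents being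
rational, the comparison with `w` takes place on the integral ones. -/
def ActsOnConst (w : T.NS ≃ₗ[ℤ] T.NS) (g : RingAut T.L) : Prop :=
  ∃ e : (T.Root → ℚ) →+ (T.Root → ℚ),
    (∀ x c, g (T.const (algebraMap (T.Puiseux ℂ) T.K (AddMonoidAlgebra.single x c))) =
      T.const (algebraMap (T.Puiseux ℂ) T.K (AddMonoidAlgebra.single (e x) c))) ∧
    ∀ z : T.Root → ℤ, ∃ z' : T.Root → ℤ, e (fun t => (z t : ℚ)) = (fun t => (z' t : ℚ)) ∧
      T.rootSum z' = w (T.rootSum z)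

/-- `g` acts on values of normalized sections as `w` does on classes. -/
def ActsOnTauValues (w : T.NS ≃ₗ[ℤ] T.NS) (g : RingAut T.L) : Prop :=
  ∀ Λ P, T.IsNormalizedSection Λ P → ∃ Q, T.IsNormalizedSection (w Λ) Q ∧
    g (T.tauValue Λ (MvPolynomial.map T.puiseuxToK P)) =
      T.tauValue (w Λ) (MvPolynomial.map T.puiseuxToK Q)

theorem ActsOnConst.mul {w w' : T.NS ≃ₗ[ℤ] T.NS} {g g' : RingAut T.L} (h : ActsOnConst w g)
    (h' : ActsOnConst w' g') : ActsOnConst (w * w') (g * g') := by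
  obtain ⟨e, he, hw⟩ := h
  obtain ⟨e', he', hw'⟩ := h'
  refine ⟨e.comp e', fun x c => ?_, fun z => ?_⟩
  · rw [RingAut.mul_apply, he', he, AddMonoidHom.comp_apply]
  · obtain ⟨y, hzy, hy⟩ := hw' z
    obtain ⟨x, hyx, hx⟩ := hw y
    exact ⟨x, by rw [AddMonoidHom.comp_apply, hzy, hyx], by rw [hx, hy, LinearEquiv.mul_apply]⟩

theorem ActsOnTauValues.mul {w w' : T.NS ≃ₗ[ℤ] T.NS} {g g' : RingAut T.L}
    (h : ActsOnTauValues w g) (h' : ActsOnTauValues w' g') :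
    ActsOnTauValues (w * w') (g * g') := by
  intro Λ P hP
  obtain ⟨Q, hQ, hPQ⟩ := h' Λ P hP
  obtain ⟨R, hR, hQR⟩ := h _ Q hQ
  exact ⟨R, hR, by rw [RingAut.mul_apply, hPQ, hQR, LinearEquiv.mul_apply]⟩

theorem actsOnConst_one : ActsOnConst (1 : T.NS ≃ₗ[ℤ] T.NS) 1 :=
  ⟨AddMonoidHom.id _, fun _ _ => rfl, fun z => ⟨z, rfl, rfl⟩⟩

theorem actsOnTauValues_one : ActsOnTauValues (1 : T.NS ≃ₗ[ℤ] T.NS) 1 :=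
  fun _ P hP => ⟨P, hP, rfl⟩

theorem ActsOnConst.apply_const_of_one {g : RingAut T.L}
    (h : ActsOnConst (1 : T.NS ≃ₗ[ℤ] T.NS) g) (x : T.Root → ℚ) (c : ℂ) :
    g (T.const (algebraMap (T.Puiseux ℂ) T.K (AddMonoidAlgebra.single x c))) =
      T.const (algebraMap (T.Puiseux ℂ) T.K (AddMonoidAlgebra.single x c)) := by
  obtain ⟨e, he, hw⟩ := h
  have hid : e.toRatLinearMap = LinearMap.id := by
    refine LinearMap.pi_ext' fun t => LinearMap.ext_ring ?_
    obtain ⟨z, hz, hzw⟩ := hw (Pi.single t 1)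
    have hcast : (fun u => ((Pi.single t 1 : T.Root → ℤ) u : ℚ)) = Pi.single t 1 := by
      funext u
      exact_mod_cast Pi.apply_single (fun _ (a : ℤ) => (a : ℚ)) (fun _ => Int.cast_zero) t 1 u
    rw [rootSum_injective hzw, hcast] at hz
    exact hz
  have hx : e x = x := LinearMap.congr_fun hid x
  rw [he, hx]

theorem E_mem_M (c : T.Center) : T.E c.1 c.2 ∈ T.M := ⟨1, one_mem _, c, rfl⟩

theorem sW_inv (r : T.Root) : (T.sW r)⁻¹ = T.sW r :=
  inv_eq_of_mul_eq_one_left (Subtype.ext (LinearEquiv.ext (T.s_s r)))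

theorem lift_sW_surjective : Function.Surjective (FreeGroup.lift T.sW) := by
  have hrange : Set.range T.sW = Subtype.val ⁻¹' Set.range T.s := by
    ext w
    exact exists_congr fun r => Subtype.ext_iff
  rw [FreeGroup.lift_surjective_iff_closure_range_eq_top, hrange]
  exact Subgroup.closure_closure_coe_preimage

section Orbit

variable (hT : ∀ n : ZMod T.N, T.k (n - 1) * T.k (n + 1) = T.ℓ (n - 1) * T.ℓ (n + 1))
include hT

theorem ActsOnTauValues.apply_tauVar_of_one {g : RingAut T.L}
    (h : ActsOnTauValues (1 : T.NS ≃ₗ[ℤ] T.NS) g) (c : T.Center) :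
    g (T.tauVar c) = T.tauVar c := by
  obtain ⟨Q, hQ, hval⟩ := h _ _ (T.isNormalizedSection_E c)
  rw [LinearEquiv.coe_one, id_eq] at hQ hval
  rwa [(T.isNormalizedSection_E c).unique hT (E_mem_M c) hQ, map_one, tauValue_E] at hval

theorem eq_one_of_acts {g : RingAut T.L} (h : ActsOnConst (1 : T.NS ≃ₗ[ℤ] T.NS) g)
    (h' : ActsOnTauValues (1 : T.NS ≃ₗ[ℤ] T.NS) g) : g = 1 := by
  have : (g : T.L →+* T.L) = RingHom.id _ :=
    ringHom_L_ext h.apply_const_of_one (h'.apply_tauVar_of_one hT)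
  exact RingEquiv.ext fun x => RingHom.congr_fun this x

theorem sL_sL (r : T.Root) (x : T.L) : T.sL r (T.sL r x) = x := by
  have : (T.sL r).comp (T.sL r) = RingHom.id _ := by
    refine ringHom_L_ext (fun x c => ?_) fun c => ?_
    · simp only [RingHom.comp_apply, sL_const, sK_sK, RingHom.id_apply]
    · obtain ⟨Q, hQ, hEQ⟩ := exists_isNormalizedSection_s hT r (T.isNormalizedSection_E c)
      obtain ⟨R, hR, hQR⟩ := exists_isNormalizedSection_s hT r hQ
      rw [s_s] at hR hQR
      rw [(T.isNormalizedSection_E c).unique hT (E_mem_M c) hR] at hQR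
      rw [map_one, tauValue_E] at hEQ hQR
      rw [RingHom.comp_apply, hEQ, hQR, RingHom.id_apply]
  exact RingHom.congr_fun this x

/-- The birational transformations `s_n^i` as automorphisms of `L`. -/
def sAut (r : T.Root) : RingAut T.L :=
  RingEquiv.ofRingHom (T.sL r) (T.sL r) (RingHom.ext (sL_sL hT r)) (RingHom.ext (sL_sL hT r))

theorem sAut_inv (r : T.Root) : (sAut hT r)⁻¹ = sAut hT r := rfl

theorem actsOnConst_sAut (r : T.Root) : ActsOnConst (T.s r) (sAut hT r) := by
  refine ⟨(T.expAct r : (T.Root → ℚ) →+ (T.Root → ℚ)), fun x c => ?_, fun z =>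
    ⟨_, ?_, (s_rootSum r z).symm⟩⟩
  · exact (T.sL_const r _).trans (by rw [sK_algebraMap_single]; rfl)
  · change T.expAct r _ = _
    rw [expAct_apply]
    funext t
    by_cases h : t = r
    · subst h
      simp
    · simp [h]

theorem actsOnTauValues_sAut (r : T.Root) : ActsOnTauValues (T.s r) (sAut hT r) :=
  fun _ _ hP => exists_isNormalizedSection_s hT r hP

theorem acts_freeGroup (x : FreeGroup T.Root) :
    ActsOnConst (FreeGroup.lift T.sW x).1 (FreeGroup.lift (sAut hT) x) ∧
      ActsOnTauValues (FreeGroup.lift T.sW x).1 (FreeGroup.lift (sAut hT) x) := by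
  induction x using FreeGroup.induction_on with
  | C1 => rw [map_one, map_one]; exact ⟨actsOnConst_one, actsOnTauValues_one⟩
  | of r =>
    rw [FreeGroup.lift_apply_of, FreeGroup.lift_apply_of]
    exact ⟨actsOnConst_sAut hT r, actsOnTauValues_sAut hT r⟩
  | inv_of r _ =>
    rw [map_inv, map_inv, FreeGroup.lift_apply_of, FreeGroup.lift_apply_of, sAut_inv, sW_inv]
    exact ⟨actsOnConst_sAut hT r, actsOnTauValues_sAut hT r⟩
  | mul x y hx hy =>
    rw [map_mul, map_mul]
    exact ⟨hx.1.mul hy.1, hx.2.mul hy.2⟩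

theorem ker_lift_sW_le : (FreeGroup.lift T.sW).ker ≤ (FreeGroup.lift (sAut hT)).ker := by
  intro x hx
  rw [MonoidHom.mem_ker] at hx ⊢
  have h := acts_freeGroup hT x
  rw [hx] at h
  exact eq_one_of_acts hT h.1 h.2

theorem exists_isWeylAction : ∃ ρ : T.W →* RingAut T.L, T.IsWeylAction ρ := by
  refine ⟨(FreeGroup.lift T.sW).liftOfSurjective lift_sW_surjective
    ⟨FreeGroup.lift (sAut hT), ker_lift_sW_le hT⟩, fun r x => ?_⟩
  have h := MonoidHom.liftOfRightInverse_comp_apply (FreeGroup.lift T.sW) _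
    (Function.rightInverse_surjInv lift_sW_surjective)
    ⟨FreeGroup.lift (sAut hT), ker_lift_sW_le hT⟩ (FreeGroup.of r)
  simp only [FreeGroup.lift_apply_of] at h
  rw [MonoidHom.liftOfSurjective, h]
  rfl

theorem IsWeylAction.actsOnTauValues {ρ : T.W →* RingAut T.L} (hρ : T.IsWeylAction ρ) (w : T.W) :
    ActsOnTauValues w.1 (ρ w) := by
  obtain ⟨x, rfl⟩ := lift_sW_surjective w
  have hcomp : ρ.comp (FreeGroup.lift T.sW) = FreeGroup.lift (sAut hT) := by
    refine FreeGroup.ext_hom _ _ fun r => ?_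
    rw [MonoidHom.comp_apply, FreeGroup.lift_apply_of, FreeGroup.lift_apply_of]
    exact RingEquiv.ext (hρ r)
  have h := (acts_freeGroup hT x).2
  rwa [← hcomp] at h

theorem exists_isTauFunction {ρ : T.W →* RingAut T.L} (hρ : T.IsWeylAction ρ) :
    ∃ τ : T.M → T.L, T.IsTauFunction ρ τ := by
  choose P hP using fun Λ : T.M => exists_isNormalizedSection hT Λ.2
  refine ⟨fun Λ => T.tauValue Λ (MvPolynomial.map T.puiseuxToK (P Λ)), fun c Λ h => ?_,
    fun w Λ Λ' h => ?_⟩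
  · have hE := T.isNormalizedSection_E c
    rw [← h] at hE
    rw [hE.unique hT Λ.2 (hP Λ), map_one, h, tauValue_E]
  · obtain ⟨Q, hQ, hval⟩ := hρ.actsOnTauValues hT w Λ (P Λ) (hP Λ)
    rw [← h] at hQ hval
    rw [hval, (hP Λ').unique hT Λ'.2 hQ]

theorem IsTauFunction.eq_tauValue {ρ : T.W →* RingAut T.L} (hρ : T.IsWeylAction ρ)
    {τ : T.M → T.L} (hτ : T.IsTauFunction ρ τ) (Λ : T.M) :
    ∃ P, T.IsNormalizedSection Λ P ∧
      τ Λ = T.tauValue Λ (MvPolynomial.map T.puiseuxToK P) := by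
  obtain ⟨w, hw, c, h⟩ := Λ.2
  obtain ⟨Q, hQ, hval⟩ := hρ.actsOnTauValues hT ⟨w, hw⟩ _ _ (T.isNormalizedSection_E c)
  rw [map_one, tauValue_E] at hval
  dsimp only at hQ hval
  rw [← h] at hQ hval
  refine ⟨Q, hQ, ?_⟩
  rw [← hval, hτ.equivariant ⟨w, hw⟩ ⟨T.E c.1 c.2, E_mem_M c⟩ Λ h, hτ.exceptional c _ rfl]

end Orbit

/-! ### The Laurent phenomenon -/

theorem tau_mem_laurent (n : ZMod T.N) (i : ℤ) : T.tau n i ∈ T.laurent := by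
  unfold tau
  split_ifs
  · exact Algebra.subset_adjoin (Or.inl ⟨_, rfl⟩)
  · exact one_mem _

theorem zeta_mem_laurent (z : T.Coord) : T.zeta z ∈ T.laurent := by
  have hξ : ∀ n, T.ξ n ∈ T.laurent := fun n => prod_mem fun _ _ => tau_mem_laurent _ _
  have hη : ∀ n, T.η n ∈ T.laurent := fun n => prod_mem fun _ _ => tau_mem_laurent _ _
  unfold zeta
  split_ifs <;> exact mul_mem (hξ _) (hη _)

theorem tauVar_zpow_mem_laurent (c : T.Center) (a : ℤ) : T.tauVar c ^ a ∈ T.laurent := by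
  rcases Int.eq_nat_or_neg a with ⟨j, rfl | rfl⟩
  · rw [zpow_natCast]
    exact pow_mem (Algebra.subset_adjoin (Or.inl ⟨c, rfl⟩) : T.tauVar c ∈ T.laurent) j
  · rw [zpow_neg, zpow_natCast, ← inv_pow]
    exact pow_mem (Algebra.subset_adjoin (Or.inr ⟨c, rfl⟩) : (T.tauVar c)⁻¹ ∈ T.laurent) j

theorem tauValue_mem_laurent (Λ : T.NS) (f : MvPolynomial T.Coord T.K) :
    T.tauValue Λ f ∈ T.laurent := by
  rw [tauValue, div_eq_mul_inv]
  refine mul_mem ?_ ?_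
  · have h : Algebra.adjoin T.K (Set.range T.zeta) ≤ T.laurent :=
      Algebra.adjoin_le (Set.range_subset_iff.2 zeta_mem_laurent)
    rw [Algebra.adjoin_range_eq_range_aeval] at h
    exact h ⟨f, rfl⟩
  · rw [multTau, ← Finset.prod_inv_distrib]
    refine prod_mem fun c _ => ?_
    rw [← zpow_neg]
    exact tauVar_zpow_mem_laurent c _

end WeylAction

end TropicalDatum

end

theorem theorem3p2 (T : TropicalDatum)
    (hT : ∀ n : ZMod T.N, T.k (n - 1) * T.k (n + 1) = T.ℓ (n - 1) * T.ℓ (n + 1)) :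
    (∃ (ρ : T.W →* RingAut T.L) (τ : T.M → T.L), T.IsWeylAction ρ ∧ T.IsTauFunction ρ τ) ∧
    ∀ (ρ : T.W →* RingAut T.L) (τ : T.M → T.L), T.IsWeylAction ρ → T.IsTauFunction ρ τ →
      ∀ Λ : T.M,
        Module.finrank T.K (T.linearSystem (Λ : T.NS)) = 1 ∧
        (∃! Φ, T.IsNormalizedDefiningPolynomial (Λ : T.NS) Φ) ∧
        (∀ Φ, T.IsNormalizedDefiningPolynomial (Λ : T.NS) Φ →
          τ Λ * ∏ c : T.Center, T.tauVar c ^ T.mult (Λ : T.NS) c =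
            MvPolynomial.aeval T.zeta Φ) ∧
        τ Λ ∈ T.laurent := by
  obtain ⟨ρ₀, hρ₀⟩ := TropicalDatum.exists_isWeylAction hT
  obtain ⟨τ₀, hτ₀⟩ := TropicalDatum.exists_isTauFunction hT hρ₀
  refine ⟨⟨ρ₀, τ₀, hρ₀, hτ₀⟩, fun ρ τ hρ hτ Λ => ?_⟩
  obtain ⟨P, hP, hval⟩ := hτ.eq_tauValue hT hρ Λ
  have hiff := TropicalDatum.isNormalizedDefiningPolynomial_iff hT Λ.2 hP
  refine ⟨TropicalDatum.finrank_linearSystem hT Λ.2,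
    ⟨_, (hiff _).2 rfl, fun Φ => (hiff Φ).1⟩, fun Φ hΦ => ?_, ?_⟩
  · rw [hval, (hiff Φ).1 hΦ]
    exact div_mul_cancel₀ _ (T.multTau_ne_zero Λ)
  · rw [hval]
    exact TropicalDatum.tauValue_mem_laurent _ _
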